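/- \textbf{Setting.} Let $G$ be a Lie group with Lie algebra $\mathfrak g$, let $(\cdot,\cdot)$ be an $\mathrm{Ad}$-invariant positive definite inner product on $\mathfrak g$ (used to identify $\mathfrak g^*\cong\mathfrak g$), let $\theta^l,\theta^r$ be the left- and right-invariant Maurer–Cartan forms, $\chi=\frac1{12}(\theta^l,[\theta^l,\theta^l])\in\Omega^3(G)$, and $$\varpi=\frac12\int_0^1\Big(\exp_s^*\theta^r,\frac{\partial}{\partial s}\exp_s^*\theta^r\Big)\,ds\in\Omega^2(\mathfrak g),\qquad \exp_s(\eta)=\exp(s\eta).$$ Let $M$ be a smooth manifold, $Z\subset M$ a (possibly empty) closed embedded hypersurface, $f$ a defining function of $Z$ on a neighbourhood of $Z$, and $m\ge 1$. The $b^m$-tangent bundle ${}^{b^m}TM$ is the bundle whose sections are the vector fields $v$ with $v(f)\in f^mC^\infty$ near $Z$; $b^m$-forms are smooth sections of exterior powers of its dual (near $Z$: $\frac{df}{f^m}\wedge\alpha+\beta$ with $\alpha,\beta$ smooth); a $b^m$-function is smooth off $Z$ and locally near $Z$ of the form $\sum_{i=1}^{m-1}f^{-i}c_i(f)+a\log|f|+h$,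 with $c_i$ smooth functions of one variable, $a$ constant and $h$ smooth. Let $G$ act smoothly on $M$, preserving $Z$, with fundamental vector fields $\upsilon_\xi(x)=\frac{d}{dt}\big|_{0}\exp(t\xi)x$. A \emph{$b^m$-Hamiltonian $G$-space} is such an $M$ with an invariant closed $b^m$-form $\omega$ of degree 2, non-degenerate on ${}^{b^m}TM$, and an equivariant $\mathfrak g$-valued $b^m$-function $\mu$ with $\iota(\upsilon_\xi)\omega=d(\mu,\xi)$ for all $\xi\in\mathfrak g$. A \emph{$b^m$-quasi-Hamiltonian $G$-space} is such an $M$ with an invariant $b^m$-form $\sigma$ of degree 2 and a map $\Phi:M\setminus Z\to G$, smooth, equivariant for conjugation, and with $\Phi^*\theta^l$ extending over $Z$ as a $\mathfrak g$-valued $b^m$-form, such that (i) $d\sigma=-\Phi^*\chi$; (ii) $\iota(\upsilon_\xi)\sigma=\frac12\Phi^*(\theta^l+\theta^r,\xi)$ for all $\xi\in\mathfrak g$; (iii) $\ker\sigma_x\cap\ker d_x\Phi=0$ in ${}^{b^m}T_xM$ for all $x\in M$, where for $x\in Z$ the kernel of $d_x\Phi$ is the kernel of the extension of $\Phi^*\theta^l$.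 For $Z=\emptyset$ these are the usual Hamiltonian and quasi-Hamiltonian $G$-spaces. \textbf{Lemma.} Let $(M,\omega,\mu)$ be a $b^m$-Hamiltonian $G$-space. Then $\omega+\mu^*\varpi$, defined on $M\setminus Z$, extends to a $b^m$-form $\sigma$ on $M$, and $M$ with $\sigma$ and $\Phi=\exp\circ\mu$ satisfies all axioms of a $b^m$-quasi-Hamiltonian $G$-space except possibly the non-degeneracy condition (iii). If $d_{\mu(x)}\exp$ is bijective for all $x\in M\setminus Z$, then (iii) holds at all points of $M\setminus Z$. If moreover the same holds at the values at infinity that $\mu$ takes on $Z$, that is, for every $p\in Z$ the left-trivialized differential $\theta^l\circ d_{\mu(x)}\exp\in\mathrm{End}(\mathfrak g)$ has a bijective limit as $x\to p$, $x\notin Z$, then (iii) holds on all of $M$ and $(M,\sigma,\Phi)$ is a $b^m$-quasi-Hamiltonian $G$-space. -/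

import Mathlib

open scoped Manifold ContDiff Topology
open Set Filter

noncomputable section

namespace BmQH

/-! ### Differential forms on a manifold -/

section Forms

/-- A (not necessarily smooth) `k`-form on `M` with values in `W`. -/
abbrev DForm (E M : Type*) [NormedAddCommGroup E] [NormedSpace ℝ E] [TopologicalSpace M]
    [ChartedSpace E M] (k : ℕ) (W : Type*) [NormedAddCommGroup W] [NormedSpace ℝ W] :=
  ∀ x : M, TangentSpace 𝓘(ℝ, E) x [⋀^Fin k]→L[ℝ] W

variable {E M : Type*} [NormedAddCommGroup E] [NormedSpace ℝ E] [TopologicalSpace M]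
  [ChartedSpace E M] {k : ℕ} {W : Type*} [NormedAddCommGroup W] [NormedSpace ℝ W]

/-- The expression of a form in the preferred chart around `x₀`: the pullback of the form under
the inverse of the chart. -/
def chartRep (ω₀ : DForm E M k W) (x₀ : M) (y : E) : E [⋀^Fin k]→L[ℝ] W :=
  (ω₀ ((extChartAt 𝓘(ℝ, E) x₀).symm y)).compContinuousLinearMap
    (mfderiv 𝓘(ℝ, E) 𝓘(ℝ, E) (extChartAt 𝓘(ℝ, E) x₀).symm y)

/-- A form is smooth at `x` if its expression in the chart around `x` is. -/
def SmoothFormAt (ω₀ : DForm E M k W) (x : M) : Prop :=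
  ContDiffAt ℝ ∞ (chartRep ω₀ x) (extChartAt 𝓘(ℝ, E) x x)

/-- The exterior derivative, computed in the chart around each point. -/
def extD (ω₀ : DForm E M k W) : DForm E M (k + 1) W := fun x =>
  (extDeriv (chartRep ω₀ x) (extChartAt 𝓘(ℝ, E) x x)).compContinuousLinearMap
    (mfderiv 𝓘(ℝ, E) 𝓘(ℝ, E) (extChartAt 𝓘(ℝ, E) x) x)

end Forms

/-! ### `b^m`-manifolds and the `b^m`-tangent bundle -/

/-- A `b^m`-manifold structure on `M`: a closed embedded hypersurface `Z` together with a
defining function `f` of `Z`, smooth on an open neighbourhood `U` of `Z` (the values of `f`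
outside `U` are irrelevant), and the order `m ≥ 1`. -/
structure BmStructure (E M : Type*) [NormedAddCommGroup E] [NormedSpace ℝ E]
    [TopologicalSpace M] [ChartedSpace E M] where
  Z : Set M
  U : Set M
  f : M → ℝ
  m : ℕ
  one_le_m : 1 ≤ m
  isClosed_Z : IsClosed Z
  isOpen_U : IsOpen U
  Z_subset_U : Z ⊆ U
  mem_Z_iff : ∀ x ∈ U, x ∈ Z ↔ f x = 0
  smooth_f : ContMDiffOn 𝓘(ℝ, E) 𝓘(ℝ) ∞ f U
  mfderiv_f_ne_zero : ∀ x ∈ Z, mfderiv 𝓘(ℝ, E) 𝓘(ℝ) f x ≠ 0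

namespace BmStructure

variable {E M : Type*} [NormedAddCommGroup E] [NormedSpace ℝ E]
  [TopologicalSpace M] [ChartedSpace E M] (B : BmStructure E M)

/-- The differential of the defining function. -/
def df (x : M) : TangentSpace 𝓘(ℝ, E) x →L[ℝ] ℝ := mfderiv 𝓘(ℝ, E) 𝓘(ℝ) B.f x

/-- The fibre of the `b^m`-tangent bundle at `x`. Near `Z` it consists of the pairs `(s, v)` with
`df v = f ^ m * s`; its smooth sections are the pairs `(s, v)` where `v` is a vector field with
`v(f) = f ^ m s`, i.e. the `b^m`-vector fields. The pair `(1, 0)` at a point of `Z` is the value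
of `f ^ m ∂/∂f`. The anchor to the tangent space is `(s, v) ↦ v`, which is bijective off `Z`. -/
def tangent (x : M) : Submodule ℝ (ℝ × TangentSpace 𝓘(ℝ, E) x) where
  carrier := {e | (x ∈ B.U → B.df x e.2 = B.f x ^ B.m * e.1) ∧ (x ∉ B.U → e.1 = 0)}
  add_mem' := by
    rintro a b ⟨ha, ha'⟩ ⟨hb, hb'⟩
    refine ⟨fun h => ?_, fun h => ?_⟩
    · rw [Prod.snd_add, map_add, ha h, hb h, Prod.fst_add]; ring
    · rw [Prod.fst_add, ha' h, hb' h, add_zero]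
  zero_mem' := by
    refine ⟨fun _ => ?_, fun _ => rfl⟩
    rw [Prod.snd_zero, map_zero, Prod.fst_zero, mul_zero]
  smul_mem' := by
    rintro c a ⟨ha, ha'⟩
    refine ⟨fun h => ?_, fun h => ?_⟩
    · rw [Prod.smul_snd, map_smul, ha h, Prod.smul_fst, smul_eq_mul, smul_eq_mul]; ring
    · rw [Prod.smul_fst, ha' h, smul_zero]

/-- The first coordinate `s` of a `b^m`-tangent vector, i.e. the value of the `b^m`-form
`df / f ^ m` on it. -/
def coeff {x : M} (e : B.tangent x) : ℝ := e.1.1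

/-- The anchor map from the `b^m`-tangent bundle to the tangent bundle. -/
def anchor {x : M} (e : B.tangent x) : TangentSpace 𝓘(ℝ, E) x := e.1.2

open Classical in
/-- The pair attached to a tangent vector at a point off `Z`. -/
def liftAux (x : M) : TangentSpace 𝓘(ℝ, E) x →L[ℝ] ℝ × TangentSpace 𝓘(ℝ, E) x :=
  ((if x ∈ B.U then (B.f x ^ B.m)⁻¹ else 0) • B.df x).prod
    (ContinuousLinearMap.id ℝ (TangentSpace 𝓘(ℝ, E) x))

open Classical in
theorem liftAux_mem {x : M} (hx : x ∉ B.Z) (v : TangentSpace 𝓘(ℝ, E) x) :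
    B.liftAux x v ∈ B.tangent x := by
  refine ⟨fun h => ?_, fun h => ?_⟩
  · have h0 : B.f x ^ B.m ≠ 0 := pow_ne_zero _ fun h0 => hx ((B.mem_Z_iff x h).2 h0)
    change B.df x v = B.f x ^ B.m * ((if x ∈ B.U then (B.f x ^ B.m)⁻¹ else 0) * B.df x v)
    rw [if_pos h, mul_inv_cancel_left₀ h0]
  · change (if x ∈ B.U then (B.f x ^ B.m)⁻¹ else 0) * B.df x v = 0
    rw [if_neg h, zero_mul]

open Classical in
/-- The inverse of the anchor at a point off `Z` (and `0` at the points of `Z`). -/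
def lift (x : M) : TangentSpace 𝓘(ℝ, E) x →L[ℝ] B.tangent x :=
  if hx : x ∉ B.Z then (B.liftAux x).codRestrict (B.tangent x) (B.liftAux_mem hx) else 0

theorem anchor_lift {x : M} (hx : x ∉ B.Z) (v : TangentSpace 𝓘(ℝ, E) x) :
    B.anchor (B.lift x v) = v := by
  simp only [anchor, lift, dif_pos hx]
  rfl

open Classical in
theorem lift_anchor {x : M} (hx : x ∉ B.Z) (e : B.tangent x) :
    B.lift x (B.anchor e) = e := by
  apply Subtype.ext
  refine Prod.ext ?_ (B.anchor_lift hx _)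
  simp only [lift, dif_pos hx]
  change (if x ∈ B.U then (B.f x ^ B.m)⁻¹ else 0) * B.df x e.1.2 = e.1.1
  by_cases h : x ∈ B.U
  · have h0 : B.f x ^ B.m ≠ 0 := pow_ne_zero _ fun h0 => hx ((B.mem_Z_iff x h).2 h0)
    rw [if_pos h, e.2.1 h, inv_mul_cancel_left₀ h0]
  · rw [if_neg h, zero_mul, e.2.2 h]

/-- A (not necessarily smooth) `b^m`-form of degree `k` with values in `W`: an alternating form
on every fibre of the `b^m`-tangent bundle. -/
abbrev BmForm (k : ℕ) (W : Type*) [NormedAddCommGroup W] [NormedSpace ℝ W] :=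
  ∀ x : M, B.tangent x [⋀^Fin k]→L[ℝ] W

/-- The ordinary form on `M \ Z` given by a `b^m`-form (with value `0` at the points of `Z`,
which is never used). -/
def offZ {k : ℕ} {W : Type*} [NormedAddCommGroup W] [NormedSpace ℝ W] (σ : B.BmForm k W) :
    DForm E M k W := fun x => (σ x).compContinuousLinearMap (B.lift x)

/-- Smooth `b^m`-forms of degree 2: smooth off `Z`, and near every point of `Z` of the form
`(df / f ^ m) ∧ α + β` with a smooth 1-form `α` and a smooth 2-form `β`. -/
def IsSmooth₂ (σ : B.BmForm 2 ℝ) : Prop :=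
  (∀ x ∉ B.Z, SmoothFormAt (B.offZ σ) x) ∧
  ∀ p ∈ B.Z, ∃ (α : DForm E M 1 ℝ) (β : DForm E M 2 ℝ), ∀ᶠ x in 𝓝 p,
    SmoothFormAt α x ∧ SmoothFormAt β x ∧ ∀ e e' : B.tangent x,
      σ x ![e, e'] = B.coeff e * α x ![B.anchor e'] - B.coeff e' * α x ![B.anchor e] +
        β x ![B.anchor e, B.anchor e']

/-- Smooth `b^m`-forms of degree 1 with values in a vector space `W`: smooth off `Z`, and near
every point of `Z` of the form `(df / f ^ m) a + β` with a smooth function `a` and a smooth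
1-form `β`. -/
def IsSmooth₁ {W : Type*} [NormedAddCommGroup W] [NormedSpace ℝ W] (τ : B.BmForm 1 W) : Prop :=
  (∀ x ∉ B.Z, SmoothFormAt (B.offZ τ) x) ∧
  ∀ p ∈ B.Z, ∃ (a : M → W) (β : DForm E M 1 W), ∀ᶠ x in 𝓝 p,
    ContMDiffAt 𝓘(ℝ, E) 𝓘(ℝ, W) ∞ a x ∧ SmoothFormAt β x ∧ ∀ e : B.tangent x,
      τ x ![e] = B.coeff e • a x + β x ![B.anchor e]

/-- `b^m`-functions with values in a vector space `W`: smooth off `Z`, and near every point of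
`Z` equal, off `Z`, to `∑ f ^ (-i) cᵢ(f) + log |f| a + h` (sum over `1 ≤ i ≤ m - 1`), where the
`cᵢ` are smooth functions of one variable, `a` is constant and `h` is smooth. The values on `Z`
(where the function is infinite) are irrelevant. -/
def IsBmFunction {W : Type*} [NormedAddCommGroup W] [NormedSpace ℝ W] (μ : M → W) : Prop :=
  ContMDiffOn 𝓘(ℝ, E) 𝓘(ℝ, W) ∞ μ B.Zᶜ ∧
  ∀ p ∈ B.Z, ∃ (c : ℕ → ℝ → W) (a : W) (h : M → W), (∀ i, ContDiff ℝ ∞ (c i)) ∧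
    ∀ᶠ x in 𝓝 p, ContMDiffAt 𝓘(ℝ, E) 𝓘(ℝ, W) ∞ h x ∧
      (x ∉ B.Z → μ x = ∑ i ∈ Finset.Icc 1 (B.m - 1), (B.f x ^ i)⁻¹ • c i (B.f x) +
        Real.log |B.f x| • a + h x)

end BmStructure

/-! ### Lie groups

The Lie algebra of `G` is its tangent space at `1`, which is the model space `F`; elements of the
Lie algebra are therefore written as elements of `F`. -/

section LieGroup

variable {F G : Type*} [NormedAddCommGroup F] [NormedSpace ℝ F]
  [TopologicalSpace G] [ChartedSpace F G] [Group G]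

variable (G) in
/-- The Lie bracket of the Lie algebra of `G`. -/
def bracket (ξ η : F) : F :=
  (⁅(show GroupLieAlgebra 𝓘(ℝ, F) G from ξ), (show GroupLieAlgebra 𝓘(ℝ, F) G from η)⁆ :
    GroupLieAlgebra 𝓘(ℝ, F) G)

open Classical in
variable (G) in
/-- The exponential map: `lieExp G ξ = γ 1` for the integral curve `γ` through `1` of the
left-invariant vector field with value `ξ` at `1`. -/
def lieExp (ξ : F) : G :=
  if h : ∃ γ : ℝ → G, γ 0 = 1 ∧
      IsMIntegralCurve γ (fun g : G =>
        mulInvariantVectorField (I := 𝓘(ℝ, F)) (show GroupLieAlgebra 𝓘(ℝ, F) G from ξ) g)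
  then h.choose 1 else 1

/-- The adjoint action of `G` on its Lie algebra. -/
def Ad (g : G) : F →L[ℝ] F := mfderiv 𝓘(ℝ, F) 𝓘(ℝ, F) (fun h : G => g * h * g⁻¹) 1

/-- The left-invariant Maurer-Cartan form. -/
def thetaL (g : G) : TangentSpace 𝓘(ℝ, F) g →L[ℝ] F :=
  mfderiv 𝓘(ℝ, F) 𝓘(ℝ, F) (fun h : G => g⁻¹ * h) g

/-- The right-invariant Maurer-Cartan form. -/
def thetaR (g : G) : TangentSpace 𝓘(ℝ, F) g →L[ℝ] F :=
  mfderiv 𝓘(ℝ, F) 𝓘(ℝ, F) (fun h : G => h * g⁻¹) g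

variable (G) in
/-- `b` is an invariant positive definite inner product on the Lie algebra of `G`. -/
structure IsInvariantInner (b : F →L[ℝ] F →L[ℝ] ℝ) : Prop where
  symm : ∀ ξ η, b ξ η = b η ξ
  pos : ∀ ξ, ξ ≠ 0 → 0 < b ξ ξ
  invariant : ∀ (g : G) (ξ η : F), b (Ad g ξ) (Ad g η) = b ξ η

/-- The 3-form `χ = (1/12) (θ, [θ, θ])` on `G`, where `θ` is the left-invariant Maurer-Cartan form;
here `[θ, θ](v, w) = 2 [θ v, θ w]` and the 1-form `θ` is wedged with the 2-form `[θ, θ]`. -/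
def chi (b : F →L[ℝ] F →L[ℝ] ℝ) (g : G) (u v w : TangentSpace 𝓘(ℝ, F) g) : ℝ :=
  (1 / 12) *
    (b (thetaL g u) ((2 : ℝ) • bracket G (thetaL g v) (thetaL g w)) +
     b (thetaL g v) ((2 : ℝ) • bracket G (thetaL g w) (thetaL g u)) +
     b (thetaL g w) ((2 : ℝ) • bracket G (thetaL g u) (thetaL g v)))

variable (G) in
/-- The value at `η` on `X` of the pullback of the right-invariant Maurer-Cartan form under
`exp_s : η ↦ exp (s η)`. -/
def expPullback (s : ℝ) (η X : F) : F :=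
  thetaR (lieExp G (s • η)) (mfderiv 𝓘(ℝ, F) 𝓘(ℝ, F) (fun ζ : F => lieExp G (s • ζ)) η X)

variable (G) in
/-- The 2-form `ϖ = (1/2) ∫₀¹ (exp_s^* θ, ∂/∂s exp_s^* θ) ds` on the Lie algebra, where `θ` is the
right-invariant Maurer-Cartan form, evaluated at `η` on the vectors `X`, `Y`. -/
def varpi (b : F →L[ℝ] F →L[ℝ] ℝ) (η X Y : F) : ℝ :=
  (1 / 2) * ∫ s in (0 : ℝ)..1,
    (b (expPullback G s η X) (deriv (fun r => expPullback G r η Y) s) -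
     b (expPullback G s η Y) (deriv (fun r => expPullback G r η X) s))

variable (G) in
/-- The differential of the exponential map at `ξ`. -/
def dexp (ξ : F) : TangentSpace 𝓘(ℝ, F) ξ →L[ℝ] TangentSpace 𝓘(ℝ, F) (lieExp G ξ) :=
  mfderiv 𝓘(ℝ, F) 𝓘(ℝ, F) (lieExp G) ξ

variable (G) in
/-- The left-trivialized differential of the exponential map at `ξ`. -/
def dexpL (ξ : F) : F →L[ℝ] F := (thetaL (lieExp G ξ)).comp (dexp G ξ)

end LieGroup

/-! ### Actions, Hamiltonian and quasi-Hamiltonian spaces -/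

section Spaces

variable {E M F G : Type*} [NormedAddCommGroup E] [NormedSpace ℝ E]
  [TopologicalSpace M] [ChartedSpace E M]
  [NormedAddCommGroup F] [NormedSpace ℝ F]
  [TopologicalSpace G] [ChartedSpace F G] [Group G] [MulAction G M]

variable (E G) in
/-- The fundamental vector field `x ↦ d/dt exp(tξ) x` at `t = 0`, i.e. the image of `ξ` under the
differential at `1` of the orbit map. -/
def fundVF (ξ : F) (x : M) : TangentSpace 𝓘(ℝ, E) x :=
  (mfderiv 𝓘(ℝ, F) 𝓘(ℝ, E) (fun g : G => g • x) 1 : F →L[ℝ] E) ξ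

variable (B : BmStructure E M)

variable (G) in
/-- Invariance of a `b^m`-form of degree 2 under the action (expressed on the dense open set
`M \ Z`). -/
def IsInvariantForm (σ : B.BmForm 2 ℝ) : Prop :=
  ∀ (g : G), ∀ x ∉ B.Z, ∀ u v : TangentSpace 𝓘(ℝ, E) x,
    B.offZ σ (g • x) ![mfderiv 𝓘(ℝ, E) 𝓘(ℝ, E) (fun y : M => g • y) x u,
      mfderiv 𝓘(ℝ, E) 𝓘(ℝ, E) (fun y : M => g • y) x v] = B.offZ σ x ![u, v]

variable (G) in
/-- A `b^m`-Hamiltonian `G`-space: `ω₀` is a `b^m`-symplectic form (smooth, closed and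
non-degenerate on the whole `b^m`-tangent bundle), the action preserves `Z` and `ω₀`, and `μ` is an
equivariant `b^m`-moment map, with values in the Lie algebra, identified with its dual by means of
the inner product `b`. Identities between `b^m`-forms are expressed on the dense open set
`M \ Z`. For `Z = ∅` this is a Hamiltonian `G`-space. -/
structure IsBmHamiltonian (b : F →L[ℝ] F →L[ℝ] ℝ) (ω₀ : B.BmForm 2 ℝ) (μ : M → F) : Prop where
  smul_mem_Z : ∀ (g : G), ∀ x ∈ B.Z, g • x ∈ B.Z
  smooth : B.IsSmooth₂ ω₀
  closed : ∀ x ∉ B.Z, extD (B.offZ ω₀) x = 0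
  nondegenerate : ∀ (x : M) (e : B.tangent x), (∀ e', ω₀ x ![e, e'] = 0) → e = 0
  invariant : IsInvariantForm G B ω₀
  isBmFunction : B.IsBmFunction μ
  equivariant : ∀ (g : G), ∀ x ∉ B.Z, μ (g • x) = Ad g (μ x)
  moment : ∀ (ξ : F), ∀ x ∉ B.Z, ∀ v : TangentSpace 𝓘(ℝ, E) x,
    B.offZ ω₀ x ![fundVF E G ξ x, v] = b (mfderiv 𝓘(ℝ, E) 𝓘(ℝ, F) μ x v) ξ

/-- `τ` is the `b^m`-form `Φ^* θ` for the left-invariant Maurer-Cartan form `θ`: a smooth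
`b^m`-form that is equal to the pullback off `Z`. Such a `τ` is unique. -/
def IsPullbackMC (Φ : M → G) (τ : B.BmForm 1 F) : Prop :=
  B.IsSmooth₁ τ ∧ ∀ x ∉ B.Z, ∀ v : TangentSpace 𝓘(ℝ, E) x,
    B.offZ τ x ![v] = thetaL (F := F) (Φ x) (mfderiv 𝓘(ℝ, E) 𝓘(ℝ, F) Φ x v)

/-- The axioms of a `b^m`-quasi-Hamiltonian `G`-space except non-degeneracy. The group-valued
moment map `Φ` is defined and smooth off `Z` (its values on `Z` are irrelevant), with a
singularity of `b^m`-type along `Z`: its logarithmic derivative `Φ^* θ` is a smooth `b^m`-form. -/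
structure IsBmPreQuasiHamiltonian (b : F →L[ℝ] F →L[ℝ] ℝ) (σ : B.BmForm 2 ℝ) (Φ : M → G) :
    Prop where
  smul_mem_Z : ∀ (g : G), ∀ x ∈ B.Z, g • x ∈ B.Z
  smooth : B.IsSmooth₂ σ
  invariant : IsInvariantForm G B σ
  smooth_map : ContMDiffOn 𝓘(ℝ, E) 𝓘(ℝ, F) ∞ Φ B.Zᶜ
  singular_map : ∃ τ : B.BmForm 1 F, IsPullbackMC B Φ τ
  equivariant : ∀ (g : G), ∀ x ∉ B.Z, Φ (g • x) = g * Φ x * g⁻¹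
  equivariantly_closed : ∀ x ∉ B.Z, ∀ u v w : TangentSpace 𝓘(ℝ, E) x,
    extD (B.offZ σ) x ![u, v, w] = - chi (F := F) b (Φ x) (mfderiv 𝓘(ℝ, E) 𝓘(ℝ, F) Φ x u)
      (mfderiv 𝓘(ℝ, E) 𝓘(ℝ, F) Φ x v) (mfderiv 𝓘(ℝ, E) 𝓘(ℝ, F) Φ x w)
  moment : ∀ (ξ : F), ∀ x ∉ B.Z, ∀ v : TangentSpace 𝓘(ℝ, E) x,
    B.offZ σ x ![fundVF E G ξ x, v] =
      (1 / 2) * b (thetaL (F := F) (Φ x) (mfderiv 𝓘(ℝ, E) 𝓘(ℝ, F) Φ x v) +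
        thetaR (F := F) (Φ x) (mfderiv 𝓘(ℝ, E) 𝓘(ℝ, F) Φ x v)) ξ

variable (F) in
/-- Weak non-degeneracy `ker σ ∩ ker dΦ = 0` in the fibre at `x` of the `b^m`-tangent bundle. A
`b^m`-tangent vector is in the kernel of `dΦ` if the `b^m`-form `Φ^* θ` vanishes on it; off `Z` this
is the usual kernel, because `θ` is an isomorphism on each tangent space of `G`. -/
def WeaklyNondegenerateAt (σ : B.BmForm 2 ℝ) (Φ : M → G) (x : M) : Prop :=
  ∀ e : B.tangent x, (∀ e', σ x ![e, e'] = 0) →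
    (∃ τ : B.BmForm 1 F, IsPullbackMC B Φ τ ∧ τ x ![e] = 0) → e = 0

/-- A `b^m`-quasi-Hamiltonian `G`-space. For `Z = ∅` this is a quasi-Hamiltonian `G`-space. -/
structure IsBmQuasiHamiltonian (b : F →L[ℝ] F →L[ℝ] ℝ) (σ : B.BmForm 2 ℝ) (Φ : M → G) : Prop
    extends IsBmPreQuasiHamiltonian B b σ Φ where
  nondegenerate : ∀ x : M, WeaklyNondegenerateAt F B σ Φ x

variable (G) in
/-- The differential of `exp` is bijective at every point of `μ(M \ Z)`. -/
def DexpBijectiveOffZ (μ : M → F) : Prop :=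
  ∀ x ∉ B.Z, Function.Bijective (dexp G (μ x))

variable (G) in
/-- The differential of `exp` is bijective at the values at infinity that `μ` takes on `Z`: at
`p ∈ Z` the differential is understood as the limit, for `x → p` off `Z`, of the left-trivialized
differential of `exp` at `μ x`. -/
def DexpBijectiveOnZ (μ : M → F) : Prop :=
  ∀ p ∈ B.Z, ∃ T : F →L[ℝ] F,
    Tendsto (fun x => dexpL G (μ x)) (𝓝[B.Zᶜ] p) (𝓝 T) ∧ Function.Bijective T

end Spaces

end BmQH

end

/-! Everything is governed by the operator `ad η`. Write `A = ad η`, `φ₁(A) = ∫₀¹ exp(rA) dr` and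
`φ₂(A) = ∫₀¹ (1 - r) exp(rA) dr`. The right- and left-trivialized differentials of `exp` at `η` are
`φ₁(A)` and `φ₁(-A)`, and integrating the definition of `ϖ` gives `ϖ_η(X, Y) = ½ ((φ₂(-A) - φ₂(A))
X, Y)`. Hence `Φ^*θ^l = φ₁(-ad μ) ∘ dμ`, and `μ^*ϖ` is obtained by inserting `dμ` twice into a
2-form that depends on `ad μ` alone: `μ` enters only through `dμ` and `ad μ`.

Both of these extend over `Z`. The differential of the singular part of `μ` has a pole of order at
most `m` in `f`, so `dμ` is a smooth `b^m`-form (`exists_differential_of_isBmFunction`). The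
operator `ad μ` extends to a smooth function although `μ` blows up
(`IsBmHamiltonian.exists_local_ad`): non-degeneracy of `ω₀` turns `(dμ, ξ)` into a smooth section of
the `b^m`-tangent bundle, this section is the fundamental vector field of `ξ` off `Z`, and `dμ` maps
it to `[ξ, μ]` by equivariance. So `ω₀ + μ^*ϖ` and `Φ^*θ^l` extend without any assumption on the
values at infinity.

The axioms reduce to identities on the Lie algebra. The identity `dϖ = -exp^*χ`
(`extDeriv_varpiForm`) is obtained by differentiating in the parameter `s` of `exp_s`: both sides
vanish at `s = 0`, and their derivatives agree by the Maurer-Cartan equation (`maurerCartan_phi₁`).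
The relation `φ₂(A) A = φ₁(A) - 1` gives `ι([ξ, η]) ϖ = ½ exp^*(θ^l + θ^r, ξ) - (·, ξ)`
(`varpiForm_moment`), whose last term cancels the moment condition of `ω₀`. Invariance holds because
`Ad_g` conjugates `ad η` into `ad (Ad_g η)`.

For non-degeneracy (`weaklyNondegenerateAt_expForm`), let `e` be in both kernels. Then `φ₁(-ad μ)
(dμ e) = 0`. If `φ₁(-ad μ)` is injective, then `dμ e = 0`, so `μ^*ϖ` contributes nothing to the
contraction with `e`, and `ω₀(e, ·) = 0` forces `e = 0`. Off `Z` injectivity is bijectivity of `d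
exp`; on `Z` the operator `φ₁(-ad μ)`, extended by continuity, is the limit of the left-trivialized
differentials.

The analytic input is the formula for `d exp` (`hasMFDerivAt_lieExp`), proved before `exp` is known
to be differentiable: Grönwall's inequality compares the curve `exp(s(η + X)) exp(-sη)`, in a chart
at the unit, with the solution `φ₁(s, ad η) X` of the linearized equation. Smoothness of `exp` then
follows by bootstrapping. -/

noncomputable section

namespace BmQH


/-! ### The exponential of an operator and its iterated integrals -/

section PhiFunctions

variable {F : Type*} [NormedAddCommGroup F] [NormedSpace ℝ F]

/-- The operator `(x, y, z) ↦ (A x + y, z, 0)`. The first row of its exponential consists of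
`exp A` and the first two iterated integrals of `exp (s A)`. -/
def blockOp (A : F →L[ℝ] F) : (F × F × F) →L[ℝ] (F × F × F) :=
  (A.comp (ContinuousLinearMap.fst ℝ F (F × F)) +
    (ContinuousLinearMap.fst ℝ F F).comp (ContinuousLinearMap.snd ℝ F (F × F))).prod
  (((ContinuousLinearMap.snd ℝ F F).comp (ContinuousLinearMap.snd ℝ F (F × F))).prod 0)

@[simp] theorem blockOp_apply (A : F →L[ℝ] F) (x : F × F × F) :
    blockOp A x = (A x.1 + x.2.1, x.2.2, 0) := rfl

/-- The operator `exp (s A)`. -/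
def phi₀ (s : ℝ) (A : F →L[ℝ] F) : F →L[ℝ] F :=
  (ContinuousLinearMap.fst ℝ F (F × F)).comp ((NormedSpace.exp (s • blockOp A)).comp
    (ContinuousLinearMap.inl ℝ F (F × F)))

/-- The operator `∫₀ˢ exp (r A) dr`. -/
def phi₁ (s : ℝ) (A : F →L[ℝ] F) : F →L[ℝ] F :=
  (ContinuousLinearMap.fst ℝ F (F × F)).comp ((NormedSpace.exp (s • blockOp A)).comp
    ((ContinuousLinearMap.inr ℝ F (F × F)).comp (ContinuousLinearMap.inl ℝ F F)))

/-- The operator `∫₀ˢ (s - r) exp (r A) dr`. -/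
def phi₂ (s : ℝ) (A : F →L[ℝ] F) : F →L[ℝ] F :=
  (ContinuousLinearMap.fst ℝ F (F × F)).comp ((NormedSpace.exp (s • blockOp A)).comp
    ((ContinuousLinearMap.inr ℝ F (F × F)).comp (ContinuousLinearMap.inr ℝ F F)))

theorem contDiff_blockOp {n : WithTop ℕ∞} : ContDiff ℝ n (blockOp (F := F)) := by
  have h : (blockOp : (F →L[ℝ] F) → _) = fun A => (ContinuousLinearMap.inl ℝ F (F × F)).comp
      (A.comp (ContinuousLinearMap.fst ℝ F (F × F))) + blockOp 0 := by
    ext A x <;> simp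
  rw [h]
  exact (contDiff_const.clm_comp (contDiff_id.clm_comp contDiff_const)).add contDiff_const

variable [CompleteSpace F]

/-- The exponential is analytic on the Banach algebra of operators on `F × F × F`. The functions
read off its first row are therefore jointly smooth in `s` and `A`, with no differentiation under an
integral sign. -/
theorem contDiff_exp_blockOp {n : WithTop ℕ∞} :
    ContDiff ℝ n fun p : ℝ × (F →L[ℝ] F) => NormedSpace.exp (p.1 • blockOp p.2) := by
  have h : ContDiff ℝ n (NormedSpace.exp : ((F × F × F) →L[ℝ] (F × F × F)) → _) :=
    contDiff_iff_contDiffAt.2 fun x => (NormedSpace.exp_analytic x).contDiffAt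
  exact h.comp (contDiff_fst.smul (contDiff_blockOp.comp contDiff_snd))

theorem contDiff_phi₀ {n : WithTop ℕ∞} :
    ContDiff ℝ n fun p : ℝ × (F →L[ℝ] F) => phi₀ p.1 p.2 :=
  contDiff_const.clm_comp (contDiff_exp_blockOp.clm_comp contDiff_const)

theorem contDiff_phi₁ {n : WithTop ℕ∞} :
    ContDiff ℝ n fun p : ℝ × (F →L[ℝ] F) => phi₁ p.1 p.2 :=
  contDiff_const.clm_comp (contDiff_exp_blockOp.clm_comp contDiff_const)

theorem contDiff_phi₂ {n : WithTop ℕ∞} :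
    ContDiff ℝ n fun p : ℝ × (F →L[ℝ] F) => phi₂ p.1 p.2 :=
  contDiff_const.clm_comp (contDiff_exp_blockOp.clm_comp contDiff_const)

theorem hasDerivAt_exp_blockOp (A : F →L[ℝ] F) (s : ℝ) :
    HasDerivAt (fun s : ℝ => NormedSpace.exp (s • blockOp A))
      ((NormedSpace.exp (s • blockOp A)).comp (blockOp A)) s :=
  hasDerivAt_exp_smul_const (𝕂 := ℝ) (blockOp A) s

theorem hasDerivAt_phi₀ (A : F →L[ℝ] F) (s : ℝ) :
    HasDerivAt (fun s => phi₀ s A) ((phi₀ s A).comp A) s := by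
  have h := ((hasDerivAt_const s (ContinuousLinearMap.fst ℝ F (F × F))).clm_comp
    ((hasDerivAt_exp_blockOp A s).clm_comp
      (hasDerivAt_const s (ContinuousLinearMap.inl ℝ F (F × F)))))
  refine h.congr_deriv ?_
  ext x
  simp [phi₀]
  rfl

theorem hasDerivAt_phi₁ (A : F →L[ℝ] F) (s : ℝ) :
    HasDerivAt (fun s => phi₁ s A) (phi₀ s A) s := by
  have h := ((hasDerivAt_const s (ContinuousLinearMap.fst ℝ F (F × F))).clm_comp
    ((hasDerivAt_exp_blockOp A s).clm_comp (hasDerivAt_const s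
      ((ContinuousLinearMap.inr ℝ F (F × F)).comp (ContinuousLinearMap.inl ℝ F F)))))
  refine h.congr_deriv ?_
  ext x
  simp [phi₀]
  rfl

theorem hasDerivAt_phi₂ (A : F →L[ℝ] F) (s : ℝ) :
    HasDerivAt (fun s => phi₂ s A) (phi₁ s A) s := by
  have h := ((hasDerivAt_const s (ContinuousLinearMap.fst ℝ F (F × F))).clm_comp
    ((hasDerivAt_exp_blockOp A s).clm_comp (hasDerivAt_const s
      ((ContinuousLinearMap.inr ℝ F (F × F)).comp (ContinuousLinearMap.inr ℝ F F)))))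
  refine h.congr_deriv ?_
  ext x
  simp [phi₁]

omit [CompleteSpace F] in
@[simp] theorem phi₀_zero (A : F →L[ℝ] F) : phi₀ 0 A = 1 := by
  ext x; simp [phi₀, NormedSpace.exp_zero]

omit [CompleteSpace F] in
@[simp] theorem phi₁_zero (A : F →L[ℝ] F) : phi₁ 0 A = 0 := by
  ext x; simp [phi₁, NormedSpace.exp_zero]

omit [CompleteSpace F] in
@[simp] theorem phi₂_zero (A : F →L[ℝ] F) : phi₂ 0 A = 0 := by
  ext x; simp [phi₂, NormedSpace.exp_zero]

/-- Two functions with the same derivative and the same value at `0` are equal. -/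
theorem eq_of_hasDerivAt_eq {W : Type*} [NormedAddCommGroup W] [NormedSpace ℝ W] {u v w : ℝ → W}
    (hu : ∀ s, HasDerivAt u (w s) s) (hv : ∀ s, HasDerivAt v (w s) s) (h : u 0 = v 0) (s : ℝ) :
    u s = v s := by
  have h0 : ∀ s, HasDerivAt (fun s => u s - v s) 0 s := fun s =>
    ((hu s).sub (hv s)).congr_deriv (sub_self _)
  have := is_const_of_deriv_eq_zero (fun s => (h0 s).differentiableAt) (fun s => (h0 s).deriv) s 0
  simp only [h, sub_self] at this
  exact sub_eq_zero.1 this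

/-- A solution of a linear differential equation with constant coefficients that vanishes at `0`
is zero. -/
theorem eq_zero_of_hasDerivAt_clm {W : Type*} [NormedAddCommGroup W] [NormedSpace ℝ W]
    (L : W →L[ℝ] W) {u : ℝ → W} (hu : ∀ s, HasDerivAt u (L (u s)) s) (h : u 0 = 0) (s : ℝ) :
    u s = 0 := by
  have := ODE_solution_unique_univ (v := fun _ => L) (s := fun _ => univ) (K := ‖L‖₊) (t₀ := 0)
    (f := u) (g := fun _ => 0) (fun _ => L.lipschitz.lipschitzOnWith)
    (fun t => ⟨hu t, mem_univ _⟩)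
    (fun t => ⟨by simpa using hasDerivAt_const t (0 : W), mem_univ _⟩) h
  exact congrFun this s

/-- Uniqueness for linear differential equations replaces manipulation of power series: the
difference of the two sides vanishes at `s = 0` and solves `u' = u A`. The later identities between
these operators follow the same pattern. -/
theorem phi₀_comm (s : ℝ) (A : F →L[ℝ] F) : (phi₀ s A).comp A = A.comp (phi₀ s A) := by
  refine sub_eq_zero.1 (eq_zero_of_hasDerivAt_clm
    ((ContinuousLinearMap.compL ℝ F F F).flip A)
    (u := fun s => (phi₀ s A).comp A - A.comp (phi₀ s A)) (fun s => ?_) ?_ s)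
  · refine (((hasDerivAt_phi₀ A s).clm_comp (hasDerivAt_const s A)).sub
      ((hasDerivAt_const s A).clm_comp (hasDerivAt_phi₀ A s))).congr_deriv ?_
    ext x
    simp
  · ext x
    simp

theorem phi₀_eq_add (s : ℝ) (A : F →L[ℝ] F) : phi₀ s A = 1 + (phi₁ s A).comp A := by
  refine eq_of_hasDerivAt_eq (v := fun s => 1 + (phi₁ s A).comp A) (hasDerivAt_phi₀ A) (fun s => ?_) (by simp) s
  refine (((hasDerivAt_phi₁ A s).clm_comp (hasDerivAt_const s A)).const_add 1).congr_deriv ?_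
  simp

theorem phi₁_eq_add (s : ℝ) (A : F →L[ℝ] F) : phi₁ s A = s • 1 + (phi₂ s A).comp A := by
  refine eq_of_hasDerivAt_eq (v := fun s => s • 1 + (phi₂ s A).comp A) (hasDerivAt_phi₁ A) (fun s => ?_) (by simp) s
  refine (((hasDerivAt_id s).smul_const (1 : F →L[ℝ] F)).add
    ((hasDerivAt_phi₂ A s).clm_comp (hasDerivAt_const s A))).congr_deriv ?_
  rw [phi₀_eq_add]
  simp

theorem phi₁_comm (s : ℝ) (A : F →L[ℝ] F) : (phi₁ s A).comp A = A.comp (phi₁ s A) := by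
  refine eq_of_hasDerivAt_eq (u := fun s => (phi₁ s A).comp A)
    (v := fun s => A.comp (phi₁ s A)) (w := fun s => (phi₀ s A).comp A)
    (fun s => ?_) (fun s => ?_) (by simp) s
  · refine ((hasDerivAt_phi₁ A s).clm_comp (hasDerivAt_const s A)).congr_deriv (by simp)
  · refine ((hasDerivAt_const s A).clm_comp (hasDerivAt_phi₁ A s)).congr_deriv ?_
    rw [phi₀_comm]
    simp

theorem phi₀_smul (s t : ℝ) (A : F →L[ℝ] F) : phi₀ s (t • A) = phi₀ (s * t) A := by
  refine sub_eq_zero.1 (eq_zero_of_hasDerivAt_clm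
    ((ContinuousLinearMap.compL ℝ F F F).flip (t • A))
    (u := fun s => phi₀ s (t • A) - phi₀ (s * t) A) (fun s => ?_) (by simp) s)
  refine ((hasDerivAt_phi₀ (t • A) s).sub
    ((hasDerivAt_phi₀ A (s * t)).scomp s ((hasDerivAt_id s).mul_const t))).congr_deriv ?_
  ext x
  simp [smul_sub]

/-- Substitution in the integral. It absorbs the factor `s` that the chain rule produces when
`exp_s` is differentiated. -/
theorem smul_phi₁_smul (s t : ℝ) (A : F →L[ℝ] F) : t • phi₁ s (t • A) = phi₁ (s * t) A := by
  refine eq_of_hasDerivAt_eq (u := fun s => t • phi₁ s (t • A))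
    (v := fun s => phi₁ (s * t) A) (w := fun s => t • phi₀ (s * t) A)
    (fun s => ?_) (fun s => ?_) (by simp) s
  · rw [← phi₀_smul]
    exact (hasDerivAt_phi₁ (t • A) s).const_smul t
  · refine ((hasDerivAt_phi₁ A (s * t)).scomp s ((hasDerivAt_id s).mul_const t)).congr_deriv ?_
    simp

/-- `exp (-s A) exp (s A) = 1`. -/
theorem phi₀_neg_comp (s : ℝ) (A : F →L[ℝ] F) : (phi₀ s (-A)).comp (phi₀ s A) = 1 := by
  refine eq_of_hasDerivAt_eq (u := fun s => (phi₀ s (-A)).comp (phi₀ s A)) (w := fun s => 0)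
    (fun s => ?_) (fun s => hasDerivAt_const s _) (by ext; simp) s
  refine ((hasDerivAt_phi₀ (-A) s).clm_comp (hasDerivAt_phi₀ A s)).congr_deriv ?_
  rw [phi₀_comm s A]
  ext x
  simp

/-- `exp (-s A) ∫₀ˢ exp (r A) dr = ∫₀ˢ exp (-r A) dr`. -/
theorem phi₀_neg_comp_phi₁ (s : ℝ) (A : F →L[ℝ] F) :
    (phi₀ s (-A)).comp (phi₁ s A) = phi₁ s (-A) := by
  refine eq_of_hasDerivAt_eq (u := fun s => (phi₀ s (-A)).comp (phi₁ s A))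
    (w := fun s => phi₀ s (-A))
    (fun s => ?_) (hasDerivAt_phi₁ (-A)) (by ext; simp) s
  refine ((hasDerivAt_phi₀ (-A) s).clm_comp (hasDerivAt_phi₁ A s)).congr_deriv ?_
  rw [phi₀_neg_comp]
  have h : phi₀ s (-A) = (phi₀ s (-A)).comp (phi₀ s A - (phi₁ s A).comp A) := by
    rw [phi₀_eq_add s A]
    ext; simp
  conv_rhs => rw [h]
  rw [phi₁_comm]
  ext x
  have := congrArg (fun T : F →L[ℝ] F => T x) (phi₀_neg_comp s A)
  simp only [ContinuousLinearMap.comp_apply, one_apply_eq_self] at this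
  simp [this, sub_eq_add_neg, add_comm]

end PhiFunctions


/-! ### Adjoints and the Maurer-Cartan equation -/

section Adjoint

variable {F : Type*} [NormedAddCommGroup F] [NormedSpace ℝ F] [CompleteSpace F]
  {b : F →L[ℝ] F →L[ℝ] ℝ} {A : F →L[ℝ] F}

omit [CompleteSpace F] in
theorem hasDerivAt_bilin {u v : ℝ → F →L[ℝ] F} {u' v' : F →L[ℝ] F} {s : ℝ}
    (b : F →L[ℝ] F →L[ℝ] ℝ) (hu : HasDerivAt u u' s) (hv : HasDerivAt v v' s) (x y : F) :
    HasDerivAt (fun s => b (u s x) (v s y)) (b (u' x) (v s y) + b (u s x) (v' y)) s := by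
  have h1 : HasDerivAt (fun s => u s x) (u' x) s := by
    simpa using hu.clm_apply (hasDerivAt_const s x)
  have h2 : HasDerivAt (fun s => v s y) (v' y) s := by
    simpa using hv.clm_apply (hasDerivAt_const s y)
  have h3 : HasDerivAt (fun s => b (u s x)) (b (u' x)) s :=
    b.hasFDerivAt.comp_hasDerivAt s h1
  simpa using h3.clm_apply h2

/-- If `A` is skew-adjoint, then the adjoint of `exp (s A)` is `exp (-s A)`. -/
theorem adjoint_phi₀ (hA : ∀ x y, b (A x) y = - b x (A y)) (s : ℝ) (x y : F) :
    b (phi₀ s A x) y = b x (phi₀ s (-A) y) := by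
  have h : ∀ s y, b (phi₀ s A x) (phi₀ s A y) = b x y := fun s y => by
    refine eq_of_hasDerivAt_eq (u := fun s => b (phi₀ s A x) (phi₀ s A y)) (v := fun s => b x y)
      (w := fun s => 0) (fun s => ?_) (fun s => hasDerivAt_const s _) (by simp) s
    refine (hasDerivAt_bilin b (hasDerivAt_phi₀ A s) (hasDerivAt_phi₀ A s) x y).congr_deriv ?_
    rw [phi₀_comm]
    simp [hA]
  have h1 : y = phi₀ s A (phi₀ s (-A) y) := by
    have := congrArg (fun T : F →L[ℝ] F => T y) (phi₀_neg_comp s (-A))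
    simpa using this.symm
  conv_lhs => rw [h1]
  rw [h]

/-- If `A` is skew-adjoint, then the adjoint of `phi₁ s A` is `phi₁ s (-A)`. -/
theorem adjoint_phi₁ (hA : ∀ x y, b (A x) y = - b x (A y)) (s : ℝ) (x y : F) :
    b (phi₁ s A x) y = b x (phi₁ s (-A) y) := by
  refine eq_of_hasDerivAt_eq (u := fun s => b (phi₁ s A x) y)
    (v := fun s => b x (phi₁ s (-A) y)) (w := fun s => b (phi₀ s A x) y)
    (fun s => ?_) (fun s => ?_) (by simp) s
  · simpa using hasDerivAt_bilin b (hasDerivAt_phi₁ A s) (hasDerivAt_const s 1) x y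
  · rw [adjoint_phi₀ hA]
    simpa using hasDerivAt_bilin b (hasDerivAt_const s 1) (hasDerivAt_phi₁ (-A) s) x y

theorem adjoint_phi₂ (hA : ∀ x y, b (A x) y = - b x (A y)) (s : ℝ) (x y : F) :
    b (phi₂ s A x) y = b x (phi₂ s (-A) y) := by
  refine eq_of_hasDerivAt_eq (u := fun s => b (phi₂ s A x) y)
    (v := fun s => b x (phi₂ s (-A) y)) (w := fun s => b (phi₁ s A x) y)
    (fun s => ?_) (fun s => ?_) (by simp) s
  · simpa using hasDerivAt_bilin b (hasDerivAt_phi₂ A s) (hasDerivAt_const s 1) x y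
  · rw [adjoint_phi₁ hA]
    simpa using hasDerivAt_bilin b (hasDerivAt_const s 1) (hasDerivAt_phi₂ (-A) s) x y

/-- For skew-adjoint `A`: `(phi₁ s A x, exp (s A) y) = (phi₁ s (-A) x, y)`. -/
theorem bilin_phi₁_phi₀ (hsymm : ∀ x y, b x y = b y x) (hA : ∀ x y, b (A x) y = - b x (A y))
    (s : ℝ) (x y : F) : b (phi₁ s A x) (phi₀ s A y) = b (phi₁ s (-A) x) y := by
  rw [hsymm, adjoint_phi₀ hA, hsymm]
  have := congrArg (fun T : F →L[ℝ] F => T x) (phi₀_neg_comp_phi₁ s A)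
  simp only [ContinuousLinearMap.comp_apply] at this
  rw [this]

end Adjoint

/-- Mixed partial derivatives commute. -/
theorem hasDerivAt_fderiv_swap {F W : Type*} [NormedAddCommGroup F] [NormedSpace ℝ F]
    [NormedAddCommGroup W] [NormedSpace ℝ W] {Φ : ℝ × F → W} {g : ℝ → F → W}
    (hf : ContDiff ℝ 2 Φ) (hg : ∀ s η, HasDerivAt (fun s => Φ (s, η)) (g s η) s) (s : ℝ) (η X : F) :
    HasDerivAt (fun s => fderiv ℝ (fun η => Φ (s, η)) η X) (fderiv ℝ (g s) η X) s := by
  have hd : ∀ p, HasFDerivAt Φ (fderiv ℝ Φ p) p := fun p =>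
    (hf.differentiable (by norm_num) p).hasFDerivAt
  have hd2 : HasFDerivAt (fderiv ℝ Φ) (fderiv ℝ (fderiv ℝ Φ) (s, η)) (s, η) :=
    ((hf.fderiv_right (m := 1) (by norm_num)).differentiable (by norm_num) _).hasFDerivAt
  have hη : ∀ s, HasFDerivAt (fun η => ((s, η) : ℝ × F)) (ContinuousLinearMap.inr ℝ ℝ F) η :=
    fun s => hasFDerivAt_prodMk_right s η
  have hs : ∀ η s, HasDerivAt (fun s => ((s, η) : ℝ × F)) (1, 0) s := fun η s =>
    (hasDerivAt_id s).prodMk (hasDerivAt_const s η)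
  have h1 : ∀ s, fderiv ℝ (fun η => Φ (s, η)) η X = fderiv ℝ Φ (s, η) (0, X) := fun s => by
    have h : HasFDerivAt (fun η => Φ (s, η)) _ η := (hd (s, η)).comp η (hη s)
    rw [h.fderiv]
    rfl
  have h2 : g s = fun η => fderiv ℝ Φ (s, η) (1, 0) := funext fun η => by
    have h : HasDerivAt (fun s => Φ (s, η)) _ s := (hd (s, η)).comp_hasDerivAt s (hs η s)
    exact (hg s η).unique h
  have h3 : fderiv ℝ (g s) η X = fderiv ℝ (fderiv ℝ Φ) (s, η) (0, X) (1, 0) := by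
    have h : HasFDerivAt (fun η => fderiv ℝ Φ (s, η)) _ η := hd2.comp η (hη s)
    rw [h2, (h.clm_apply (hasFDerivAt_const ((1, 0) : ℝ × F) η)).fderiv]
    simp
  have h4 : HasDerivAt (fun s => fderiv ℝ Φ (s, η)) (fderiv ℝ (fderiv ℝ Φ) (s, η) (1, 0)) s :=
    hd2.comp_hasDerivAt s (hs η s)
  have h5 := h4.clm_apply (hasDerivAt_const s ((0, X) : ℝ × F))
  have hsymm : IsSymmSndFDerivAt ℝ Φ (s, η) := hf.contDiffAt.isSymmSndFDerivAt (by simp)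
  rw [h3, hsymm.eq]
  simpa only [h1, map_zero, add_zero] using h5

/-! ### The Maurer-Cartan equation and the exterior derivative of the 2-form at parameter `s` -/

section MaurerCartan

variable {F : Type*} [NormedAddCommGroup F] [NormedSpace ℝ F] [CompleteSpace F]

/-- The axioms of a Lie algebra with an invariant symmetric bilinear form, for a continuous
bracket `ad`. -/
structure IsMetricLie (ad : F →L[ℝ] F →L[ℝ] F) (b : F →L[ℝ] F →L[ℝ] ℝ) : Prop where
  antisymm : ∀ x y, ad x y = - ad y x
  jacobi : ∀ x y z, ad x (ad y z) = ad (ad x y) z + ad y (ad x z)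
  symm : ∀ x y, b x y = b y x
  skew : ∀ x y z, b (ad x y) z = - b y (ad x z)

omit [CompleteSpace F] in
-- Reversing the bracket exchanges `φ₁(ad η)` and `φ₁(-ad η)`, the pullbacks of `θ^r` and `θ^l`. A
-- computation made for the right-invariant form can thus be read for the left-invariant form, in
-- which `χ` is written.
theorem IsMetricLie.neg {ad : F →L[ℝ] F →L[ℝ] F} {b : F →L[ℝ] F →L[ℝ] ℝ} (h : IsMetricLie ad b) :
    IsMetricLie (-ad) b where
  antisymm x y := by simp [h.antisymm x y]
  jacobi x y z := by simpa using h.jacobi x y z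
  symm := h.symm
  skew x y z := by simp [h.skew x y z]

variable {ad : F →L[ℝ] F →L[ℝ] F} {b : F →L[ℝ] F →L[ℝ] ℝ}

theorem contDiff_phi₀_ad {n : WithTop ℕ∞} (ad : F →L[ℝ] F →L[ℝ] F) (Y : F) :
    ContDiff ℝ n fun p : ℝ × F => phi₀ p.1 (ad p.2) Y :=
  (contDiff_phi₀.comp (contDiff_fst.prodMk (ad.contDiff.comp contDiff_snd))).clm_apply
    contDiff_const

theorem contDiff_phi₁_ad {n : WithTop ℕ∞} (ad : F →L[ℝ] F →L[ℝ] F) (Y : F) :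
    ContDiff ℝ n fun p : ℝ × F => phi₁ p.1 (ad p.2) Y :=
  (contDiff_phi₁.comp (contDiff_fst.prodMk (ad.contDiff.comp contDiff_snd))).clm_apply
    contDiff_const

theorem contDiff_phi₂_ad {n : WithTop ℕ∞} (ad : F →L[ℝ] F →L[ℝ] F) (Y : F) :
    ContDiff ℝ n fun p : ℝ × F => phi₂ p.1 (ad p.2) Y :=
  (contDiff_phi₂.comp (contDiff_fst.prodMk (ad.contDiff.comp contDiff_snd))).clm_apply
    contDiff_const

omit [CompleteSpace F] in
theorem differentiable_right {W : Type*} [NormedAddCommGroup W] [NormedSpace ℝ W] {Φ : ℝ × F → W}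
    (hf : ContDiff ℝ 1 Φ) (s : ℝ) : Differentiable ℝ (fun η => Φ (s, η)) :=
  (hf.comp (contDiff_const.prodMk contDiff_id)).differentiable (by norm_num)

/-- The Maurer-Cartan equation for `exp_s^* θ^r`. -/
theorem maurerCartan_phi₁ (h : IsMetricLie ad b) (s : ℝ) (η X Y : F) :
    fderiv ℝ (fun η => phi₁ s (ad η) Y) η X - fderiv ℝ (fun η => phi₁ s (ad η) X) η Y =
      ad (phi₁ s (ad η) X) (phi₁ s (ad η) Y) := by
  have hphi : ∀ (s : ℝ) (A : F →L[ℝ] F) Y, phi₀ s A Y = Y + A (phi₁ s A Y) := fun s A Y => by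
    rw [phi₀_eq_add, phi₁_comm]; simp
  -- The partial derivatives in `s` and `η` are interchanged, and the product rule is applied to `φ₀
  -- Y = Y + [η, φ₁ Y]`.
  have hM : ∀ X Y s, HasDerivAt (fun s => fderiv ℝ (fun η => phi₁ s (ad η) Y) η X)
      (ad X (phi₁ s (ad η) Y) + ad η (fderiv ℝ (fun η => phi₁ s (ad η) Y) η X)) s := by
    intro X Y s
    refine (hasDerivAt_fderiv_swap (Φ := fun p : ℝ × F => phi₁ p.1 (ad p.2) Y)
      (g := fun s η => phi₀ s (ad η) Y) (contDiff_phi₁_ad ad Y) (fun s η => ?_) s η X).congr_deriv ?_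
    · simpa using (hasDerivAt_phi₁ (ad η) s).clm_apply (hasDerivAt_const s Y)
    · have h1 := (differentiable_right (contDiff_phi₁_ad ad Y) s η).hasFDerivAt
      have h2 := (((ad.hasFDerivAt (x := η)).clm_apply h1).const_add Y).fderiv
      simp only [hphi]
      rw [h2]
      simp [add_comm]
  -- By the Jacobi identity the difference of the two sides solves `u' = [η, u]`, and it vanishes at
  -- `s = 0`.
  refine sub_eq_zero.1 (eq_zero_of_hasDerivAt_clm (ad η)
    (u := fun s => fderiv ℝ (fun η => phi₁ s (ad η) Y) η X -
      fderiv ℝ (fun η => phi₁ s (ad η) X) η Y - ad (phi₁ s (ad η) X) (phi₁ s (ad η) Y))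
    (fun s => ?_) (by simp) s)
  have hd : ∀ X, HasDerivAt (fun s => phi₁ s (ad η) X) (X + ad η (phi₁ s (ad η) X)) s := fun X => by
    rw [← hphi]
    simpa using (hasDerivAt_phi₁ (ad η) s).clm_apply (hasDerivAt_const s X)
  have hd' := (ad.hasFDerivAt.comp_hasDerivAt s (hd X)).clm_apply (hd Y)
  refine (((hM X Y s).sub (hM Y X s)).sub hd').congr_deriv ?_
  simp only [map_sub, map_add, add_apply, Function.comp_apply, h.jacobi η]
  rw [h.antisymm (phi₁ s (ad η) X) Y]
  abel

/-- The invariant 3-form of a metric Lie algebra. -/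
def cubic (ad : F →L[ℝ] F →L[ℝ] F) (b : F →L[ℝ] F →L[ℝ] ℝ) (x y z : F) : ℝ := b x (ad y z)

omit [CompleteSpace F] in
-- Invariance moves one bracket across the inner product, and antisymmetry restores the sign.
theorem cubic_rotate (h : IsMetricLie ad b) (x y z : F) : cubic ad b x y z = cubic ad b y z x := by
  unfold cubic
  rw [h.symm y, h.skew, h.antisymm z y, map_neg, neg_neg]

/-- The bilinear form `(1/2) (phi₂ s (-A) X - phi₂ s A X, Y)`. -/
def varpiAux (b : F →L[ℝ] F →L[ℝ] ℝ) (s : ℝ) (A : F →L[ℝ] F) (X Y : F) : ℝ :=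
  (1 / 2) * b ((phi₂ s (-A) - phi₂ s A) X) Y

/-- The right-hand side is half the integrand of `ϖ`, so this exhibits an antiderivative. The
adjoint of `exp(sA)` is `exp(-sA)`, which turns the two terms into `(φ₁(-A) X, Y)` and `(φ₁(A) X,
Y)`. -/
theorem hasDerivAt_varpiAux (hsymm : ∀ x y, b x y = b y x) {A : F →L[ℝ] F}
    (hA : ∀ x y, b (A x) y = - b x (A y)) (s : ℝ) (X Y : F) :
    HasDerivAt (fun s => varpiAux b s A X Y) ((1 / 2) * (b (phi₁ s A X) (phi₀ s A Y) -
      b (phi₁ s A Y) (phi₀ s A X))) s := by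
  have h1 := hasDerivAt_bilin b ((hasDerivAt_phi₂ (-A) s).sub (hasDerivAt_phi₂ A s))
    (hasDerivAt_const s 1) X Y
  refine (h1.const_mul (1 / 2 : ℝ)).congr_deriv ?_
  rw [bilin_phi₁_phi₀ hsymm hA, bilin_phi₁_phi₀ hsymm hA, hsymm (phi₁ s (-A) Y), ← adjoint_phi₁ hA]
  simp

theorem contDiff_varpiAux {n : WithTop ℕ∞} (ad : F →L[ℝ] F →L[ℝ] F) (b : F →L[ℝ] F →L[ℝ] ℝ)
    (X Y : F) : ContDiff ℝ n fun p : ℝ × F => varpiAux b p.1 (ad p.2) X Y := by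
  refine contDiff_const.mul ((b.contDiff.comp ((contDiff_phi₂_ad (-ad) X).sub
    (contDiff_phi₂_ad ad X))).clm_apply contDiff_const)

/-- The exterior derivative of `varpiAux`, evaluated on constant vector fields. -/
theorem cyclic_fderiv_varpiAux (h : IsMetricLie ad b) (s : ℝ) (η X Y Z : F) :
    fderiv ℝ (fun η => varpiAux b s (ad η) Y Z) η X +
      fderiv ℝ (fun η => varpiAux b s (ad η) Z X) η Y +
      fderiv ℝ (fun η => varpiAux b s (ad η) X Y) η Z =
    - (1 / 2) * cubic ad b (phi₁ s (ad η) X) (phi₁ s (ad η) Y) (phi₁ s (ad η) Z) := by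
  set M : ℝ → F → F → F := fun s X Y => fderiv ℝ (fun η => phi₁ s (ad η) Y) η X with hM
  set N : ℝ → F → F → F := fun s X Y => fderiv ℝ (fun η => phi₀ s (ad η) Y) η X with hN
  have hphi : ∀ X s, HasDerivAt (fun s => phi₁ s (ad η) X) (phi₀ s (ad η) X) s := fun X s => by
    simpa using (hasDerivAt_phi₁ (ad η) s).clm_apply (hasDerivAt_const s X)
  have hMN : ∀ X Y s, HasDerivAt (fun s => M s X Y) (N s X Y) s := fun X Y s =>
    hasDerivAt_fderiv_swap (Φ := fun p : ℝ × F => phi₁ p.1 (ad p.2) Y)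
      (g := fun s η => phi₀ s (ad η) Y) (contDiff_phi₁_ad ad Y)
      (fun s η => by simpa using (hasDerivAt_phi₁ (ad η) s).clm_apply (hasDerivAt_const s Y)) s η X
  have hMC : ∀ s X Y, M s X Y - M s Y X = ad (phi₁ s (ad η) X) (phi₁ s (ad η) Y) := fun s X Y =>
    maurerCartan_phi₁ h s η X Y
  -- This is the `s`-derivative of the Maurer-Cartan equation.
  have hNC : ∀ s X Y, N s X Y - N s Y X =
      ad (phi₀ s (ad η) X) (phi₁ s (ad η) Y) + ad (phi₁ s (ad η) X) (phi₀ s (ad η) Y) := by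
    intro s X Y
    have h1 := (hMN X Y s).sub (hMN Y X s)
    have h2 := (ad.hasFDerivAt.comp_hasDerivAt s (hphi X s)).clm_apply (hphi Y s)
    refine h1.unique (h2.congr_of_eventuallyEq (Eventually.of_forall fun s => hMC s X Y))
  have hP : ∀ X Y Z s, HasDerivAt (fun s => fderiv ℝ (fun η => varpiAux b s (ad η) Y Z) η X)
      ((1 / 2) * (b (M s X Y) (phi₀ s (ad η) Z) + b (phi₁ s (ad η) Y) (N s X Z) -
        (b (M s X Z) (phi₀ s (ad η) Y) + b (phi₁ s (ad η) Z) (N s X Y)))) s := by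
    intro X Y Z s
    refine (hasDerivAt_fderiv_swap (Φ := fun p : ℝ × F => varpiAux b p.1 (ad p.2) Y Z)
      (contDiff_varpiAux ad b Y Z)
      (fun s η => hasDerivAt_varpiAux h.symm (h.skew η) s Y Z) s η X).congr_deriv ?_
    have h1 : ∀ Y, HasFDerivAt (fun η => phi₁ s (ad η) Y)
        (fderiv ℝ (fun η => phi₁ s (ad η) Y) η) η := fun Y =>
      (differentiable_right (contDiff_phi₁_ad ad Y) s η).hasFDerivAt
    have h0 : ∀ Y, HasFDerivAt (fun η => phi₀ s (ad η) Y)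
        (fderiv ℝ (fun η => phi₀ s (ad η) Y) η) η := fun Y =>
      (differentiable_right (contDiff_phi₀_ad ad Y) s η).hasFDerivAt
    have hb : ∀ Y Z, HasFDerivAt (fun η => b (phi₁ s (ad η) Y) (phi₀ s (ad η) Z)) _ η := fun Y Z =>
      ((b.hasFDerivAt.comp η (h1 Y)).clm_apply (h0 Z))
    rw [(((hb Y Z).fun_sub (hb Z Y)).const_mul (1 / 2 : ℝ)).fderiv]
    simp [hM, hN]
    ring
  have hc := fun s => (b.hasFDerivAt.comp_hasDerivAt s (hphi X s)).clm_apply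
    ((ad.hasFDerivAt.comp_hasDerivAt s (hphi Y s)).clm_apply (hphi Z s))
  refine eq_of_hasDerivAt_eq (fun s => ((hP X Y Z s).add (hP Y Z X s)).add (hP Z X Y s))
    (v := fun s => - (1 / 2) *
      cubic ad b (phi₁ s (ad η) X) (phi₁ s (ad η) Y) (phi₁ s (ad η) Z)) (fun s => ?_) ?_ s
  · refine ((hc s).const_mul (-(1 / 2) : ℝ)).congr_deriv ?_
    -- In the cyclic sum the derivatives occur only in the antisymmetric combinations `M X Y - M Y
    -- X` and `N X Y - N Y X`, which are brackets. What remains is an identity between values of the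
    -- invariant cubic form.
    have e1 : ∀ X Y, M s X Y = M s Y X + ad (phi₁ s (ad η) X) (phi₁ s (ad η) Y) := fun X Y => by
      rw [← hMC]; abel
    have e2 : ∀ X Y, N s X Y = N s Y X +
      (ad (phi₀ s (ad η) X) (phi₁ s (ad η) Y) + ad (phi₁ s (ad η) X) (phi₀ s (ad η) Y)) :=
      fun X Y => by rw [← hNC]; abel
    rw [e1 X Y, e1 Y Z, e1 Z X, e2 X Y, e2 Y Z, e2 Z X]
    simp only [map_add, add_apply, Function.comp_apply]
    have r1 := fun x y z => cubic_rotate h x y z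
    unfold cubic at r1
    have s1 := h.symm
    generalize phi₁ s (ad η) X = jX, phi₁ s (ad η) Y = jY, phi₁ s (ad η) Z = jZ,
      phi₀ s (ad η) X = eX, phi₀ s (ad η) Y = eY, phi₀ s (ad η) Z = eZ
    linarith [s1 (ad jX jY) eZ, s1 (ad jY jZ) eX, s1 (ad jZ jX) eY, r1 jZ eX jY, r1 jX eY jZ,
      r1 jY eZ jX, r1 jX jY eZ, r1 jY eZ jX, r1 jY jZ eX, r1 jZ eX jY, r1 jZ jX eY, r1 jX eY jZ]
  · simp [varpiAux, cubic]

end MaurerCartan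


/-! ### Derivatives of maps between manifolds, as maps between the model spaces -/

section MDeriv

variable {E M E' M' E'' M'' : Type*} [NormedAddCommGroup E] [NormedSpace ℝ E] [TopologicalSpace M]
  [ChartedSpace E M] [NormedAddCommGroup E'] [NormedSpace ℝ E'] [TopologicalSpace M']
  [ChartedSpace E' M'] [NormedAddCommGroup E''] [NormedSpace ℝ E''] [TopologicalSpace M'']
  [ChartedSpace E'' M'']

/-- The derivative of a map between manifolds, as a map between the model spaces. -/
def mD (f : M → M') (x : M) : E →L[ℝ] E' := mfderiv 𝓘(ℝ, E) 𝓘(ℝ, E') f x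

theorem mD_comp {g : M' → M''} {f : M → M'} {x : M}
    (hg : MDifferentiableAt 𝓘(ℝ, E') 𝓘(ℝ, E'') g (f x))
    (hf : MDifferentiableAt 𝓘(ℝ, E) 𝓘(ℝ, E') f x) :
    (mD (fun y => g (f y)) x : E →L[ℝ] E'') = (mD g (f x) : E' →L[ℝ] E'').comp (mD f x) :=
  mfderiv_comp x hg hf

theorem mD_comp_of_eq {g : M' → M''} {f : M → M'} {x : M} {y : M'}
    (hg : MDifferentiableAt 𝓘(ℝ, E') 𝓘(ℝ, E'') g y)
    (hf : MDifferentiableAt 𝓘(ℝ, E) 𝓘(ℝ, E') f x) (h : f x = y) :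
    (mD (fun y => g (f y)) x : E →L[ℝ] E'') = (mD g y : E' →L[ℝ] E'').comp (mD f x) := by
  subst h
  exact mD_comp hg hf

theorem mD_congr {f g : M → M'} {x : M} (h : f =ᶠ[𝓝 x] g) : (mD f x : E →L[ℝ] E') = mD g x :=
  Filter.EventuallyEq.mfderiv_eq h

theorem mD_id (x : M) : (mD (fun y : M => y) x : E →L[ℝ] E) = ContinuousLinearMap.id ℝ E :=
  mfderiv_id

theorem mD_const (c : M') (x : M) : (mD (fun _ : M => c) x : E →L[ℝ] E') = 0 := mfderiv_const

theorem mD_eq_fderiv (f : E → E') (x : E) : mD f x = fderiv ℝ f x := mfderiv_eq_fderiv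

theorem mD_eq {f : M → M'} {x : M} {f' : E →L[ℝ] E'}
    (h : HasMFDerivAt 𝓘(ℝ, E) 𝓘(ℝ, E') f x f') : mD f x = f' := h.mfderiv

theorem hasMFDerivAt_mD {f : M → M'} {x : M} (h : MDifferentiableAt 𝓘(ℝ, E) 𝓘(ℝ, E') f x) :
    HasMFDerivAt 𝓘(ℝ, E) 𝓘(ℝ, E') f x (mD f x : E →L[ℝ] E') := h.hasMFDerivAt

theorem mdiff_of_contMDiffAt {f : M → M'} {x : M} (h : ContMDiffAt 𝓘(ℝ, E) 𝓘(ℝ, E') ∞ f x) :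
    MDifferentiableAt 𝓘(ℝ, E) 𝓘(ℝ, E') f x := h.mdifferentiableAt (by simp)

end MDeriv

/-! ### Charts of manifolds modelled on a normed space -/

section Charts

variable {E M : Type*} [NormedAddCommGroup E] [NormedSpace ℝ E] [TopologicalSpace M]
  [ChartedSpace E M]

theorem extChartAt_target_mem_nhds_of_mem {p : M} {y : E}
    (hy : y ∈ (extChartAt 𝓘(ℝ, E) p).target) : (extChartAt 𝓘(ℝ, E) p).target ∈ 𝓝 y :=
  (isOpen_extChartAt_target p).mem_nhds hy

variable [IsManifold 𝓘(ℝ, E) ∞ M]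

theorem contMDiffAt_extChartAt_of_mem {p x : M} (hx : x ∈ (extChartAt 𝓘(ℝ, E) p).source) :
    ContMDiffAt 𝓘(ℝ, E) 𝓘(ℝ, E) ∞ (extChartAt 𝓘(ℝ, E) p) x :=
  contMDiffAt_extChartAt' (by rwa [extChartAt_source] at hx)

theorem contMDiffAt_extChartAt_symm_of_mem {p : M} {y : E}
    (hy : y ∈ (extChartAt 𝓘(ℝ, E) p).target) :
    ContMDiffAt 𝓘(ℝ, E) 𝓘(ℝ, E) ∞ (extChartAt 𝓘(ℝ, E) p).symm y :=
  (contMDiffOn_extChartAt_symm p).contMDiffAt (extChartAt_target_mem_nhds_of_mem hy)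

/-- The derivative at `x` of the chart around `p`. -/
def chartD (p x : M) : E →L[ℝ] E := mD (extChartAt 𝓘(ℝ, E) p) x

/-- The derivative at `y` of the inverse of the chart around `p`. -/
def chartDSymm (p : M) (y : E) : E →L[ℝ] E := mD (extChartAt 𝓘(ℝ, E) p).symm y

theorem chartD_comp_chartDSymm {p : M} {y : E} (hy : y ∈ (extChartAt 𝓘(ℝ, E) p).target) :
    (chartD p ((extChartAt 𝓘(ℝ, E) p).symm y)).comp (chartDSymm p y) =
      ContinuousLinearMap.id ℝ E := by
  have hs := (extChartAt 𝓘(ℝ, E) p).map_target hy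
  rw [chartD, chartDSymm, ← mD_comp (mdiff_of_contMDiffAt (contMDiffAt_extChartAt_of_mem hs))
    (mdiff_of_contMDiffAt (contMDiffAt_extChartAt_symm_of_mem hy)), ← mD_id y]
  refine mD_congr ?_
  filter_upwards [extChartAt_target_mem_nhds_of_mem hy] with z hz
  exact (extChartAt 𝓘(ℝ, E) p).right_inv hz

theorem chartDSymm_comp_chartD {p x : M} (hx : x ∈ (extChartAt 𝓘(ℝ, E) p).source) :
    (chartDSymm p (extChartAt 𝓘(ℝ, E) p x)).comp (chartD p x) = ContinuousLinearMap.id ℝ E := by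
  have hs := (extChartAt 𝓘(ℝ, E) p).map_source hx
  rw [chartD, chartDSymm, ← mD_comp (mdiff_of_contMDiffAt (contMDiffAt_extChartAt_symm_of_mem hs))
    (mdiff_of_contMDiffAt (contMDiffAt_extChartAt_of_mem hx)), ← mD_id x]
  refine mD_congr ?_
  filter_upwards [(isOpen_extChartAt_source p).mem_nhds hx] with z hz
  exact (extChartAt 𝓘(ℝ, E) p).left_inv hz

/-- The tangent space at `p` is identified with the model space by the preferred chart at `p`, in
which that chart is the identity to first order. -/
theorem chartD_self (p : M) : chartD p p = ContinuousLinearMap.id ℝ E := by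
  have : IsManifold 𝓘(ℝ, E) 1 M := IsManifold.of_le (n := ∞) (by simp)
  exact mfderiv_extChartAt_self

theorem chartDSymm_self (p : M) :
    chartDSymm p (extChartAt 𝓘(ℝ, E) p p) = ContinuousLinearMap.id ℝ E := by
  have h := chartDSymm_comp_chartD (mem_extChartAt_source (I := 𝓘(ℝ, E)) p)
  rwa [chartD_self, ContinuousLinearMap.comp_id] at h

end Charts

/-! ### Translations of a Lie group -/

section Translations

variable {F G : Type*} [NormedAddCommGroup F] [NormedSpace ℝ F]
  [TopologicalSpace G] [ChartedSpace F G] [Group G] [LieGroup 𝓘(ℝ, F) ∞ G]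

theorem mdiff_mulLeft (g h : G) :
    MDifferentiableAt 𝓘(ℝ, F) 𝓘(ℝ, F) (fun k : G => g * k) h :=
  (contMDiff_mul_left (n := ∞)).mdifferentiable (by simp) h

theorem mdiff_mulRight (g h : G) :
    MDifferentiableAt 𝓘(ℝ, F) 𝓘(ℝ, F) (fun k : G => k * g) h :=
  (contMDiff_mul_right (n := ∞)).mdifferentiable (by simp) h

/-- The derivative at `h` of left multiplication by `g`. -/
def dLeft (g h : G) : F →L[ℝ] F := mD (fun k : G => g * k) h

/-- The derivative at `h` of right multiplication by `g`. -/
def dRight (g h : G) : F →L[ℝ] F := mD (fun k : G => k * g) h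

theorem dLeft_comp (a b h : G) :
    (dLeft (F := F) a (b * h)).comp (dLeft b h) = dLeft (a * b) h := by
  rw [dLeft, dLeft, ← mD_comp (mdiff_mulLeft a _) (mdiff_mulLeft b h), dLeft]
  simp only [mul_assoc]

theorem dRight_comp (a b h : G) :
    (dRight (F := F) a (h * b)).comp (dRight b h) = dRight (b * a) h := by
  rw [dRight, dRight, ← mD_comp (mdiff_mulRight a _) (mdiff_mulRight b h), dRight]
  simp only [mul_assoc]

theorem dLeft_comp_dRight (a b h : G) :
    (dLeft (F := F) a (h * b)).comp (dRight b h) = (dRight b (a * h)).comp (dLeft a h) := by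
  rw [dRight, dLeft, ← mD_comp (mdiff_mulLeft a _) (mdiff_mulRight b h), dRight, dLeft,
    ← mD_comp (mdiff_mulRight b _) (mdiff_mulLeft a h)]
  simp only [mul_assoc]

omit [LieGroup 𝓘(ℝ, F) ∞ G] in
theorem dLeft_one (h : G) : dLeft (F := F) 1 h = ContinuousLinearMap.id ℝ F := by
  unfold dLeft
  simp only [one_mul]
  exact mD_id h

omit [LieGroup 𝓘(ℝ, F) ∞ G] in
theorem dRight_one (h : G) : dRight (F := F) 1 h = ContinuousLinearMap.id ℝ F := by
  unfold dRight
  simp only [mul_one]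
  exact mD_id h

theorem Ad_eq (g : G) : Ad (F := F) g = (dRight g⁻¹ g).comp (dLeft g 1) := by
  change mD (fun h : G => g * h * g⁻¹) 1 = _
  rw [mD_comp_of_eq (f := fun h : G => g * h) (g := fun h => h * g⁻¹) (mdiff_mulRight _ g)
    (mdiff_mulLeft g 1) (mul_one g)]
  rfl

theorem Ad_one : Ad (F := F) (1 : G) = ContinuousLinearMap.id ℝ F := by
  rw [Ad_eq, inv_one, dLeft_one, dRight_one, ContinuousLinearMap.comp_id]

/-- `dR_g Ad_g = dL_g`. -/
theorem dRight_comp_Ad (g : G) : (dRight (F := F) g 1).comp (Ad g) = dLeft g 1 := by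
  rw [Ad_eq, ← ContinuousLinearMap.comp_assoc]
  have h := dRight_comp (F := F) g g⁻¹ g
  rw [mul_inv_cancel, inv_mul_cancel, dRight_one] at h
  rw [h, ContinuousLinearMap.id_comp]

theorem dLeft_inv_comp_dLeft (g : G) :
    (dLeft g⁻¹ g).comp (dLeft g 1) = ContinuousLinearMap.id ℝ F := by
  have h := dLeft_comp (F := F) g⁻¹ g 1
  rwa [mul_one, inv_mul_cancel, dLeft_one] at h

theorem dRight_inv_comp_dRight (g : G) :
    (dRight g⁻¹ g).comp (dRight g 1) = ContinuousLinearMap.id ℝ F := by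
  have h := dRight_comp (F := F) g⁻¹ g 1
  rwa [one_mul, mul_inv_cancel, dRight_one] at h

theorem dLeft_comp_dLeft_inv (g : G) :
    (dLeft g 1).comp (dLeft g⁻¹ g) = ContinuousLinearMap.id ℝ F := by
  have h := dLeft_comp (F := F) g g⁻¹ g
  rwa [inv_mul_cancel, mul_inv_cancel, dLeft_one] at h

theorem dLeft_inv_injective (g : G) : Function.Injective (dLeft (F := F) g⁻¹ g) := by
  intro u v h
  have h1 : ∀ w, dLeft g 1 (dLeft g⁻¹ g w) = w := fun w =>
    congrArg (fun T : F →L[ℝ] F => T w) (dLeft_comp_dLeft_inv (F := F) g)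
  rw [← h1 u, ← h1 v, h]

end Translations


/-! ### One-parameter subgroups -/

section OneParameter

variable {F G : Type*} [NormedAddCommGroup F] [NormedSpace ℝ F] [CompleteSpace F]
  [TopologicalSpace G] [ChartedSpace F G] [Group G] [LieGroup 𝓘(ℝ, F) ∞ G] [T2Space G]

/-- `γ` is an integral curve through `1` of the left-invariant vector field with value `ξ`. -/
def IsOneParam (ξ : F) (γ : ℝ → G) : Prop :=
  γ 0 = 1 ∧ IsMIntegralCurve γ (fun g : G =>
    mulInvariantVectorField (I := 𝓘(ℝ, F)) (show GroupLieAlgebra 𝓘(ℝ, F) G from ξ) g)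

omit [CompleteSpace F] [T2Space G] [LieGroup 𝓘(ℝ, F) ∞ G] in
theorem isOneParam_iff {ξ : F} {γ : ℝ → G} : IsOneParam ξ γ ↔ γ 0 = 1 ∧
    ∀ t, HasMFDerivAt 𝓘(ℝ, ℝ) 𝓘(ℝ, F) γ t
      ((1 : ℝ →L[ℝ] ℝ).smulRight (dLeft (γ t) 1 ξ) : ℝ →L[ℝ] F) := Iff.rfl

omit [CompleteSpace F] [T2Space G] in
theorem lieGroup_three : LieGroup 𝓘(ℝ, F) (minSmoothness ℝ 3) G :=
  LieGroup.of_le (n := ∞) (by rw [minSmoothness_of_isRCLikeNormedField]; exact WithTop.coe_le_coe.2 (le_top (a := (3 : ℕ∞))))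

omit [CompleteSpace F] [T2Space G] in
theorem contMDiff_invariantVectorField (ξ : F) :
    ContMDiff 𝓘(ℝ, F) 𝓘(ℝ, F).tangent 1 (fun g : G =>
      (⟨g, mulInvariantVectorField (I := 𝓘(ℝ, F)) (show GroupLieAlgebra 𝓘(ℝ, F) G from ξ) g⟩ :
        TangentBundle 𝓘(ℝ, F) G)) := by
  have := lieGroup_three (F := F) (G := G)
  exact (contMDiff_mulInvariantVectorField _).of_le (by simp)

/-- Left translates of a local integral curve through `1` are integral curves through every point,
all defined on the same interval. A vector field with such a uniform existence time is complete. -/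
theorem exists_isOneParam (ξ : F) : ∃ γ : ℝ → G, IsOneParam ξ γ := by
  have : IsManifold 𝓘(ℝ, F) 1 G := IsManifold.of_le (n := ∞) (by simp)
  obtain ⟨γ, h0, hγ⟩ := exists_isMIntegralCurveAt_of_contMDiffAt_boundaryless (t₀ := 0)
    ((contMDiff_invariantVectorField (G := G) ξ).contMDiffAt (x := 1))
  obtain ⟨ε, hε, hγ⟩ := isMIntegralCurveAt_iff'.1 hγ
  refine exists_isMIntegralCurve_of_isMIntegralCurveOn (contMDiff_invariantVectorField (G := G) ξ)
    hε (fun g => ⟨fun t => g * γ t, by simp [h0], fun t ht => ?_⟩) 1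
  rw [show Ioo (-ε) ε = Metric.ball 0 ε by rw [Real.ball_eq_Ioo]; simp] at ht ⊢
  have h1 := hγ t ht
  have h2 := (hasMFDerivAt_mD (mdiff_mulLeft (F := F) g (γ t))).comp_hasMFDerivWithinAt t h1
  refine HasMFDerivWithinAt.congr_mfderiv h2 ?_
  have h3 := dLeft_comp (F := F) g (γ t) 1
  rw [mul_one] at h3
  refine ContinuousLinearMap.ext fun (r : ℝ) => ?_
  have h4 := congrArg (fun T : F →L[ℝ] F => T ξ) h3
  change dLeft g (γ t) (r • dLeft (γ t) 1 ξ) = r • dLeft (g * γ t) 1 ξ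
  rw [map_smul]
  exact congrArg _ h4

omit [CompleteSpace F] in
-- Since `G` is Hausdorff, local uniqueness of integral curves propagates along the whole line.
theorem IsOneParam.unique {ξ : F} {γ γ' : ℝ → G} (h : IsOneParam ξ γ) (h' : IsOneParam ξ γ') :
    γ = γ' := by
  have : IsManifold 𝓘(ℝ, F) 1 G := IsManifold.of_le (n := ∞) (by simp)
  exact isMIntegralCurve_Ioo_eq_of_contMDiff_boundaryless (t₀ := 0)
    (contMDiff_invariantVectorField ξ) h.2 h'.2 (h.1.trans h'.1.symm)

omit [CompleteSpace F] in
-- By left-invariance `t ↦ γ(s)⁻¹ γ(t + s)` is again an integral curve through `1`, so it is `γ`.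
theorem IsOneParam.add {ξ : F} {γ : ℝ → G} (h : IsOneParam ξ γ) (s t : ℝ) :
    γ (s + t) = γ s * γ t := by
  have h1 : IsOneParam ξ (fun t => (γ s)⁻¹ * γ (t + s)) := by
    refine ⟨by simp, fun t => ?_⟩
    have h2 := h.2.comp_add s t
    have h3 := (hasMFDerivAt_mD (mdiff_mulLeft (F := F) (γ s)⁻¹ (γ (t + s)))).comp t h2
    refine HasMFDerivAt.congr_mfderiv h3 ?_
    have h3 := dLeft_comp (F := F) (γ s)⁻¹ (γ (t + s)) 1
    rw [mul_one] at h3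
    refine ContinuousLinearMap.ext fun (r : ℝ) => ?_
    have h4 := congrArg (fun T : F →L[ℝ] F => T ξ) h3
    change dLeft (γ s)⁻¹ (γ (t + s)) (r • dLeft (γ (t + s)) 1 ξ) =
      r • dLeft ((γ s)⁻¹ * γ (t + s)) 1 ξ
    rw [map_smul]
    exact congrArg _ h4
  have h2 : γ t = (γ s)⁻¹ * γ (t + s) := congrFun (h.unique h1) t
  rw [h2, mul_inv_cancel_left, add_comm]

omit [CompleteSpace F] [T2Space G] [LieGroup 𝓘(ℝ, F) ∞ G] in
theorem IsOneParam.comp_mul {ξ : F} {γ : ℝ → G} (h : IsOneParam ξ γ) (s : ℝ) :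
    IsOneParam (s • ξ) (fun t => γ (t * s)) := by
  refine ⟨by simp [h.1], fun t => ?_⟩
  refine HasMFDerivAt.congr_mfderiv (h.2.comp_mul s t) ?_
  refine ContinuousLinearMap.ext fun (r : ℝ) => ?_
  change r • s • dLeft (γ (t * s)) 1 ξ = r • dLeft (γ (t * s)) 1 (s • ξ)
  rw [map_smul]

omit [CompleteSpace F] in
-- The exponential is defined through a chosen integral curve. Uniqueness makes the choice
-- immaterial, so any explicit curve computes it.
theorem lieExp_eq {ξ : F} {γ : ℝ → G} (h : IsOneParam ξ γ) : lieExp G ξ = γ 1 := by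
  have hex : ∃ γ : ℝ → G, IsOneParam ξ γ := ⟨γ, h⟩
  have h1 : lieExp G ξ = hex.choose 1 := dif_pos hex
  rw [h1, h.unique hex.choose_spec]

theorem isOneParam_lieExp (ξ : F) : IsOneParam ξ (fun t : ℝ => lieExp G (t • ξ)) := by
  obtain ⟨γ, hγ⟩ := exists_isOneParam (G := G) ξ
  have h : (fun t : ℝ => lieExp G (t • ξ)) = γ := by
    funext t
    rw [lieExp_eq (hγ.comp_mul t), one_mul]
  rwa [h]

theorem lieExp_zero : lieExp G (0 : F) = 1 := by
  simpa using (isOneParam_lieExp (G := G) (0 : F)).1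

theorem lieExp_add_smul (s t : ℝ) (ξ : F) :
    lieExp G ((s + t) • ξ) = lieExp G (s • ξ) * lieExp G (t • ξ) :=
  (isOneParam_lieExp ξ).add s t

theorem lieExp_neg (ξ : F) : lieExp G (-ξ) = (lieExp G ξ)⁻¹ := by
  have h := lieExp_add_smul (G := G) (-1) 1 ξ
  simp only [neg_add_cancel, zero_smul, neg_smul, one_smul, lieExp_zero] at h
  exact eq_inv_of_mul_eq_one_left h.symm

theorem hasMFDerivAt_lieExp_smul (ξ : F) :
    HasMFDerivAt 𝓘(ℝ, ℝ) 𝓘(ℝ, F) (fun t : ℝ => lieExp G (t • ξ)) 0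
      ((1 : ℝ →L[ℝ] ℝ).smulRight ξ : ℝ →L[ℝ] F) := by
  have h := (isOneParam_iff.1 (isOneParam_lieExp (G := G) ξ)).2 0
  simp only [zero_smul, lieExp_zero] at h
  rwa [dLeft_one] at h

/-- `exp (Ad_g ξ) = g exp(ξ) g⁻¹`. -/
theorem lieExp_Ad (g : G) (ξ : F) : lieExp G (Ad g ξ) = g * lieExp G ξ * g⁻¹ := by
  have h : IsOneParam (Ad g ξ) (fun t : ℝ => g * lieExp G (t • ξ) * g⁻¹) := by
    refine isOneParam_iff.2 ⟨by simp [lieExp_zero], fun t => ?_⟩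
    have h1 := (isOneParam_iff.1 (isOneParam_lieExp (G := G) ξ)).2 t
    set γ := lieExp G (t • ξ)
    have h2 := ((hasMFDerivAt_mD (mdiff_mulRight (F := F) g⁻¹ (g * γ))).comp t
      ((hasMFDerivAt_mD (mdiff_mulLeft (F := F) g γ)).comp t h1))
    refine HasMFDerivAt.congr_mfderiv h2 ?_
    refine ContinuousLinearMap.ext fun (r : ℝ) => ?_
    change dRight g⁻¹ (g * γ) (dLeft g γ (r • dLeft γ 1 ξ)) = r • dLeft (g * γ * g⁻¹) 1 (Ad g ξ)
    simp only [map_smul]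
    congr 1
    -- Both sides are the differential at `1` of `h ↦ g γ h g⁻¹`, factored in two ways into left and
    -- right translations.
    have e1 := dLeft_comp (F := F) g γ 1
    have e2 := dLeft_comp_dRight (F := F) (g * γ) g⁻¹ 1
    have e3 := dLeft_comp (F := F) (g * γ) g⁻¹ 1
    have e4 := dLeft_comp (F := F) (g * γ * g⁻¹) g 1
    have e5 := dLeft_comp_dRight (F := F) (g * γ * g⁻¹) g⁻¹ g
    rw [Ad_eq]
    simp only [mul_one, mul_inv_cancel, inv_mul_cancel_right] at e1 e2 e3 e4 e5
    have := congrArg (fun T : F →L[ℝ] F => T.comp (dLeft g 1)) e5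
    simp only [ContinuousLinearMap.comp_assoc] at this
    rw [e4, ← e1] at this
    exact (congrArg (fun T : F →L[ℝ] F => T ξ) this).symm
  rw [lieExp_eq h, one_smul]

end OneParameter


/-! ### The multiplication of a Lie group in the chart at the unit element -/

section LocalGroup

variable {F G : Type*} [NormedAddCommGroup F] [NormedSpace ℝ F]
  [TopologicalSpace G] [ChartedSpace F G] [Group G]

variable (F G) in
/-- The coordinates of the unit element. -/
def unitPt : F := extChartAt 𝓘(ℝ, F) (1 : G) 1

variable (G) in
/-- The multiplication in coordinates. -/
def cMul (p : F × F) : F :=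
  extChartAt 𝓘(ℝ, F) (1 : G) ((extChartAt 𝓘(ℝ, F) (1 : G)).symm p.1 *
    (extChartAt 𝓘(ℝ, F) (1 : G)).symm p.2)

variable (G) in
/-- The right-invariant frame in coordinates. -/
def rightFrame (y : F) : F →L[ℝ] F :=
  (fderiv ℝ (cMul G) (unitPt F G, y)).comp (ContinuousLinearMap.inl ℝ F F)

variable (G) in
/-- The left-invariant frame in coordinates. -/
def leftFrame (y : F) : F →L[ℝ] F :=
  (fderiv ℝ (cMul G) (y, unitPt F G)).comp (ContinuousLinearMap.inr ℝ F F)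

theorem unitPt_mem_target : unitPt F G ∈ (extChartAt 𝓘(ℝ, F) (1 : G)).target :=
  mem_extChartAt_target (1 : G)

theorem symm_unitPt : (extChartAt 𝓘(ℝ, F) (1 : G)).symm (unitPt F G) = 1 :=
  extChartAt_to_inv (1 : G)

variable [LieGroup 𝓘(ℝ, F) ∞ G]

theorem contDiffAt_cMul {p : F × F} (h1 : p.1 ∈ (extChartAt 𝓘(ℝ, F) (1 : G)).target)
    (h2 : p.2 ∈ (extChartAt 𝓘(ℝ, F) (1 : G)).target)
    (h : (extChartAt 𝓘(ℝ, F) (1 : G)).symm p.1 * (extChartAt 𝓘(ℝ, F) (1 : G)).symm p.2 ∈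
      (extChartAt 𝓘(ℝ, F) (1 : G)).source) : ContDiffAt ℝ ∞ (cMul G) p := by
  rw [← contMDiffAt_iff_contDiffAt]
  have e1 : ContMDiffAt 𝓘(ℝ, F × F) 𝓘(ℝ, F) ∞
      (fun p : F × F => (extChartAt 𝓘(ℝ, F) (1 : G)).symm p.1) p :=
    ContMDiffAt.comp p (contMDiffAt_extChartAt_symm_of_mem h1) contDiffAt_fst.contMDiffAt
  have e2 : ContMDiffAt 𝓘(ℝ, F × F) 𝓘(ℝ, F) ∞
      (fun p : F × F => (extChartAt 𝓘(ℝ, F) (1 : G)).symm p.2) p :=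
    ContMDiffAt.comp p (contMDiffAt_extChartAt_symm_of_mem h2) contDiffAt_snd.contMDiffAt
  exact ContMDiffAt.comp p (contMDiffAt_extChartAt_of_mem h) (e1.mul e2)

theorem contDiffAt_cMul_unitPt : ContDiffAt ℝ ∞ (cMul G) (unitPt F G, unitPt F G) := by
  refine contDiffAt_cMul unitPt_mem_target unitPt_mem_target ?_
  simp only [symm_unitPt, mul_one]
  exact mem_extChartAt_source (1 : G)

theorem contDiffAt_fderiv_cMul :
    ContDiffAt ℝ ∞ (fderiv ℝ (cMul G)) (unitPt F G, unitPt F G) :=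
  (contDiffAt_cMul_unitPt (F := F) (G := G)).fderiv_right (by simp)

theorem contDiffAt_rightFrame : ContDiffAt ℝ ∞ (rightFrame G) (unitPt F G) :=
  (ContDiffAt.comp (unitPt F G) (contDiffAt_fderiv_cMul (F := F) (G := G))
    (contDiffAt_const.prodMk contDiffAt_id)).clm_comp contDiffAt_const

theorem contDiffAt_leftFrame : ContDiffAt ℝ ∞ (leftFrame G) (unitPt F G) :=
  (ContDiffAt.comp (f := fun y => (y, unitPt F G)) (unitPt F G) (contDiffAt_fderiv_cMul (F := F) (G := G))
    (contDiffAt_id.prodMk contDiffAt_const)).clm_comp contDiffAt_const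

/-- The partial derivative of the product in its first factor is a right translation. The chart at
the unit has identity differential there, so only the chart differential at the target point
remains. -/
theorem rightFrame_eq {y : F} (hy : y ∈ (extChartAt 𝓘(ℝ, F) (1 : G)).target) :
    rightFrame G y = (chartD 1 ((extChartAt 𝓘(ℝ, F) (1 : G)).symm y)).comp
      (dRight ((extChartAt 𝓘(ℝ, F) (1 : G)).symm y) 1) := by
  set g := (extChartAt 𝓘(ℝ, F) (1 : G)).symm y
  have hg : g ∈ (extChartAt 𝓘(ℝ, F) (1 : G)).source := (extChartAt 𝓘(ℝ, F) (1 : G)).map_target hy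
  have hc : ContDiffAt ℝ ∞ (cMul G) (unitPt F G, y) := by
    refine contDiffAt_cMul unitPt_mem_target hy ?_
    rwa [symm_unitPt, one_mul]
  have h1 : rightFrame G y = fderiv ℝ (fun a => cMul G (a, y)) (unitPt F G) :=
    ((HasFDerivAt.comp (f := fun a => (a, y)) (unitPt F G)
      (hc.differentiableAt (by simp)).hasFDerivAt
      (hasFDerivAt_prodMk_left (unitPt F G) y)).fderiv).symm
  have e1 : MDifferentiableAt 𝓘(ℝ, F) 𝓘(ℝ, F) (fun a : F =>
      (extChartAt 𝓘(ℝ, F) (1 : G)).symm a * g) (unitPt F G) :=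
    MDifferentiableAt.comp (unitPt F G) (mdiff_mulRight g _)
      (mdiff_of_contMDiffAt (contMDiffAt_extChartAt_symm_of_mem unitPt_mem_target))
  rw [h1, ← mD_eq_fderiv]
  change mD (fun a => extChartAt 𝓘(ℝ, F) (1 : G)
    ((extChartAt 𝓘(ℝ, F) (1 : G)).symm a * g)) (unitPt F G) = _
  rw [mD_comp_of_eq (y := g) (mdiff_of_contMDiffAt (contMDiffAt_extChartAt_of_mem hg)) e1
    (by rw [symm_unitPt, one_mul]), mD_comp_of_eq (y := 1) (g := fun h => h * g)
    (mdiff_mulRight g _) (mdiff_of_contMDiffAt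
      (contMDiffAt_extChartAt_symm_of_mem unitPt_mem_target)) symm_unitPt]
  have h2 := chartDSymm_self (E := F) (1 : G)
  unfold chartDSymm at h2
  rw [unitPt, h2]
  rfl

theorem leftFrame_eq {y : F} (hy : y ∈ (extChartAt 𝓘(ℝ, F) (1 : G)).target) :
    leftFrame G y = (chartD 1 ((extChartAt 𝓘(ℝ, F) (1 : G)).symm y)).comp
      (dLeft ((extChartAt 𝓘(ℝ, F) (1 : G)).symm y) 1) := by
  set g := (extChartAt 𝓘(ℝ, F) (1 : G)).symm y
  have hg : g ∈ (extChartAt 𝓘(ℝ, F) (1 : G)).source := (extChartAt 𝓘(ℝ, F) (1 : G)).map_target hy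
  have hc : ContDiffAt ℝ ∞ (cMul G) (y, unitPt F G) := by
    refine contDiffAt_cMul hy unitPt_mem_target ?_
    rwa [symm_unitPt, mul_one]
  have h1 : leftFrame G y = fderiv ℝ (fun a => cMul G (y, a)) (unitPt F G) :=
    (((hc.differentiableAt (by simp)).hasFDerivAt.comp (unitPt F G)
      (hasFDerivAt_prodMk_right y (unitPt F G))).fderiv).symm
  have e1 : MDifferentiableAt 𝓘(ℝ, F) 𝓘(ℝ, F) (fun a : F =>
      g * (extChartAt 𝓘(ℝ, F) (1 : G)).symm a) (unitPt F G) :=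
    MDifferentiableAt.comp (unitPt F G) (mdiff_mulLeft g _)
      (mdiff_of_contMDiffAt (contMDiffAt_extChartAt_symm_of_mem unitPt_mem_target))
  rw [h1, ← mD_eq_fderiv]
  change mD (fun a => extChartAt 𝓘(ℝ, F) (1 : G)
    (g * (extChartAt 𝓘(ℝ, F) (1 : G)).symm a)) (unitPt F G) = _
  rw [mD_comp_of_eq (y := g) (mdiff_of_contMDiffAt (contMDiffAt_extChartAt_of_mem hg)) e1
    (by rw [symm_unitPt, mul_one]), mD_comp_of_eq (y := 1) (g := fun h => g * h)
    (mdiff_mulLeft g _) (mdiff_of_contMDiffAt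
      (contMDiffAt_extChartAt_symm_of_mem unitPt_mem_target)) symm_unitPt]
  have h2 := chartDSymm_self (E := F) (1 : G)
  unfold chartDSymm at h2
  rw [unitPt, h2]
  rfl

theorem rightFrame_unitPt : rightFrame G (unitPt F G) = ContinuousLinearMap.id ℝ F := by
  rw [rightFrame_eq unitPt_mem_target, symm_unitPt, chartD_self, dRight_one,
    ContinuousLinearMap.comp_id]

theorem leftFrame_unitPt : leftFrame G (unitPt F G) = ContinuousLinearMap.id ℝ F := by
  rw [leftFrame_eq unitPt_mem_target, symm_unitPt, chartD_self, dLeft_one,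
    ContinuousLinearMap.comp_id]

/-- The Lie bracket in coordinates. -/
theorem bracket_eq (ξ η : F) : bracket G ξ η =
    fderiv ℝ (leftFrame G) (unitPt F G) ξ η - fderiv ℝ (leftFrame G) (unitPt F G) η ξ := by
  set V : F → (g : G) → TangentSpace 𝓘(ℝ, F) g := fun ξ g =>
    mulInvariantVectorField (I := 𝓘(ℝ, F)) (show GroupLieAlgebra 𝓘(ℝ, F) G from ξ) g
  let W : F → F → F := fun ξ => VectorField.mpullbackWithin 𝓘(ℝ, F) 𝓘(ℝ, F)
    (extChartAt 𝓘(ℝ, F) (1 : G)).symm (V ξ) (range 𝓘(ℝ, F))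
  -- In the chart at the unit the left-invariant field is a column of the left frame, because the
  -- differentials of the chart and of its inverse are mutually inverse.
  have h1 : ∀ ξ : F, W ξ =ᶠ[𝓝 (unitPt F G)] fun y => leftFrame G y ξ := by
    intro ξ
    filter_upwards [extChartAt_target_mem_nhds_of_mem (unitPt_mem_target (F := F) (G := G))]
      with y hy
    rw [leftFrame_eq hy]
    have e1 := chartD_comp_chartDSymm hy
    have e2 := chartDSymm_comp_chartD ((extChartAt 𝓘(ℝ, F) (1 : G)).map_target hy)
    rw [(extChartAt 𝓘(ℝ, F) (1 : G)).right_inv hy] at e2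
    have e3 := ContinuousLinearMap.inverse_eq e2 e1
    rw [← e3]
    simp only [W, VectorField.mpullbackWithin, modelWithCornersSelf_coe, range_id, mfderivWithin_univ]
    rfl
  have h2 : ∀ ξ η : F, fderiv ℝ (fun y => leftFrame G y ξ) (unitPt F G) η =
      fderiv ℝ (leftFrame G) (unitPt F G) η ξ := fun ξ η => by
    have h := ((contDiffAt_leftFrame (F := F) (G := G)).differentiableAt (by simp)).hasFDerivAt
    rw [(h.clm_apply (hasFDerivAt_const ξ _)).fderiv]
    simp
  have h3 : bracket G ξ η = (chartD (1 : G) 1).inverse (VectorField.lieBracketWithin ℝ (W ξ) (W η)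
      ((extChartAt 𝓘(ℝ, F) (1 : G)).symm ⁻¹' univ ∩ range 𝓘(ℝ, F)) (unitPt F G)) := rfl
  rw [h3, chartD_self, ContinuousLinearMap.inverse_id]
  simp only [preimage_univ, modelWithCornersSelf_coe, range_id, inter_univ,
    VectorField.lieBracketWithin_univ]
  rw [Filter.EventuallyEq.lieBracket_vectorField_eq (h1 ξ) (h1 η), VectorField.lieBracket, h2, h2,
    leftFrame_unitPt]
  rfl

/-- The derivative of `y ↦ R(y) η - L(y) η` at the unit element is `[η, ·]`, where `R` and `L` are
the invariant frames. -/
theorem hasFDerivAt_frame_sub (η : F) : ∃ A : F →L[ℝ] F, (∀ u, A u = bracket G η u) ∧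
    HasFDerivAt (fun y => rightFrame G y η - leftFrame G y η) A (unitPt F G) := by
  have hR := (((contDiffAt_rightFrame (F := F) (G := G)).differentiableAt
    (by simp)).hasFDerivAt).clm_apply (hasFDerivAt_const η _)
  have hL := (((contDiffAt_leftFrame (F := F) (G := G)).differentiableAt
    (by simp)).hasFDerivAt).clm_apply (hasFDerivAt_const η _)
  refine ⟨_, fun u => ?_, hR.sub hL⟩
  have hm := ((contDiffAt_fderiv_cMul (F := F) (G := G)).differentiableAt (by simp)).hasFDerivAt
  have hsymm : IsSymmSndFDerivAt ℝ (cMul G) (unitPt F G, unitPt F G) :=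
    (contDiffAt_cMul_unitPt (F := F) (G := G)).isSymmSndFDerivAt
      (by rw [minSmoothness_of_isRCLikeNormedField]; exact WithTop.coe_le_coe.2 le_top)
  have e1 : ∀ u v, fderiv ℝ (rightFrame G) (unitPt F G) u v =
      fderiv ℝ (fderiv ℝ (cMul G)) (unitPt F G, unitPt F G) (0, u) (v, 0) := fun u v => by
    have h : HasFDerivAt (fun y => fderiv ℝ (cMul G) (unitPt F G, y)) _ (unitPt F G) :=
      hm.comp (unitPt F G) (hasFDerivAt_prodMk_right _ _)
    have h' := (h.clm_comp (hasFDerivAt_const (ContinuousLinearMap.inl ℝ F F) _)).fderiv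
    change fderiv ℝ (fun y => (fderiv ℝ (cMul G) (unitPt F G, y)).comp
      (ContinuousLinearMap.inl ℝ F F)) _ _ _ = _
    rw [h']
    simp
  have e2 : ∀ u v, fderiv ℝ (leftFrame G) (unitPt F G) u v =
      fderiv ℝ (fderiv ℝ (cMul G)) (unitPt F G, unitPt F G) (u, 0) (0, v) := fun u v => by
    have h : HasFDerivAt (fun y => fderiv ℝ (cMul G) (y, unitPt F G)) _ (unitPt F G) :=
      HasFDerivAt.comp (f := fun y => (y, unitPt F G)) (unitPt F G) hm
        (hasFDerivAt_prodMk_left _ _)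
    have h' := (h.clm_comp (hasFDerivAt_const (ContinuousLinearMap.inr ℝ F F) _)).fderiv
    change fderiv ℝ (fun y => (fderiv ℝ (cMul G) (y, unitPt F G)).comp
      (ContinuousLinearMap.inr ℝ F F)) _ _ _ = _
    rw [h']
    simp
  -- Symmetry of the second derivative of the product at the unit: the same mixed derivative is that
  -- of `R η` along `u` and that of `L u` along `η`. Subtracting the derivative of `L η` along `u`
  -- leaves `[η, u]`.
  have e3 : fderiv ℝ (rightFrame G) (unitPt F G) u η = fderiv ℝ (leftFrame G) (unitPt F G) η u := by
    rw [e1, e2, hsymm.eq]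
  rw [bracket_eq, ← e3]
  simp

/-- The derivative of a curve `t ↦ a(t) g b(t)` with `a(0) = b(0) = 1`. -/
theorem hasMFDerivAt_mul_mul {a b : ℝ → G} {ξ η : F} (g : G) (ha0 : a 0 = 1) (hb0 : b 0 = 1)
    (ha : HasMFDerivAt 𝓘(ℝ, ℝ) 𝓘(ℝ, F) a 0 ((1 : ℝ →L[ℝ] ℝ).smulRight ξ : ℝ →L[ℝ] F))
    (hb : HasMFDerivAt 𝓘(ℝ, ℝ) 𝓘(ℝ, F) b 0 ((1 : ℝ →L[ℝ] ℝ).smulRight η : ℝ →L[ℝ] F)) :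
    HasMFDerivAt 𝓘(ℝ, ℝ) 𝓘(ℝ, F) (fun t => a t * g * b t) 0
      ((1 : ℝ →L[ℝ] ℝ).smulRight (dRight g 1 ξ + dLeft g 1 η) : ℝ →L[ℝ] F) := by
  have h1 : MDifferentiableAt (𝓘(ℝ, F).prod 𝓘(ℝ, F)) 𝓘(ℝ, F)
      (fun p : G × G => p.1 * g * p.2) (a 0, b 0) := by
    have : ContMDiffAt (𝓘(ℝ, F).prod 𝓘(ℝ, F)) 𝓘(ℝ, F) ∞
        (fun p : G × G => p.1 * g * p.2) (a 0, b 0) :=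
      (contMDiffAt_fst.mul contMDiffAt_const).mul contMDiffAt_snd
    exact this.mdifferentiableAt (by simp)
  have h2 := HasMFDerivAt.comp (0 : ℝ) h1.hasMFDerivAt (ha.prodMk hb)
  refine HasMFDerivAt.congr_mfderiv h2 ?_
  refine ContinuousLinearMap.ext fun (r : ℝ) => ?_
  have h3 := mfderiv_prod_eq_add_apply (v := ((r • ξ, r • η) : F × F)) h1
  refine h3.trans ?_
  change mD (fun z => z * g * b 0) (a 0) (r • ξ) + mD (fun z => a 0 * g * z) (b 0) (r • η) = 
    r • (dRight g 1 ξ + dLeft g 1 η)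
  simp only [ha0, hb0, mul_one, one_mul, map_smul, smul_add]
  rfl

end LocalGroup


/-! ### A perturbed differential equation -/

section Perturbed

variable {F : Type*} [NormedAddCommGroup F] [NormedSpace ℝ F]

theorem gronwallBound_zero_mul (K ε x : ℝ) :
    gronwallBound 0 K ε x = ε * gronwallBound 0 K 1 x := by
  unfold gronwallBound
  split_ifs <;> ring

/-- A bound for the solutions of `u' = R(u) X + n(u)`, `u(0) = y₀`, where `n(y₀) = 0`. -/
theorem norm_sub_le_of_perturbed {R : F → F →L[ℝ] F} {n : F → F} {y₀ X : F} {r C T : ℝ} {u : ℝ → F}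
    (hC : 0 ≤ C) (hT : T ≤ 1) (hR : ∀ y ∈ Metric.closedBall y₀ r, ‖R y‖ ≤ 2)
    (hn : ∀ y ∈ Metric.closedBall y₀ r, ‖n y‖ ≤ C * ‖y - y₀‖) (h0 : u 0 = y₀)
    (hu : ∀ t ∈ Icc 0 T, u t ∈ Metric.closedBall y₀ r)
    (hu' : ∀ t ∈ Icc 0 T, HasDerivAt u (R (u t) X + n (u t)) t) :
    ∀ t ∈ Icc 0 T, ‖u t - y₀‖ ≤ 2 * gronwallBound 0 C 1 1 * ‖X‖ := by
  intro t ht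
  have h := norm_le_gronwallBound_of_norm_deriv_right_le (f := fun t => u t - y₀)
    (f' := fun t => R (u t) X + n (u t)) (δ := 0) (K := C) (ε := 2 * ‖X‖) (a := 0) (b := T)
    (fun s hs => ((hu' s hs).continuousAt.continuousWithinAt.sub continuousWithinAt_const))
    (fun s hs => ((hu' s (Ico_subset_Icc_self hs)).sub_const y₀).hasDerivWithinAt)
    (by simp [h0]) (fun s hs => ?_) t ht
  · refine h.trans ?_
    rw [sub_zero, gronwallBound_zero_mul]
    have := gronwallBound_mono le_rfl zero_le_one hC (ht.2.trans hT)
    nlinarith [norm_nonneg X]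
  · have hs' := hu s (Ico_subset_Icc_self hs)
    calc ‖R (u s) X + n (u s)‖ ≤ ‖R (u s)‖ * ‖X‖ + C * ‖u s - y₀‖ :=
          (norm_add_le _ _).trans (add_le_add ((R (u s)).le_opNorm X) (hn _ hs'))
      _ ≤ C * ‖u s - y₀‖ + 2 * ‖X‖ := by nlinarith [hR _ hs', norm_nonneg X]

/-- The solutions of `u' = R(u) X + n(u)`, `u(0) = y₀`, are approximated by those of the linearized
equation. -/
theorem norm_sub_phi₁_le_of_perturbed [CompleteSpace F] {R : F → F →L[ℝ] F} {n : F → F} {y₀ X : F}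
    {r ε κ : ℝ} {A : F →L[ℝ] F} {u : ℝ → F} (hε : 0 ≤ ε)
    (hR : ∀ y ∈ Metric.closedBall y₀ r, ‖R y - 1‖ ≤ ε)
    (hn : ∀ y ∈ Metric.closedBall y₀ r, ‖n y - A (y - y₀)‖ ≤ ε * ‖y - y₀‖) (h0 : u 0 = y₀)
    (hu : ∀ t ∈ Icc (0 : ℝ) 1, u t ∈ Metric.closedBall y₀ r)
    (hκ : ∀ t ∈ Icc (0 : ℝ) 1, ‖u t - y₀‖ ≤ κ * ‖X‖)
    (hu' : ∀ t ∈ Icc (0 : ℝ) 1, HasDerivAt u (R (u t) X + n (u t)) t) :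
    ‖u 1 - y₀ - phi₁ 1 A X‖ ≤ ε * (1 + κ) * gronwallBound 0 ‖A‖ 1 1 * ‖X‖ := by
  have hphi : ∀ s, HasDerivAt (fun s => phi₁ s A X) (X + A (phi₁ s A X)) s := fun s => by
    have h : X + A (phi₁ s A X) = phi₀ s A X := by
      rw [phi₀_eq_add, phi₁_comm]; simp
    rw [h]
    simpa using (hasDerivAt_phi₁ A s).clm_apply (hasDerivAt_const s X)
  have h := norm_le_gronwallBound_of_norm_deriv_right_le
    (f := fun t => u t - y₀ - phi₁ t A X)
    (f' := fun t => R (u t) X + n (u t) - (X + A (phi₁ t A X))) (δ := 0) (K := ‖A‖)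
    (ε := ε * (1 + κ) * ‖X‖) (a := 0) (b := 1)
    (fun s hs => (((hu' s hs).sub_const y₀).sub (hphi s)).continuousAt.continuousWithinAt)
    (fun s hs => (((hu' s (Ico_subset_Icc_self hs)).sub_const y₀).sub (hphi s)).hasDerivWithinAt)
    (by simp [h0]) (fun s hs => ?_) 1 (right_mem_Icc.2 zero_le_one)
  · rw [gronwallBound_zero_mul] at h
    refine h.trans (le_of_eq ?_)
    rw [sub_zero]
    ring
  · have hs' := Ico_subset_Icc_self hs
    -- The defect `v = u - y₀ - φ₁ X` satisfies `v' = A v + r` with `‖r‖ ≤ ε (1 + κ) ‖X‖`, and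
    -- Grönwall's inequality applies.
    have e : R (u s) X + n (u s) - (X + A (phi₁ s A X)) = A (u s - y₀ - phi₁ s A X) +
        ((R (u s) - 1) X + (n (u s) - A (u s - y₀))) := by
      simp
      abel
    rw [e]
    have h1 := hR _ (hu s hs')
    have h2 := hn _ (hu s hs')
    have h3 := hκ s hs'
    have h4 : ‖(R (u s) - 1) X‖ ≤ ε * ‖X‖ :=
      ((R (u s) - 1).le_opNorm X).trans (mul_le_mul_of_nonneg_right h1 (norm_nonneg X))
    have h5 : ‖n (u s) - A (u s - y₀)‖ ≤ ε * (κ * ‖X‖) :=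
      h2.trans (mul_le_mul_of_nonneg_left h3 hε)
    refine (norm_add_le _ _).trans (add_le_add (A.le_opNorm _) ?_)
    refine (norm_add_le _ _).trans ?_
    linarith

end Perturbed

/-! ### The differential of the exponential map -/

section ExpDeriv

variable {F G : Type*} [NormedAddCommGroup F] [NormedSpace ℝ F]
  [FiniteDimensional ℝ F] [CompleteSpace F]
  [TopologicalSpace G] [ChartedSpace F G] [Group G] [LieGroup 𝓘(ℝ, F) ∞ G] [T2Space G]

omit [FiniteDimensional ℝ F] [CompleteSpace F] [T2Space G] in
theorem hasDerivAt_chart_curve {c : ℝ → G} {s : ℝ} {v : F} {p : G}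
    (hs : c s ∈ (extChartAt 𝓘(ℝ, F) p).source)
    (h : HasMFDerivAt 𝓘(ℝ, ℝ) 𝓘(ℝ, F) c s ((1 : ℝ →L[ℝ] ℝ).smulRight v : ℝ →L[ℝ] F)) :
    HasDerivAt (fun t => extChartAt 𝓘(ℝ, F) p (c t)) (chartD p (c s) v) s := by
  have h1 := (hasMFDerivAt_mD (mdiff_of_contMDiffAt (contMDiffAt_extChartAt_of_mem hs))).comp s h
  have h2 : HasFDerivAt (fun t => extChartAt 𝓘(ℝ, F) p (c t))
    ((chartD p (c s)).comp ((1 : ℝ →L[ℝ] ℝ).smulRight v)) s := h1.hasFDerivAt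
  refine h2.hasDerivAt.congr_deriv ?_
  change chartD p (c s) ((1 : ℝ) • v) = _
  rw [one_smul]

/-- The curve `exp (s (η + X)) exp (-s η)`. -/
def expQuot (G : Type*) [TopologicalSpace G] [ChartedSpace F G] [Group G] (η X : F) (s : ℝ) : G :=
  lieExp G (s • (η + X)) * lieExp G (s • (-η))

omit [FiniteDimensional ℝ F] in
theorem hasMFDerivAt_expQuot (η X : F) (s : ℝ) :
    HasMFDerivAt 𝓘(ℝ, ℝ) 𝓘(ℝ, F) (expQuot G η X) s ((1 : ℝ →L[ℝ] ℝ).smulRight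
      (dRight (expQuot G η X s) 1 (η + X) - dLeft (expQuot G η X s) 1 η) : ℝ →L[ℝ] F) := by
  -- With `c` the curve in question, `c(t) = exp((t - s)(η + X)) c(s) exp(-(t - s)η)`, so a
  -- derivative at time `0` suffices.
  have h := hasMFDerivAt_mul_mul (expQuot G η X s) (by simp [lieExp_zero]) (by simp [lieExp_zero])
    (hasMFDerivAt_lieExp_smul (G := G) (η + X)) (hasMFDerivAt_lieExp_smul (G := G) (-η))
  have h1 : HasMFDerivAt 𝓘(ℝ, ℝ) 𝓘(ℝ, ℝ) (fun t : ℝ => t - s) s (ContinuousLinearMap.id ℝ ℝ) :=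
    ((hasFDerivAt_id s).sub_const s).hasMFDerivAt
  have h2 := HasMFDerivAt.comp s (f := fun t : ℝ => t - s) (by rw [sub_self]; exact h) h1
  have h3 : (fun t => lieExp G (t • (η + X)) * expQuot G η X s * lieExp G (t • -η)) ∘
      (fun t : ℝ => t - s) = expQuot G η X := by
    funext t
    have e1 := lieExp_add_smul (G := G) (t - s) s (η + X)
    have e2 := lieExp_add_smul (G := G) s (t - s) (-η)
    rw [sub_add_cancel] at e1
    rw [add_sub_cancel] at e2
    simp only [Function.comp_apply, expQuot, e1, e2, mul_assoc]
  rw [h3] at h2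
  refine HasMFDerivAt.congr_mfderiv h2 ?_
  refine ContinuousLinearMap.ext fun (r : ℝ) => ?_
  change r • (dRight (expQuot G η X s) 1 (η + X) + dLeft (expQuot G η X s) 1 (-η)) =
    r • (dRight (expQuot G η X s) 1 (η + X) - dLeft (expQuot G η X s) 1 η)
  rw [map_neg, sub_eq_add_neg]

omit [FiniteDimensional ℝ F] in
theorem expQuot_zero (η X : F) : expQuot G η X 0 = 1 := by
  simp [expQuot, lieExp_zero]

omit [FiniteDimensional ℝ F] in
theorem continuous_expQuot (η X : F) : Continuous (expQuot G η X) :=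
  continuous_iff_continuousAt.2 fun s => (hasMFDerivAt_expQuot η X s).continuousAt

omit [FiniteDimensional ℝ F] in
/-- The differential equation for `exp (s (η + X)) exp (-s η)` in the chart at the unit element. -/
theorem hasDerivAt_chart_expQuot (η X : F) {s : ℝ}
    (hs : expQuot G η X s ∈ (extChartAt 𝓘(ℝ, F) (1 : G)).source) :
    HasDerivAt (fun t => extChartAt 𝓘(ℝ, F) (1 : G) (expQuot G η X t))
      (rightFrame G (extChartAt 𝓘(ℝ, F) (1 : G) (expQuot G η X s)) X +
        (rightFrame G (extChartAt 𝓘(ℝ, F) (1 : G) (expQuot G η X s)) η -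
          leftFrame G (extChartAt 𝓘(ℝ, F) (1 : G) (expQuot G η X s)) η)) s := by
  refine (hasDerivAt_chart_curve hs (hasMFDerivAt_expQuot η X s)).congr_deriv ?_
  have ht := (extChartAt 𝓘(ℝ, F) (1 : G)).map_source hs
  rw [rightFrame_eq ht, leftFrame_eq ht, (extChartAt 𝓘(ℝ, F) (1 : G)).left_inv hs]
  simp
  abel

omit [CompleteSpace F] [LieGroup 𝓘(ℝ, F) ∞ G] in
/-- The coordinate balls around the unit element are closed subsets of the group. -/
theorem isClosed_image_closedBall {r : ℝ}
    (hr : Metric.closedBall (unitPt F G) r ⊆ (extChartAt 𝓘(ℝ, F) (1 : G)).target) :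
    IsClosed ((extChartAt 𝓘(ℝ, F) (1 : G)).symm '' Metric.closedBall (unitPt F G) r) := by
  have := FiniteDimensional.proper ℝ F
  exact ((isCompact_closedBall _ r).image_of_continuousOn
    ((continuousOn_extChartAt_symm (1 : G)).mono hr)).isClosed

/-- For small `X` the curve `exp (s (η + X)) exp (-s η)`, `0 ≤ s ≤ 1`, stays in a given coordinate
ball. -/
theorem expQuot_mem_of_small {η X : F} {r C : ℝ} (hC : 0 ≤ C) (hr0 : 0 ≤ r)
    (hr : Metric.closedBall (unitPt F G) r ⊆ (extChartAt 𝓘(ℝ, F) (1 : G)).target)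
    (hR : ∀ y ∈ Metric.closedBall (unitPt F G) r, ‖rightFrame G y‖ ≤ 2)
    (hn : ∀ y ∈ Metric.closedBall (unitPt F G) r,
      ‖rightFrame G y η - leftFrame G y η‖ ≤ C * ‖y - unitPt F G‖)
    (hX : 2 * gronwallBound 0 C 1 1 * ‖X‖ < r) :
    ∀ t ∈ Icc (0 : ℝ) 1, expQuot G η X t ∈
      (extChartAt 𝓘(ℝ, F) (1 : G)).symm '' Metric.closedBall (unitPt F G) r := by
  set D := (extChartAt 𝓘(ℝ, F) (1 : G)).symm '' Metric.closedBall (unitPt F G) r with hD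
  have hDmem : ∀ g ∈ D, g ∈ (extChartAt 𝓘(ℝ, F) (1 : G)).source ∧
      extChartAt 𝓘(ℝ, F) (1 : G) g ∈ Metric.closedBall (unitPt F G) r := by
    rintro _ ⟨y, hy, rfl⟩
    refine ⟨(extChartAt 𝓘(ℝ, F) (1 : G)).map_target (hr hy), ?_⟩
    rwa [(extChartAt 𝓘(ℝ, F) (1 : G)).right_inv (hr hy)]
  -- Continuous induction on the time. The good times form a closed set because the coordinate ball
  -- is compact in a Hausdorff group. As long as the curve has stayed in the ball, the a priori
  -- bound keeps it strictly inside, so it can be continued.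
  refine IsClosed.Icc_subset_of_forall_mem_nhdsGT_of_Icc_subset (s := expQuot G η X ⁻¹' D)
    (((isClosed_image_closedBall hr).preimage (continuous_expQuot η X)).inter isClosed_Icc)
    ⟨unitPt F G, Metric.mem_closedBall_self hr0, by rw [symm_unitPt, expQuot_zero]⟩
    fun t ht hsub => ?_
  have hb := norm_sub_le_of_perturbed (R := rightFrame G) (X := X)
    (n := fun y => rightFrame G y η - leftFrame G y η)
    (u := fun t => extChartAt 𝓘(ℝ, F) (1 : G) (expQuot G η X t)) hC ht.2.le hR hn
    (by simp only [expQuot_zero]; rfl) (fun s hs => (hDmem _ (hsub hs)).2)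
    (fun s hs => hasDerivAt_chart_expQuot η X (hDmem _ (hsub hs)).1) t (right_mem_Icc.2 ht.1)
  have hts := (hDmem _ (hsub (right_mem_Icc.2 ht.1))).1
  have h1 : ∀ᶠ g in 𝓝 (expQuot G η X t), g ∈ (extChartAt 𝓘(ℝ, F) (1 : G)).source ∧
      ‖extChartAt 𝓘(ℝ, F) (1 : G) g - unitPt F G‖ < r := by
    refine Filter.Eventually.and (show ∀ᶠ g in 𝓝 (expQuot G η X t),
      g ∈ (extChartAt 𝓘(ℝ, F) (1 : G)).source from
        (isOpen_extChartAt_source (1 : G)).mem_nhds hts) ?_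
    exact (((continuousAt_extChartAt' hts).sub continuousAt_const).norm).eventually_lt
      continuousAt_const (hb.trans_lt hX)
  refine mem_nhdsWithin_of_mem_nhds ?_
  filter_upwards [(continuous_expQuot η X).continuousAt.eventually h1] with s hs
  exact ⟨_, mem_closedBall_iff_norm.2 hs.2.le,
    (extChartAt 𝓘(ℝ, F) (1 : G)).left_inv hs.1⟩

variable (G) in
/-- The adjoint representation of the Lie algebra of `G`. -/
def adL : F →L[ℝ] F →L[ℝ] F :=
  letI L : F →ₗ[ℝ] F →ₗ[ℝ] F := LinearMap.mk₂ ℝ (bracket G)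
    (fun x y z => by simp [bracket_eq]; abel) (fun c x y => by simp [bracket_eq, smul_sub])
    (fun x y z => by simp [bracket_eq]; abel) (fun c x y => by simp [bracket_eq, smul_sub])
  LinearMap.toContinuousLinearMap
    ((LinearMap.toContinuousLinearMap : (F →ₗ[ℝ] F) ≃ₗ[ℝ] (F →L[ℝ] F)).toLinearMap.comp L)

omit [CompleteSpace F] [T2Space G] in
@[simp] theorem adL_apply (x y : F) : adL G x y = bracket G x y := rfl

omit [CompleteSpace F] [T2Space G] in
theorem hasFDerivAt_frame_sub_adL (η : F) :
    HasFDerivAt (fun y => rightFrame G y η - leftFrame G y η) (adL G η) (unitPt F G) := by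
  obtain ⟨A, hA, h⟩ := hasFDerivAt_frame_sub (G := G) η
  rwa [show adL G η = A from ContinuousLinearMap.ext fun u => (hA u).symm]

/-- The derivative at `X = 0` of `exp (η + X) exp (-η)` in the chart at the unit element. -/
theorem hasFDerivAt_chart_expQuot (η : F) :
    (∀ᶠ X in 𝓝 (0 : F), expQuot G η X 1 ∈ (extChartAt 𝓘(ℝ, F) (1 : G)).source) ∧
    HasFDerivAt (fun X => extChartAt 𝓘(ℝ, F) (1 : G) (expQuot G η X 1)) (phi₁ 1 (adL G η)) 0 := by
  have hn := hasFDerivAt_frame_sub_adL (G := G) η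
  have hn0 : rightFrame G (unitPt F G) η - leftFrame G (unitPt F G) η = 0 := by
    rw [rightFrame_unitPt, leftFrame_unitPt, sub_self]
  have hRc := (contDiffAt_rightFrame (F := F) (G := G)).continuousAt
  -- The norm of the linearization, plus `1` to absorb the remainder, whose relative size is `ε ≤ 1`
  -- below.
  set C := ‖adL G η‖ + 1 with hCdef
  have hC : 0 ≤ C := by positivity
  have hball : ∀ ε > 0, ∃ r > 0, Metric.closedBall (unitPt F G) r ⊆
      (extChartAt 𝓘(ℝ, F) (1 : G)).target ∧
      (∀ y ∈ Metric.closedBall (unitPt F G) r, ‖rightFrame G y - 1‖ ≤ ε) ∧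
      (∀ y ∈ Metric.closedBall (unitPt F G) r,
        ‖rightFrame G y η - leftFrame G y η - adL G η (y - unitPt F G)‖ ≤
          ε * ‖y - unitPt F G‖) := by
    intro ε hε
    have h1 : ∀ᶠ y in 𝓝 (unitPt F G), y ∈ (extChartAt 𝓘(ℝ, F) (1 : G)).target :=
      extChartAt_target_mem_nhds_of_mem (unitPt_mem_target (F := F) (G := G))
    have h2 : ∀ᶠ y in 𝓝 (unitPt F G), ‖rightFrame G y - 1‖ ≤ ε := by
      have h := (hRc.sub (continuousAt_const (y := (1 : F →L[ℝ] F)))).norm.eventually_lt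
        (continuousAt_const (y := ε)) (by
          simp only [Pi.sub_apply, rightFrame_unitPt]
          simpa [ContinuousLinearMap.one_def] using hε)
      exact h.mono fun y hy => hy.le
    have h3 := hn.isLittleO.def hε
    simp only [hn0, sub_zero] at h3
    obtain ⟨r, hr, hr'⟩ := Metric.nhds_basis_closedBall.mem_iff.1 (h1.and (h2.and h3))
    exact ⟨r, hr, fun y hy => (hr' hy).1, fun y hy => (hr' hy).2.1, fun y hy => (hr' hy).2.2⟩
  have hone : ‖(1 : F →L[ℝ] F)‖ ≤ 1 := ContinuousLinearMap.norm_id_le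
  set κ := 2 * gronwallBound 0 C 1 1 with hκ
  have hκ0 : 0 ≤ κ := by
    have := gronwallBound_mono (δ := 0) (ε := 1) le_rfl zero_le_one hC (zero_le_one (α := ℝ))
    rw [gronwallBound_x0] at this
    positivity
  have hmain : ∀ ε > 0, ε ≤ 1 → ∀ᶠ X in 𝓝 (0 : F),
      expQuot G η X 1 ∈ (extChartAt 𝓘(ℝ, F) (1 : G)).source ∧
      ‖extChartAt 𝓘(ℝ, F) (1 : G) (expQuot G η X 1) - unitPt F G - phi₁ 1 (adL G η) X‖ ≤
        ε * (1 + κ) * gronwallBound 0 ‖adL G η‖ 1 1 * ‖X‖ := by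
    intro ε hε hε1
    obtain ⟨r, hr0, hr, hR, hN⟩ := hball ε hε
    have hX : ∀ᶠ X in 𝓝 (0 : F), κ * ‖X‖ < r := by
      have h : ContinuousAt (fun X : F => κ * ‖X‖) 0 := by fun_prop
      exact h.eventually_lt continuousAt_const (by simpa using hr0)
    filter_upwards [hX] with X hX
    have hR2 : ∀ y ∈ Metric.closedBall (unitPt F G) r, ‖rightFrame G y‖ ≤ 2 := fun y hy => by
      have := norm_add_le (rightFrame G y - 1) 1
      rw [sub_add_cancel] at this
      linarith [hR y hy]
    have hN2 : ∀ y ∈ Metric.closedBall (unitPt F G) r,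
        ‖rightFrame G y η - leftFrame G y η‖ ≤ C * ‖y - unitPt F G‖ := fun y hy => by
      have h1 := norm_add_le (rightFrame G y η - leftFrame G y η - adL G η (y - unitPt F G))
        (adL G η (y - unitPt F G))
      rw [sub_add_cancel] at h1
      have h2 := (adL G η).le_opNorm (y - unitPt F G)
      have h3 := hN y hy
      rw [hCdef]
      nlinarith [norm_nonneg (y - unitPt F G)]
    have hmem := expQuot_mem_of_small hC hr0.le hr hR2 hN2 hX
    have hDmem : ∀ t ∈ Icc (0 : ℝ) 1, expQuot G η X t ∈ (extChartAt 𝓘(ℝ, F) (1 : G)).source ∧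
        extChartAt 𝓘(ℝ, F) (1 : G) (expQuot G η X t) ∈ Metric.closedBall (unitPt F G) r := by
      intro t ht
      obtain ⟨y, hy, hyt⟩ := hmem t ht
      rw [← hyt]
      refine ⟨(extChartAt 𝓘(ℝ, F) (1 : G)).map_target (hr hy), ?_⟩
      rwa [(extChartAt 𝓘(ℝ, F) (1 : G)).right_inv (hr hy)]
    have hu0 : extChartAt 𝓘(ℝ, F) (1 : G) (expQuot G η X 0) = unitPt F G := by
      rw [expQuot_zero]; rfl
    have hap := norm_sub_le_of_perturbed (R := rightFrame G) (X := X)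
      (n := fun y => rightFrame G y η - leftFrame G y η)
      (u := fun t => extChartAt 𝓘(ℝ, F) (1 : G) (expQuot G η X t)) hC le_rfl hR2 hN2 hu0
      (fun s hs => (hDmem s hs).2) (fun s hs => hasDerivAt_chart_expQuot η X (hDmem s hs).1)
    exact ⟨(hDmem 1 (right_mem_Icc.2 zero_le_one)).1,
      norm_sub_phi₁_le_of_perturbed (R := rightFrame G) (X := X)
      (n := fun y => rightFrame G y η - leftFrame G y η)
      (u := fun t => extChartAt 𝓘(ℝ, F) (1 : G) (expQuot G η X t)) hε.le hR hN hu0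
      (fun s hs => (hDmem s hs).2) hap
      (fun s hs => hasDerivAt_chart_expQuot η X (hDmem s hs).1)⟩
  refine ⟨(hmain 1 one_pos le_rfl).mono fun X hX => hX.1, ?_⟩
  have h0 : extChartAt 𝓘(ℝ, F) (1 : G) (expQuot G η 0 1) = unitPt F G := by
    have h := lieExp_neg (G := G) η
    rw [expQuot, one_smul, one_smul, add_zero, h, mul_inv_cancel]
    rfl
  refine HasFDerivAt.of_isLittleO (Asymptotics.isLittleO_iff.2 fun c hc => ?_)
  set g := gronwallBound 0 ‖adL G η‖ 1 1
  have hg0 : 0 ≤ g := by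
    have := gronwallBound_mono (δ := 0) (ε := 1) le_rfl zero_le_one (norm_nonneg (adL G η))
      (zero_le_one (α := ℝ))
    rwa [gronwallBound_x0] at this
  have hK : 0 < (1 + κ) * g + 1 := by positivity
  -- This `ε` makes the total error at most `c ‖X‖`; the summand `1` keeps the denominator positive.
  filter_upwards [hmain (min 1 (c / ((1 + κ) * g + 1))) (lt_min one_pos (div_pos hc hK))
    (min_le_left _ _)] with X hX
  simp only [h0, sub_zero]
  refine hX.2.trans (mul_le_mul_of_nonneg_right ?_ (norm_nonneg X))
  rw [mul_assoc]
  calc min 1 (c / ((1 + κ) * g + 1)) * ((1 + κ) * g)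
      ≤ (c / ((1 + κ) * g + 1)) * ((1 + κ) * g + 1) := by
        refine mul_le_mul (min_le_right _ _) (by linarith) (by positivity)
          (div_pos hc hK).le
    _ = c := div_mul_cancel₀ _ hK.ne'

/-- The differential of the exponential map. -/
theorem hasMFDerivAt_lieExp (η : F) : HasMFDerivAt 𝓘(ℝ, F) 𝓘(ℝ, F) (lieExp G) η
    ((dRight (lieExp G η) 1).comp (phi₁ 1 (adL G η)) : F →L[ℝ] F) := by
  obtain ⟨h1, h2⟩ := hasFDerivAt_chart_expQuot (G := G) η
  have h0 : expQuot G η 0 1 = 1 := by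
    have h := lieExp_neg (G := G) η
    rw [expQuot, one_smul, one_smul, add_zero, h, mul_inv_cancel]
  have hs : HasMFDerivAt 𝓘(ℝ, F) 𝓘(ℝ, F) (extChartAt 𝓘(ℝ, F) (1 : G)).symm
      (extChartAt 𝓘(ℝ, F) (1 : G) (expQuot G η 0 1)) (ContinuousLinearMap.id ℝ F) := by
    have h := hasMFDerivAt_mD (mdiff_of_contMDiffAt
      (contMDiffAt_extChartAt_symm_of_mem (mem_extChartAt_target (I := 𝓘(ℝ, F)) (1 : G))))
    have h' := chartDSymm_self (E := F) (1 : G)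
    unfold chartDSymm at h'
    rw [h'] at h
    rw [h0]
    exact h
  have h3 : HasMFDerivAt 𝓘(ℝ, F) 𝓘(ℝ, F) (fun X => expQuot G η X 1) 0
      (phi₁ 1 (adL G η) : F →L[ℝ] F) := by
    have h := (HasMFDerivAt.comp (0 : F) hs h2.hasMFDerivAt).congr_of_eventuallyEq
      (f₁ := fun X => expQuot G η X 1) (by
        filter_upwards [h1] with X hX
        exact ((extChartAt 𝓘(ℝ, F) (1 : G)).left_inv hX).symm)
    exact h
  have hsub : HasMFDerivAt 𝓘(ℝ, F) 𝓘(ℝ, F) (fun ζ : F => ζ - η) η (ContinuousLinearMap.id ℝ F) :=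
    ((hasFDerivAt_id η).sub_const η).hasMFDerivAt
  have h4 := HasMFDerivAt.comp η (f := fun ζ : F => ζ - η) (by rw [sub_self]; exact h3) hsub
  have h5 : HasMFDerivAt 𝓘(ℝ, F) 𝓘(ℝ, F) (fun g : G => g * lieExp G η)
      (((fun X => expQuot G η X 1) ∘ fun ζ => ζ - η) η) (dRight (lieExp G η) 1 : F →L[ℝ] F) := by
    have he : ((fun X => expQuot G η X 1) ∘ fun ζ => ζ - η) η = 1 := by
      rw [Function.comp_apply, sub_self, h0]
    rw [he]
    exact hasMFDerivAt_mD (mdiff_mulRight (lieExp G η) 1)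
  have h6 := HasMFDerivAt.comp η h5 h4
  -- This is the factorization `exp ζ = (exp ζ exp(-η)) exp η`, with `X = ζ - η`.
  have h7 : (fun g : G => g * lieExp G η) ∘ ((fun X => expQuot G η X 1) ∘ fun ζ => ζ - η) =
      lieExp G := by
    funext ζ
    simp [expQuot, lieExp_neg]
  rw [h7] at h6
  exact h6

end ExpDeriv


/-! ### Operators conjugated by a linear map -/

section Intertwine

variable {F : Type*} [NormedAddCommGroup F] [NormedSpace ℝ F] [CompleteSpace F]
  {A A' C : F →L[ℝ] F}

/-- For `C = Ad_g`, `A = ad η` and `A' = ad (Ad_g η)` this family of identities yields the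
equivariance of `ϖ`. -/
theorem phi₀_intertwine (h : C.comp A = A'.comp C) (s : ℝ) :
    C.comp (phi₀ s A) = (phi₀ s A').comp C := by
  refine sub_eq_zero.1 (eq_zero_of_hasDerivAt_clm
    ((ContinuousLinearMap.compL ℝ F F F).flip A)
    (u := fun s => C.comp (phi₀ s A) - (phi₀ s A').comp C) (fun s => ?_) ?_ s)
  · refine (((hasDerivAt_const s C).clm_comp (hasDerivAt_phi₀ A s)).sub
      ((hasDerivAt_phi₀ A' s).clm_comp (hasDerivAt_const s C))).congr_deriv ?_
    ext x
    have := congrArg (fun T : F →L[ℝ] F => T x) h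
    simp only [ContinuousLinearMap.comp_apply] at this
    simp [this]
  · ext; simp

theorem phi₁_intertwine (h : C.comp A = A'.comp C) (s : ℝ) :
    C.comp (phi₁ s A) = (phi₁ s A').comp C := by
  refine eq_of_hasDerivAt_eq (u := fun s => C.comp (phi₁ s A))
    (v := fun s => (phi₁ s A').comp C) (w := fun s => C.comp (phi₀ s A))
    (fun s => ?_) (fun s => ?_) (by simp) s
  · exact ((hasDerivAt_const s C).clm_comp (hasDerivAt_phi₁ A s)).congr_deriv (by simp)
  · refine ((hasDerivAt_phi₁ A' s).clm_comp (hasDerivAt_const s C)).congr_deriv ?_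
    rw [phi₀_intertwine h]
    simp

theorem phi₂_intertwine (h : C.comp A = A'.comp C) (s : ℝ) :
    C.comp (phi₂ s A) = (phi₂ s A').comp C := by
  refine eq_of_hasDerivAt_eq (u := fun s => C.comp (phi₂ s A))
    (v := fun s => (phi₂ s A').comp C) (w := fun s => C.comp (phi₁ s A))
    (fun s => ?_) (fun s => ?_) (by simp) s
  · exact ((hasDerivAt_const s C).clm_comp (hasDerivAt_phi₂ A s)).congr_deriv (by simp)
  · refine ((hasDerivAt_phi₂ A' s).clm_comp (hasDerivAt_const s C)).congr_deriv ?_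
    rw [phi₁_intertwine h]
    simp

end Intertwine

section ContDiffPhi

variable {F V : Type*} [NormedAddCommGroup F] [NormedSpace ℝ F] [CompleteSpace F]
  [NormedAddCommGroup V] [NormedSpace ℝ V] {n : WithTop ℕ∞} {A : V → F →L[ℝ] F} {y : V}

theorem contDiffAt_phi₁_comp (s : ℝ) (hA : ContDiffAt ℝ n A y) :
    ContDiffAt ℝ n (fun y => phi₁ s (A y)) y :=
  ContDiffAt.comp (g := fun p : ℝ × (F →L[ℝ] F) => phi₁ p.1 p.2) (f := fun y => (s, A y)) y
    contDiff_phi₁.contDiffAt (contDiffAt_const.prodMk hA)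

theorem contDiffAt_phi₂_comp (s : ℝ) (hA : ContDiffAt ℝ n A y) :
    ContDiffAt ℝ n (fun y => phi₂ s (A y)) y :=
  ContDiffAt.comp (g := fun p : ℝ × (F →L[ℝ] F) => phi₂ p.1 p.2) (f := fun y => (s, A y)) y
    contDiff_phi₂.contDiffAt (contDiffAt_const.prodMk hA)

end ContDiffPhi

/-! ### The adjoint representations of the group and of its Lie algebra -/

section AdjointRep

variable {F G : Type*} [NormedAddCommGroup F] [NormedSpace ℝ F] [FiniteDimensional ℝ F]
  [TopologicalSpace G] [ChartedSpace F G] [Group G] [LieGroup 𝓘(ℝ, F) ∞ G]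

omit [FiniteDimensional ℝ F] in
theorem Ad_mul (g h : G) : Ad (F := F) (g * h) = (Ad g).comp (Ad h) := by
  have hc : ∀ g k : G, MDifferentiableAt 𝓘(ℝ, F) 𝓘(ℝ, F) (fun x : G => g * x * g⁻¹) k :=
    fun g k => (mdiff_mulRight g⁻¹ (g * k)).comp k (mdiff_mulLeft g k)
  change mD (fun x : G => g * h * x * (g * h)⁻¹) 1 = _
  have := mD_comp_of_eq (hc g 1) (hc h 1) (by simp)
  change _ = (mD (fun x : G => g * x * g⁻¹) 1).comp (mD (fun x : G => h * x * h⁻¹) 1)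
  rw [← this]
  congr 1
  funext x
  group

omit [FiniteDimensional ℝ F] in
theorem Ad_comp_Ad_inv (g : G) : (Ad (F := F) g).comp (Ad g⁻¹) = ContinuousLinearMap.id ℝ F := by
  rw [← Ad_mul, mul_inv_cancel, Ad_one]

omit [FiniteDimensional ℝ F] in
theorem Ad_inv_comp_Ad (g : G) : (Ad (F := F) g⁻¹).comp (Ad g) = ContinuousLinearMap.id ℝ F := by
  rw [← Ad_mul, inv_mul_cancel, Ad_one]

/-- The derivative of the adjoint representation. -/
theorem hasMFDerivAt_Ad (η : F) : HasMFDerivAt 𝓘(ℝ, F) 𝓘(ℝ, F) (fun g : G => Ad g η) 1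
    ((adL G).flip η : F →L[ℝ] F) := by
  have : CompleteSpace F := FiniteDimensional.complete ℝ F
  set ψ := extChartAt 𝓘(ℝ, F) (1 : G) with hψ
  have hRd := ((contDiffAt_rightFrame (F := F) (G := G)).differentiableAt (by simp))
  have hinv : DifferentiableAt ℝ (fun y => Ring.inverse (rightFrame G y)) (unitPt F G) := by
    have h := (hasFDerivAt_ringInverse (𝕜 := ℝ) (R := F →L[ℝ] F) 1).differentiableAt
    refine DifferentiableAt.comp (g := Ring.inverse) (unitPt F G) ?_ hRd
    rw [rightFrame_unitPt]
    exact h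
  -- From `L = R ∘ Ad` near the unit, `Ad_g η = η - R⁻¹(R η - L η)` in coordinates. The difference
  -- `R η - L η` vanishes at the unit, so the derivative of `R⁻¹` does not contribute, and the
  -- result is `-[η, ·] = [·, η]`.
  have h1 : HasFDerivAt (fun y => η - Ring.inverse (rightFrame G y)
      (rightFrame G y η - leftFrame G y η)) ((adL G).flip η) (unitPt F G) := by
    have h := (hasFDerivAt_const η _).sub
      (hinv.hasFDerivAt.clm_apply (hasFDerivAt_frame_sub_adL (G := G) η))
    refine h.congr_fderiv ?_
    have hi : Ring.inverse (ContinuousLinearMap.id ℝ F) = 1 := Ring.inverse_one _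
    ext u
    simp only [rightFrame_unitPt, leftFrame_unitPt, hi]
    simp
    rw [bracket_eq, bracket_eq]
    abel
  have h2 : HasMFDerivAt 𝓘(ℝ, F) 𝓘(ℝ, F) ψ 1 (ContinuousLinearMap.id ℝ F) := by
    have h := hasMFDerivAt_mD (mdiff_of_contMDiffAt (contMDiffAt_extChartAt_of_mem
      (mem_extChartAt_source (I := 𝓘(ℝ, F)) (1 : G))))
    have h' := chartD_self (E := F) (1 : G)
    unfold chartD at h'
    rwa [h'] at h
  have h3 := HasMFDerivAt.comp (1 : G) h1.hasMFDerivAt h2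
  refine HasMFDerivAt.congr_of_eventuallyEq h3 ?_
  have hu : ∀ᶠ g in 𝓝 (1 : G), IsUnit (rightFrame G (ψ g)) := by
    have hc : ContinuousAt (fun g => rightFrame G (ψ g)) 1 :=
      ContinuousAt.comp (g := rightFrame G) (contDiffAt_rightFrame (F := F) (G := G)).continuousAt
        (continuousAt_extChartAt (1 : G))
    refine hc.eventually (Units.isOpen.mem_nhds ?_)
    change IsUnit (rightFrame G (unitPt F G))
    rw [rightFrame_unitPt]
    exact isUnit_one
  filter_upwards [hu, (isOpen_extChartAt_source (I := 𝓘(ℝ, F)) (1 : G)).mem_nhds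
    (mem_extChartAt_source (1 : G))] with g hg hs
  have ht := ψ.map_source hs
  have hL : leftFrame G (ψ g) = (rightFrame G (ψ g)).comp (Ad g) := by
    rw [leftFrame_eq ht, rightFrame_eq ht, ContinuousLinearMap.comp_assoc]
    have : ψ.symm (ψ g) = g := ψ.left_inv hs
    rw [this, dRight_comp_Ad]
  change Ad g η = η - Ring.inverse (rightFrame G (ψ g))
    (rightFrame G (ψ g) η - leftFrame G (ψ g) η)
  have hcan := Ring.inverse_mul_cancel _ hg
  have hcan' : ∀ x, Ring.inverse (rightFrame G (ψ g)) (rightFrame G (ψ g) x) = x := fun x =>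
    congrArg (fun T : F →L[ℝ] F => T x) hcan
  rw [hL, map_sub, ContinuousLinearMap.comp_apply, hcan', hcan', sub_sub_cancel]

variable [T2Space G]

/-- Applied to a vector, both sides solve `u' = [η, u]` with the same initial value.
Multiplicativity of `Ad` reduces the derivative at time `s` to the derivative at the unit. -/
theorem Ad_lieExp (s : ℝ) (η : F) : Ad (lieExp G (s • η)) = phi₀ s (adL G η) := by
  have : CompleteSpace F := FiniteDimensional.complete ℝ F
  ext x
  refine sub_eq_zero.1 (eq_zero_of_hasDerivAt_clm (adL G η)
    (u := fun s => Ad (lieExp G (s • η)) x - phi₀ s (adL G η) x) (fun s => ?_)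
    (by simp [lieExp_zero, Ad_one]) s)
  have h1 : HasDerivAt (fun s => phi₀ s (adL G η) x) (adL G η (phi₀ s (adL G η) x)) s := by
    refine ((hasDerivAt_phi₀ (adL G η) s).clm_apply (hasDerivAt_const s x)).congr_deriv ?_
    rw [phi₀_comm]; simp
  have h2 : HasDerivAt (fun s => Ad (lieExp G (s • η)) x)
      (adL G η (Ad (lieExp G (s • η)) x)) s := by
    have h3 := HasMFDerivAt.comp (0 : ℝ) (f := fun t : ℝ => lieExp G (t • η))
      (by rw [zero_smul, lieExp_zero]; exact hasMFDerivAt_Ad (Ad (lieExp G (s • η)) x))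
      (hasMFDerivAt_lieExp_smul (G := G) η)
    have h4 : HasFDerivAt (fun t : ℝ => Ad (lieExp G (t • η)) (Ad (lieExp G (s • η)) x))
      (((adL G).flip (Ad (lieExp G (s • η)) x)).comp ((1 : ℝ →L[ℝ] ℝ).smulRight η)) 0 :=
      h3.hasFDerivAt
    have h5 := HasDerivAt.comp_sub_const s s (by rw [sub_self]; exact h4.hasDerivAt)
    refine (h5.congr_deriv ?_).congr_of_eventuallyEq (Eventually.of_forall fun t => ?_)
    · simp
    · change Ad (lieExp G (t • η)) x = Ad (lieExp G ((t - s) • η)) (Ad (lieExp G (s • η)) x)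
      rw [← ContinuousLinearMap.comp_apply, ← Ad_mul, ← lieExp_add_smul, sub_add_cancel]
  exact (h2.sub h1).congr_deriv (map_sub _ _ _).symm

theorem Ad_lieExp_one (η : F) : Ad (lieExp G η) = phi₀ 1 (adL G η) := by
  rw [← Ad_lieExp, one_smul]

/-- This is the derivative at `s = 0` of `Ad_g exp(s ad η) = exp(s ad (Ad_g η)) Ad_g`, which is `Ad`
applied to `exp(Ad_g sη) = g exp(sη) g⁻¹`. -/
theorem Ad_comp_adL (g : G) (η : F) :
    (Ad g).comp (adL G η) = (adL G (Ad g η)).comp (Ad g) := by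
  have : CompleteSpace F := FiniteDimensional.complete ℝ F
  have h : ∀ s : ℝ, (Ad g).comp (phi₀ s (adL G η)) = (phi₀ s (adL G (Ad g η))).comp (Ad g) := by
    intro s
    rw [← Ad_lieExp, ← Ad_lieExp, ← map_smul, lieExp_Ad, Ad_mul, Ad_mul,
      ContinuousLinearMap.comp_assoc, ContinuousLinearMap.comp_assoc, Ad_inv_comp_Ad,
      ContinuousLinearMap.comp_id]
  have h1 := (hasDerivAt_const (0 : ℝ) (Ad g : F →L[ℝ] F)).clm_comp (hasDerivAt_phi₀ (adL G η) 0)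
  have h2 := (hasDerivAt_phi₀ (adL G (Ad g η)) 0).clm_comp
    (hasDerivAt_const (0 : ℝ) (Ad g : F →L[ℝ] F))
  rw [funext h] at h1
  have h3 := h1.unique h2
  simpa [ContinuousLinearMap.one_def] using h3

/-- Skewness of `ad x` is the derivative at `0` of the invariance of `b` under `Ad (exp(sx))`. -/
theorem isMetricLie_adL {b : F →L[ℝ] F →L[ℝ] ℝ} (hb : IsInvariantInner G b) :
    IsMetricLie (adL G) b := by
  have : CompleteSpace F := FiniteDimensional.complete ℝ F
  have := lieGroup_three (F := F) (G := G)
  refine ⟨fun x y => ?_, fun x y z => ?_, hb.symm, fun x y z => ?_⟩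
  · rw [adL_apply, adL_apply, bracket_eq, bracket_eq]; abel
  · exact leibniz_lie (show GroupLieAlgebra 𝓘(ℝ, F) G from x)
      (show GroupLieAlgebra 𝓘(ℝ, F) G from y) (show GroupLieAlgebra 𝓘(ℝ, F) G from z)
  · have h := hasDerivAt_bilin b (hasDerivAt_phi₀ (adL G x) 0) (hasDerivAt_phi₀ (adL G x) 0) y z
    have h0 : (fun s => b (phi₀ s (adL G x) y) (phi₀ s (adL G x) z)) = fun _ => b y z := by
      funext s
      rw [← Ad_lieExp, hb.invariant]
    rw [h0] at h
    have h1 := h.unique (hasDerivAt_const (0 : ℝ) (b y z))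
    simp only [phi₀_zero, ContinuousLinearMap.comp_apply, one_apply_eq_self] at h1
    linarith

end AdjointRep

/-! ### The exponential map -/

section Exp

variable {F G : Type*} [NormedAddCommGroup F] [NormedSpace ℝ F] [FiniteDimensional ℝ F]
  [TopologicalSpace G] [ChartedSpace F G] [Group G] [LieGroup 𝓘(ℝ, F) ∞ G] [T2Space G]

omit [FiniteDimensional ℝ F] in
/-- Solutions of a first order system `u' = R(u) Φ` with smooth coefficients are smooth. -/
theorem contDiffAt_of_hasFDerivAt_comp {u : F → F} {R Φ : F → F →L[ℝ] F} {η : F}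
    (hd : ∀ᶠ ζ in 𝓝 η, HasFDerivAt u ((R (u ζ)).comp (Φ ζ)) ζ) (hR : ContDiffAt ℝ ∞ R (u η))
    (hΦ : ContDiffAt ℝ ∞ Φ η) : ContDiffAt ℝ ∞ u η := by
  refine contDiffAt_infty.2 fun n => ?_
  induction n with
  | zero =>
    exact contDiffAt_zero.2 ⟨_, hd, fun ζ hζ =>
      (HasFDerivAt.continuousAt hζ).continuousWithinAt⟩
  | succ n ih =>
    have : ((n + 1 : ℕ) : WithTop ℕ∞) = (n : WithTop ℕ∞) + 1 := by push_cast; rfl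
    rw [this, contDiffAt_succ_iff_hasFDerivAt]
    have hn : ((n : ℕ) : WithTop ℕ∞) ≤ ∞ := by exact_mod_cast le_top
    exact ⟨_, ⟨_, hd, fun ζ hζ => hζ⟩,
      (ContDiffAt.comp η (hR.of_le hn) ih).clm_comp (hΦ.of_le hn)⟩

theorem continuous_lieExp : Continuous (lieExp G : F → G) := by
  have : CompleteSpace F := FiniteDimensional.complete ℝ F
  exact continuous_iff_continuousAt.2 fun η => (hasMFDerivAt_lieExp (G := G) η).continuousAt

/-- A right translation brings `exp ζ` into the chart at the unit, where the formula for `d exp`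
becomes a first order system `u' = R(u) φ₁(ad ζ)` with smooth coefficients. Smoothness of `exp` is
bootstrapped from it. -/
theorem hasFDerivAt_chart_lieExp_mul {g : G} {ζ : F}
    (hζ : lieExp G ζ * g ∈ (extChartAt 𝓘(ℝ, F) (1 : G)).source) :
    HasFDerivAt (fun ζ => extChartAt 𝓘(ℝ, F) (1 : G) (lieExp G ζ * g))
      ((rightFrame G (extChartAt 𝓘(ℝ, F) (1 : G) (lieExp G ζ * g))).comp (phi₁ 1 (adL G ζ))) ζ := by
  have : CompleteSpace F := FiniteDimensional.complete ℝ F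
  have h1 := HasMFDerivAt.comp ζ (hasMFDerivAt_mD (mdiff_mulRight (F := F) g (lieExp G ζ)))
    (hasMFDerivAt_lieExp (G := G) ζ)
  have h2 := HasMFDerivAt.comp ζ (g := extChartAt 𝓘(ℝ, F) (1 : G))
    (hasMFDerivAt_mD (mdiff_of_contMDiffAt (contMDiffAt_extChartAt_of_mem hζ))) h1
  have h3 : HasFDerivAt (fun ζ => extChartAt 𝓘(ℝ, F) (1 : G) (lieExp G ζ * g))
    ((chartD 1 (lieExp G ζ * g)).comp ((dRight g (lieExp G ζ)).comp
    ((dRight (lieExp G ζ) 1).comp (phi₁ 1 (adL G ζ))))) ζ := h2.hasFDerivAt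
  refine h3.congr_fderiv ?_
  have h5 := dRight_comp (F := F) g (lieExp G ζ) 1
  rw [one_mul] at h5
  rw [rightFrame_eq ((extChartAt 𝓘(ℝ, F) (1 : G)).map_source hζ),
    ← ContinuousLinearMap.comp_assoc (dRight g _), h5, ContinuousLinearMap.comp_assoc,
    (extChartAt 𝓘(ℝ, F) (1 : G)).left_inv hζ]

theorem eventually_lieExp_mul_inv_mem (η : F) : ∀ᶠ ζ in 𝓝 η,
    lieExp G ζ * (lieExp G η)⁻¹ ∈ (extChartAt 𝓘(ℝ, F) (1 : G)).source := by
  have hq : Continuous fun ζ : F => lieExp G ζ * (lieExp G η)⁻¹ :=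
    (contMDiff_mul_right (I := 𝓘(ℝ, F)) (n := ∞) (a := (lieExp G η)⁻¹)).continuous.comp
      continuous_lieExp
  refine hq.continuousAt.eventually ((isOpen_extChartAt_source (1 : G)).mem_nhds ?_)
  simp only [mul_inv_cancel]
  exact mem_extChartAt_source (1 : G)

theorem contDiffAt_chart_lieExp_mul_inv (η : F) : ContDiffAt ℝ ∞
    (fun ζ => extChartAt 𝓘(ℝ, F) (1 : G) (lieExp G ζ * (lieExp G η)⁻¹)) η := by
  have : CompleteSpace F := FiniteDimensional.complete ℝ F
  have hd : ∀ᶠ ζ in 𝓝 η, HasFDerivAt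
      (fun ζ => extChartAt 𝓘(ℝ, F) (1 : G) (lieExp G ζ * (lieExp G η)⁻¹))
      ((rightFrame G (extChartAt 𝓘(ℝ, F) (1 : G) (lieExp G ζ * (lieExp G η)⁻¹))).comp
        (phi₁ 1 (adL G ζ))) ζ := by
    filter_upwards [eventually_lieExp_mul_inv_mem (G := G) η] with ζ hζ
    exact hasFDerivAt_chart_lieExp_mul hζ
  have hR : ContDiffAt ℝ ∞ (rightFrame G)
      (extChartAt 𝓘(ℝ, F) (1 : G) (lieExp G η * (lieExp G η)⁻¹)) := by
    rw [mul_inv_cancel]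
    exact contDiffAt_rightFrame
  have hΦ : ContDiffAt ℝ ∞ (fun ζ => phi₁ 1 (adL G ζ)) η :=
    contDiffAt_phi₁_comp 1 (adL G : F →L[ℝ] F →L[ℝ] F).contDiff.contDiffAt
  exact contDiffAt_of_hasFDerivAt_comp hd hR hΦ

theorem contMDiff_lieExp : ContMDiff 𝓘(ℝ, F) 𝓘(ℝ, F) ∞ (lieExp G : F → G) := by
  intro η
  have ht : extChartAt 𝓘(ℝ, F) (1 : G) (lieExp G η * (lieExp G η)⁻¹) ∈
      (extChartAt 𝓘(ℝ, F) (1 : G)).target := by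
    rw [mul_inv_cancel]; exact unitPt_mem_target
  have h0 : ContMDiffAt 𝓘(ℝ, F) 𝓘(ℝ, F) ∞ (fun ζ => (extChartAt 𝓘(ℝ, F) (1 : G)).symm
      (extChartAt 𝓘(ℝ, F) (1 : G) (lieExp G ζ * (lieExp G η)⁻¹))) η :=
    ContMDiffAt.comp η (contMDiffAt_extChartAt_symm_of_mem ht)
      (contDiffAt_chart_lieExp_mul_inv η).contMDiffAt
  have h1 := ContMDiffAt.comp η
    ((contMDiff_mul_right (I := 𝓘(ℝ, F)) (n := ∞) (a := lieExp G η)).contMDiffAt) h0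
  refine h1.congr_of_eventuallyEq ?_
  filter_upwards [eventually_lieExp_mul_inv_mem (G := G) η] with ζ hζ
  rw [Function.comp_apply, (extChartAt 𝓘(ℝ, F) (1 : G)).left_inv hζ, inv_mul_cancel_right]

theorem mdiff_lieExp (η : F) : MDifferentiableAt 𝓘(ℝ, F) 𝓘(ℝ, F) (lieExp G) η :=
  mdiff_of_contMDiffAt contMDiff_lieExp.contMDiffAt

theorem mD_lieExp (η : F) :
    mD (lieExp G) η = (dRight (lieExp G η) 1).comp (phi₁ 1 (adL G η)) := by
  have : CompleteSpace F := FiniteDimensional.complete ℝ F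
  exact mD_eq (hasMFDerivAt_lieExp η)

theorem thetaR_comp_mD_lieExp (η : F) :
    (dRight (lieExp G η)⁻¹ (lieExp G η)).comp (mD (lieExp G) η) = phi₁ 1 (adL G η) := by
  rw [mD_lieExp, ← ContinuousLinearMap.comp_assoc, dRight_inv_comp_dRight,
    ContinuousLinearMap.id_comp]

/-- Changing from the right to the left trivialization composes with `Ad (exp(-η)) = exp(-A)`, where
`A = ad η`, and `exp(-A) φ₁(A) = φ₁(-A)`. -/
theorem thetaL_comp_mD_lieExp (η : F) :
    (dLeft (lieExp G η)⁻¹ (lieExp G η)).comp (mD (lieExp G) η) = phi₁ 1 (-adL G η) := by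
  have : CompleteSpace F := FiniteDimensional.complete ℝ F
  set g := lieExp G η with hg
  have h1 : dRight (F := F) g 1 = (dLeft g 1).comp (Ad g⁻¹) := by
    rw [← dRight_comp_Ad, ContinuousLinearMap.comp_assoc, Ad_comp_Ad_inv,
      ContinuousLinearMap.comp_id]
  have h2 : Ad g⁻¹ = phi₀ 1 (-adL G η) := by
    rw [hg, ← lieExp_neg, Ad_lieExp_one, map_neg]
  rw [mD_lieExp, h1, h2, ContinuousLinearMap.comp_assoc, phi₀_neg_comp_phi₁,
    ← ContinuousLinearMap.comp_assoc, dLeft_inv_comp_dLeft, ContinuousLinearMap.id_comp]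

theorem dexpL_eq (η : F) : dexpL G η = phi₁ 1 (-adL G η) := thetaL_comp_mD_lieExp η

theorem expPullback_eq (s : ℝ) (η X : F) : expPullback G s η X = phi₁ s (adL G η) X := by
  have : CompleteSpace F := FiniteDimensional.complete ℝ F
  have h1 : HasMFDerivAt 𝓘(ℝ, F) 𝓘(ℝ, F) (fun ζ : F => s • ζ) η
      (s • ContinuousLinearMap.id ℝ F) := ((hasFDerivAt_id η).const_smul s).hasMFDerivAt
  have h2 : mD (fun ζ : F => lieExp G (s • ζ)) η = (mD (lieExp G) (s • η)).comp
      (s • ContinuousLinearMap.id ℝ F) :=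
    mD_eq (HasMFDerivAt.comp η (hasMFDerivAt_mD (mdiff_lieExp (s • η))) h1)
  change dRight (lieExp G (s • η))⁻¹ (lieExp G (s • η)) (mD (fun ζ : F => lieExp G (s • ζ)) η X) = _
  have h3 := congrArg (fun T : F →L[ℝ] F => T (s • X)) (thetaR_comp_mD_lieExp (G := G) (s • η))
  have h4 := congrArg (fun T : F →L[ℝ] F => T X) (smul_phi₁_smul 1 s (adL G η))
  rw [one_mul] at h4
  rw [h2, ← h4]
  simpa using h3

/-- The fundamental theorem of calculus in `s`: `varpiAux` is an antiderivative of the integrand,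
with its factor `½`, and vanishes at `s = 0`. -/
theorem varpi_eq {b : F →L[ℝ] F →L[ℝ] ℝ} (hb : IsInvariantInner G b) (η X Y : F) :
    varpi G b η X Y = varpiAux b 1 (adL G η) X Y := by
  have : CompleteSpace F := FiniteDimensional.complete ℝ F
  have hA : ∀ x y, b (adL G η x) y = - b x (adL G η y) := (isMetricLie_adL hb).skew η
  have hphi : ∀ X s, HasDerivAt (fun s => phi₁ s (adL G η) X) (phi₀ s (adL G η) X) s :=
    fun X s => by simpa using (hasDerivAt_phi₁ (adL G η) s).clm_apply (hasDerivAt_const s X)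
  simp only [varpi, expPullback_eq, (hphi _ _).deriv]
  have hint : Continuous fun s => (1 / 2 : ℝ) * (b (phi₁ s (adL G η) X) (phi₀ s (adL G η) Y) -
      b (phi₁ s (adL G η) Y) (phi₀ s (adL G η) X)) := by
    have c0 : ∀ X, Continuous fun s => phi₀ s (adL G η) X := fun X =>
      ((contDiff_phi₀ (n := 0)).continuous.comp (Continuous.prodMk_left (adL G η))).clm_apply
        continuous_const
    have c1 : ∀ X, Continuous fun s => phi₁ s (adL G η) X := fun X =>
      ((contDiff_phi₁ (n := 0)).continuous.comp (Continuous.prodMk_left (adL G η))).clm_apply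
        continuous_const
    exact continuous_const.mul (((b.continuous.comp (c1 X)).clm_apply (c0 Y)).sub
      ((b.continuous.comp (c1 Y)).clm_apply (c0 X)))
  rw [← intervalIntegral.integral_const_mul, intervalIntegral.integral_eq_sub_of_hasDerivAt
    (fun s _ => hasDerivAt_varpiAux hb.symm hA s X Y) (hint.intervalIntegrable _ _)]
  simp [varpiAux]

end Exp


/-! ### Alternating forms -/

section Alternating

variable {E E' V W : Type*} [NormedAddCommGroup E] [NormedSpace ℝ E]
  [NormedAddCommGroup E'] [NormedSpace ℝ E'] [NormedAddCommGroup V] [NormedSpace ℝ V]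
  [NormedAddCommGroup W] [NormedSpace ℝ W] {ι : Type*} [Fintype ι] [DecidableEq ι]

variable (E W ι) in
/-- The projection of multilinear maps onto alternating maps. -/
def alternProj : ContinuousMultilinearMap ℝ (fun _ : ι => E) W →L[ℝ] (E [⋀^ι]→L[ℝ] W) :=
  LinearMap.mkContinuous
    { toFun := fun f => ((Fintype.card ι).factorial : ℝ)⁻¹ • f.alternatization
      map_add' := fun f g => by rw [map_add, smul_add]
      map_smul' := fun c f => by
        ext v
        simp only [ContinuousAlternatingMap.smul_apply,
          ContinuousMultilinearMap.alternatization_apply_apply, smul_apply,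
          RingHom.id_apply]
        rw [smul_comm c, Finset.smul_sum (r := c)]
        refine congrArg _ (Finset.sum_congr rfl fun σ _ => ?_)
        rcases Int.units_eq_one_or (Equiv.Perm.sign σ) with h | h <;> simp [h] }
    1 fun f => by
      refine ContinuousAlternatingMap.opNorm_le_bound _ (by positivity) fun v => ?_
      have h0 : (0 : ℝ) < (Fintype.card ι).factorial := by exact_mod_cast Nat.factorial_pos _
      have h1 : ∀ σ : Equiv.Perm ι, ‖Equiv.Perm.sign σ • f (v ∘ σ)‖ ≤ ‖f‖ * ∏ i, ‖v i‖ := by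
        intro σ
        have h2 : ‖Equiv.Perm.sign σ • f (v ∘ σ)‖ = ‖f (v ∘ σ)‖ := by
          rcases Int.units_eq_one_or (Equiv.Perm.sign σ) with h | h <;> simp [h]
        rw [h2, ← Equiv.prod_comp σ fun i => ‖v i‖]
        exact f.le_opNorm _
      change ‖((Fintype.card ι).factorial : ℝ)⁻¹ • f.alternatization v‖ ≤ _
      rw [ContinuousMultilinearMap.alternatization_apply_apply, norm_smul, norm_inv,
        RCLike.norm_natCast, one_mul, inv_mul_le_iff₀ h0]
      refine (norm_sum_le_of_le _ fun σ _ => h1 σ).trans_eq ?_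
      rw [Finset.sum_const, Finset.card_univ, Fintype.card_perm, nsmul_eq_mul]

theorem alternProj_coe (κ : E [⋀^ι]→L[ℝ] W) : alternProj E W ι κ.toContinuousMultilinearMap = κ := by
  have h0 : ((Fintype.card ι).factorial : ℝ) ≠ 0 := by exact_mod_cast Nat.factorial_ne_zero _
  ext v
  change ((Fintype.card ι).factorial : ℝ)⁻¹ •
    κ.toContinuousMultilinearMap.alternatization v = κ v
  rw [ContinuousMultilinearMap.alternatization_apply_apply]
  have h1 : ∀ σ : Equiv.Perm ι,
      Equiv.Perm.sign σ • κ.toContinuousMultilinearMap (v ∘ σ) = κ v := by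
    intro σ
    change Equiv.Perm.sign σ • κ.toAlternatingMap (v ∘ σ) = κ.toAlternatingMap v
    rw [AlternatingMap.map_perm, smul_smul, Int.units_mul_self, one_smul]
  rw [Finset.sum_congr rfl fun σ _ => h1 σ, Finset.sum_const, Finset.card_univ, Fintype.card_perm,
    ← Nat.cast_smul_eq_nsmul ℝ, smul_smul, inv_mul_cancel₀ h0, one_smul]

/-- On multilinear maps, precomposition depends polynomially on the linear map. The result is
brought back to alternating maps by a continuous projection that fixes them. -/
theorem contDiffAt_compContinuousLinearMap {n : WithTop ℕ∞} {g : V → E [⋀^ι]→L[ℝ] W}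
    {L : V → E' →L[ℝ] E} {x : V} (hg : ContDiffAt ℝ n g x) (hL : ContDiffAt ℝ n L x) :
    ContDiffAt ℝ n (fun y => (g y).compContinuousLinearMap (L y)) x := by
  have h1 := (ContinuousMultilinearMap.compContinuousLinearMapContinuousMultilinear ℝ
    (fun _ : ι => E') (fun _ : ι => E) W).contDiff (n := n)
  have h2 : ContDiffAt ℝ n (fun y => ContinuousMultilinearMap.compContinuousLinearMapContinuousMultilinear ℝ
    (fun _ : ι => E') (fun _ : ι => E) W (fun _ => L y)) x :=
    h1.contDiffAt.comp x (contDiffAt_pi.2 fun _ => hL)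
  have h3 := (alternProj E' W ι).contDiff.contDiffAt.comp x (h2.clm_apply
    ((ContinuousAlternatingMap.toContinuousMultilinearMapCLM ℝ
      (E := E) (F := W) (ι := ι)).contDiff.contDiffAt.comp x hg))
  refine h3.congr_of_eventuallyEq (Eventually.of_forall fun y => ?_)
  exact (alternProj_coe ((g y).compContinuousLinearMap (L y))).symm

variable (E W) in
/-- Forms of degree 1 as linear maps. -/
def linOfForm : (E [⋀^Fin 1]→L[ℝ] W) →L[ℝ] (E →L[ℝ] W) :=
  ((ContinuousAlternatingMap.ofSubsingletonLIE (𝕜 := ℝ) (E := E) (F := W) (0 : Fin 1)).symm :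
    (E [⋀^Fin 1]→L[ℝ] W) →L[ℝ] (E →L[ℝ] W))

variable (E W) in
/-- Linear maps as forms of degree 1. -/
def formOfLin : (E →L[ℝ] W) →L[ℝ] (E [⋀^Fin 1]→L[ℝ] W) :=
  (ContinuousAlternatingMap.ofSubsingletonLIE (𝕜 := ℝ) (E := E) (F := W) (0 : Fin 1) :
    (E →L[ℝ] W) →L[ℝ] (E [⋀^Fin 1]→L[ℝ] W))

theorem formOfLin_apply (L : E →L[ℝ] W) (v : Fin 1 → E) : formOfLin E W L v = L (v 0) := rfl

theorem linOfForm_apply (κ : E [⋀^Fin 1]→L[ℝ] W) (v : E) : linOfForm E W κ v = κ ![v] := by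
  have h : formOfLin E W (linOfForm E W κ) = κ :=
    (ContinuousAlternatingMap.ofSubsingletonLIE (𝕜 := ℝ) (E := E) (F := W) (0 : Fin 1)).apply_symm_apply κ
  rw [← h, formOfLin_apply, h]
  rfl

variable (E W) in
/-- Forms of degree 2 as bilinear maps. -/
def bilinOfForm : (E [⋀^Fin 2]→L[ℝ] W) →L[ℝ] (E →L[ℝ] E →L[ℝ] W) :=
  (ContinuousLinearMap.compL ℝ E _ _ (linOfForm E W)).comp
    (ContinuousAlternatingMap.curryLeftLI (𝕜 := ℝ) (E := E) (F := W)
      (n := 1)).toContinuousLinearMap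

theorem bilinOfForm_apply (κ : E [⋀^Fin 2]→L[ℝ] W) (u v : E) :
    bilinOfForm E W κ u v = κ ![u, v] := by
  change linOfForm E W (κ.curryLeft u) v = _
  rw [linOfForm_apply]
  rfl

variable (E W) in
/-- The alternating part of a bilinear form. -/
def formOfBilin : (E →L[ℝ] E →L[ℝ] W) →L[ℝ] (E [⋀^Fin 2]→L[ℝ] W) :=
  (2 : ℝ)⁻¹ • (ContinuousAlternatingMap.alternatizeUncurryFinCLM (n := 1) ℝ E W).comp
    (ContinuousLinearMap.compL ℝ E _ _ (formOfLin E W))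

theorem formOfBilin_apply (S : E →L[ℝ] E →L[ℝ] W) (u v : E) :
    formOfBilin E W S ![u, v] = (2 : ℝ)⁻¹ • (S u v - S v u) := by
  change (2 : ℝ)⁻¹ • ContinuousAlternatingMap.alternatizeUncurryFin
    ((formOfLin E W).comp S) ![u, v] = _
  rw [ContinuousAlternatingMap.alternatizeUncurryFin_apply, Fin.sum_univ_two]
  simp [formOfLin_apply, Fin.removeNth, sub_eq_add_neg]

theorem contDiff_formOfBilin {n : WithTop ℕ∞} : ContDiff ℝ n (formOfBilin E W) :=
  ContinuousLinearMap.contDiff (𝕜 := ℝ) (E := E →L[ℝ] E →L[ℝ] W) (F := E [⋀^Fin 2]→L[ℝ] W)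
    (formOfBilin E W)

theorem contDiff_bilinOfForm {n : WithTop ℕ∞} : ContDiff ℝ n (bilinOfForm E W) :=
  ContinuousLinearMap.contDiff (𝕜 := ℝ) (E := E [⋀^Fin 2]→L[ℝ] W) (F := E →L[ℝ] E →L[ℝ] W)
    (bilinOfForm E W)

theorem contDiff_formOfLin {n : WithTop ℕ∞} : ContDiff ℝ n (formOfLin E W) :=
  ContinuousLinearMap.contDiff (formOfLin E W)

theorem contDiff_linOfForm {n : WithTop ℕ∞} : ContDiff ℝ n (linOfForm E W) :=
  ContinuousLinearMap.contDiff (linOfForm E W)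

theorem form₂_ext {κ κ' : E [⋀^Fin 2]→L[ℝ] W} (h : ∀ u v, κ ![u, v] = κ' ![u, v]) : κ = κ' := by
  ext w
  have hw : w = ![w 0, w 1] := by ext i; fin_cases i <;> rfl
  rw [hw, h]

theorem form₁_ext {κ κ' : E [⋀^Fin 1]→L[ℝ] W} (h : ∀ u, κ ![u] = κ' ![u]) : κ = κ' := by
  ext w
  have hw : w = ![w 0] := by ext i; fin_cases i; rfl
  rw [hw, h]

theorem form₂_swap (κ : E [⋀^Fin 2]→L[ℝ] W) (u v : E) : κ ![u, v] = - κ ![v, u] := by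
  have h := κ.toAlternatingMap.map_swap ![v, u] (show (0 : Fin 2) ≠ 1 by decide)
  have h1 : (![v, u] ∘ Equiv.swap (0 : Fin 2) 1) = ![u, v] := by
    ext i; fin_cases i <;> rfl
  rw [h1] at h
  exact h

theorem compContinuousLinearMap_apply₁ (κ : E [⋀^Fin 1]→L[ℝ] W) (L : E' →L[ℝ] E) (u : E') :
    κ.compContinuousLinearMap L ![u] = κ ![L u] := by
  change κ (L ∘ ![u]) = _
  congr 1
  ext i; fin_cases i; rfl

theorem compContinuousLinearMap_apply₂ (κ : E [⋀^Fin 2]→L[ℝ] W) (L : E' →L[ℝ] E) (u v : E') :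
    κ.compContinuousLinearMap L ![u, v] = κ ![L u, L v] := by
  change κ (L ∘ ![u, v]) = _
  congr 1
  ext i; fin_cases i <;> rfl

theorem compContinuousLinearMap_apply₃ (κ : E [⋀^Fin 3]→L[ℝ] W) (L : E' →L[ℝ] E) (u v w : E') :
    κ.compContinuousLinearMap L ![u, v, w] = κ ![L u, L v, L w] := by
  change κ (L ∘ ![u, v, w]) = _
  congr 1
  ext i; fin_cases i <;> rfl

/-- The exterior derivative of a 2-form as a cyclic sum. -/
theorem extDeriv_apply₃ {κ : E → E [⋀^Fin 2]→L[ℝ] W} {x : E} (h : DifferentiableAt ℝ κ x)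
    (u v w : E) : extDeriv κ x ![u, v, w] = fderiv ℝ (fun y => κ y ![v, w]) x u +
      fderiv ℝ (fun y => κ y ![w, u]) x v + fderiv ℝ (fun y => κ y ![u, v]) x w := by
  rw [extDeriv_apply h, Fin.sum_univ_three]
  have e0 : (0 : Fin 3).removeNth ![u, v, w] = ![v, w] := by ext i; fin_cases i <;> rfl
  have e1 : (1 : Fin 3).removeNth ![u, v, w] = ![u, w] := by ext i; fin_cases i <;> rfl
  have e2 : (2 : Fin 3).removeNth ![u, v, w] = ![u, v] := by ext i; fin_cases i <;> rfl
  have hs : (fun y => κ y ![u, w]) = fun y => - κ y ![w, u] := funext fun y => form₂_swap _ _ _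
  rw [e0, e1, e2, hs, fderiv_fun_neg]
  simp

end Alternating

/-! ### Smooth forms on manifolds -/

section SmoothForms

variable {E M : Type*} [NormedAddCommGroup E] [NormedSpace ℝ E] [TopologicalSpace M]
  [ChartedSpace E M] [IsManifold 𝓘(ℝ, E) ∞ M] {k : ℕ}
  {W : Type*} [NormedAddCommGroup W] [NormedSpace ℝ W]

omit [IsManifold 𝓘(ℝ, E) ∞ M] in
theorem chartRep_eq (κ : DForm E M k W) (p : M) (y : E) : chartRep κ p y =
    ContinuousAlternatingMap.compContinuousLinearMap
      (show E [⋀^Fin k]→L[ℝ] W from κ ((extChartAt 𝓘(ℝ, E) p).symm y)) (chartDSymm p y) := rfl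

/-- The transition map between two charts. -/
def transition (E : Type*) {M : Type*} [NormedAddCommGroup E] [NormedSpace ℝ E]
    [TopologicalSpace M] [ChartedSpace E M] (p q : M) (y : E) : E :=
  extChartAt 𝓘(ℝ, E) q ((extChartAt 𝓘(ℝ, E) p).symm y)

theorem contDiffAt_transition {p q : M} {y : E} (hy : y ∈ (extChartAt 𝓘(ℝ, E) p).target)
    (hq : (extChartAt 𝓘(ℝ, E) p).symm y ∈ (extChartAt 𝓘(ℝ, E) q).source) :
    ContDiffAt ℝ ∞ (transition E p q) y :=
  ((contMDiffAt_extChartAt_of_mem hq).comp y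
    (contMDiffAt_extChartAt_symm_of_mem hy)).contDiffAt

theorem chartRep_eq_pullback (κ : DForm E M k W) {p q : M} {y : E}
    (hy : y ∈ (extChartAt 𝓘(ℝ, E) p).target)
    (hq : (extChartAt 𝓘(ℝ, E) p).symm y ∈ (extChartAt 𝓘(ℝ, E) q).source) :
    chartRep κ p y = (chartRep κ q (transition E p q y)).compContinuousLinearMap
      (fderiv ℝ (transition E p q) y) := by
  have ht : transition E p q y ∈ (extChartAt 𝓘(ℝ, E) q).target :=
    (extChartAt 𝓘(ℝ, E) q).map_source hq
  have h1 : chartDSymm p y =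
      (chartDSymm q (transition E p q y)).comp
        (mD (transition E p q) y : E →L[ℝ] E) := by
    rw [chartDSymm, chartDSymm, ← mD_comp (mdiff_of_contMDiffAt (contMDiffAt_extChartAt_symm_of_mem ht))
      (mdiff_of_contMDiffAt (contDiffAt_transition hy hq).contMDiffAt)]
    refine mD_congr ?_
    have hc := (contMDiffAt_extChartAt_symm_of_mem hy).continuousAt
    filter_upwards [hc.eventually ((isOpen_extChartAt_source q).mem_nhds hq)] with z hz
    exact ((extChartAt 𝓘(ℝ, E) q).left_inv hz).symm
  have h2 : (extChartAt 𝓘(ℝ, E) q).symm (transition E p q y) =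
      (extChartAt 𝓘(ℝ, E) p).symm y := (extChartAt 𝓘(ℝ, E) q).left_inv hq
  rw [chartRep_eq, chartRep_eq, h1, h2, mD_eq_fderiv]
  rfl

theorem contDiffAt_chartRep_of_contDiffAt {κ : DForm E M k W} {p q x : M}
    (hp : x ∈ (extChartAt 𝓘(ℝ, E) p).source) (hq : x ∈ (extChartAt 𝓘(ℝ, E) q).source)
    (h : ContDiffAt ℝ ∞ (chartRep κ q) (extChartAt 𝓘(ℝ, E) q x)) :
    ContDiffAt ℝ ∞ (chartRep κ p) (extChartAt 𝓘(ℝ, E) p x) := by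
  have hy := (extChartAt 𝓘(ℝ, E) p).map_source hp
  have hx : (extChartAt 𝓘(ℝ, E) p).symm (extChartAt 𝓘(ℝ, E) p x) = x :=
    (extChartAt 𝓘(ℝ, E) p).left_inv hp
  have hq' : (extChartAt 𝓘(ℝ, E) p).symm (extChartAt 𝓘(ℝ, E) p x) ∈
    (extChartAt 𝓘(ℝ, E) q).source := by rwa [hx]
  have ht := contDiffAt_transition hy hq'
  have h' : ContDiffAt ℝ ∞ (chartRep κ q) (transition E p q (extChartAt 𝓘(ℝ, E) p x)) := by
    rwa [transition, hx]
  refine (contDiffAt_compContinuousLinearMap (h'.comp _ ht)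
    (ht.fderiv_right (m := ∞) (by simp))).congr_of_eventuallyEq ?_
  have hc := (contMDiffAt_extChartAt_symm_of_mem hy).continuousAt
  filter_upwards [extChartAt_target_mem_nhds_of_mem hy,
    hc.eventually ((isOpen_extChartAt_source q).mem_nhds hq')] with z hz hz'
  exact chartRep_eq_pullback κ hz hz'

/-- Coordinate expressions in two charts differ by pullback under a smooth transition map.
Smoothness at all points near `p` can therefore be tested in the one chart around `p`. -/
theorem smoothFormAt_iff {κ : DForm E M k W} {p x : M}
    (hp : x ∈ (extChartAt 𝓘(ℝ, E) p).source) :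
    SmoothFormAt κ x ↔ ContDiffAt ℝ ∞ (chartRep κ p) (extChartAt 𝓘(ℝ, E) p x) :=
  ⟨contDiffAt_chartRep_of_contDiffAt hp (mem_extChartAt_source x),
    contDiffAt_chartRep_of_contDiffAt (mem_extChartAt_source x) hp⟩

theorem contDiffAt_comp_chart_symm {f : M → W} {p x : M}
    (hp : x ∈ (extChartAt 𝓘(ℝ, E) p).source) (hf : ContMDiffAt 𝓘(ℝ, E) 𝓘(ℝ, W) ∞ f x) :
    ContDiffAt ℝ ∞ (fun y => f ((extChartAt 𝓘(ℝ, E) p).symm y)) (extChartAt 𝓘(ℝ, E) p x) := by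
  have hx : (extChartAt 𝓘(ℝ, E) p).symm (extChartAt 𝓘(ℝ, E) p x) = x :=
    (extChartAt 𝓘(ℝ, E) p).left_inv hp
  refine (ContMDiffAt.comp (extChartAt 𝓘(ℝ, E) p x) (by rwa [hx])
    (contMDiffAt_extChartAt_symm_of_mem ((extChartAt 𝓘(ℝ, E) p).map_source hp))).contDiffAt

theorem contMDiffAt_comp_chart {f : E → W} {p x : M}
    (hp : x ∈ (extChartAt 𝓘(ℝ, E) p).source)
    (hf : ContDiffAt ℝ ∞ f (extChartAt 𝓘(ℝ, E) p x)) :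
    ContMDiffAt 𝓘(ℝ, E) 𝓘(ℝ, W) ∞ (fun x => f (extChartAt 𝓘(ℝ, E) p x)) x :=
  ContMDiffAt.comp x hf.contMDiffAt (contMDiffAt_extChartAt_of_mem hp)

theorem eventually_mdifferentiableAt {f : M → W} {x : M}
    (hf : ContMDiffAt 𝓘(ℝ, E) 𝓘(ℝ, W) ∞ f x) :
    ∀ᶠ z in 𝓝 x, MDifferentiableAt 𝓘(ℝ, E) 𝓘(ℝ, W) f z := by
  have : IsManifold 𝓘(ℝ, E) 1 M := IsManifold.of_le (n := ∞) (by simp)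
  have h1 : ContMDiffAt 𝓘(ℝ, E) 𝓘(ℝ, W) 1 f x := hf.of_le (by simp)
  exact ((contMDiffAt_iff_contMDiffAt_nhds (by simp)).1 h1).mono fun z hz => hz.mdifferentiableAt (by simp)

/-- The differential of a function in a chart. -/
theorem mD_comp_mD_chart_symm {f : M → W} {p x : M} (hp : x ∈ (extChartAt 𝓘(ℝ, E) p).source)
    (hf : ContMDiffAt 𝓘(ℝ, E) 𝓘(ℝ, W) ∞ f x) :
    ∀ᶠ y in 𝓝 (extChartAt 𝓘(ℝ, E) p x),
      (mD f ((extChartAt 𝓘(ℝ, E) p).symm y) : E →L[ℝ] W).comp (chartDSymm p y) =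
        fderiv ℝ (fun y => f ((extChartAt 𝓘(ℝ, E) p).symm y)) y := by
  have hy := (extChartAt 𝓘(ℝ, E) p).map_source hp
  have hx : (extChartAt 𝓘(ℝ, E) p).symm (extChartAt 𝓘(ℝ, E) p x) = x :=
    (extChartAt 𝓘(ℝ, E) p).left_inv hp
  have hc := (contMDiffAt_extChartAt_symm_of_mem hy).continuousAt
  have hd := eventually_mdifferentiableAt hf
  rw [← hx] at hd
  filter_upwards [extChartAt_target_mem_nhds_of_mem hy, hc.eventually hd] with z hz hz'
  rw [chartDSymm, ← mD_comp hz' (mdiff_of_contMDiffAt (contMDiffAt_extChartAt_symm_of_mem hz)), mD_eq_fderiv]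

theorem contDiffAt_mD_comp {f : M → W} {p x : M} (hp : x ∈ (extChartAt 𝓘(ℝ, E) p).source)
    (hf : ContMDiffAt 𝓘(ℝ, E) 𝓘(ℝ, W) ∞ f x) :
    ContDiffAt ℝ ∞ (fun y => (mD f ((extChartAt 𝓘(ℝ, E) p).symm y) : E →L[ℝ] W).comp
      (chartDSymm p y)) (extChartAt 𝓘(ℝ, E) p x) :=
  ((contDiffAt_comp_chart_symm hp hf).fderiv_right (m := ∞) (by simp)).congr_of_eventuallyEq
    (mD_comp_mD_chart_symm hp hf)

omit [IsManifold 𝓘(ℝ, E) ∞ M] in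
theorem extD_apply₃ (κ : DForm E M 2 W) (x : M) (u v w : E) :
    extD κ x ![u, v, w] = extDeriv (chartRep κ x) (extChartAt 𝓘(ℝ, E) x x)
      ![chartD x x u, chartD x x v, chartD x x w] :=
  compContinuousLinearMap_apply₃ (E' := E) _ (chartD x x) u v w

end SmoothForms


/-! ### The 2-form on the Lie algebra -/

section VarpiForm

variable {F : Type*} [NormedAddCommGroup F] [NormedSpace ℝ F]

/-- The 2-form `ϖ` as a function of the operator `ad η`. -/
def varpiForm (b : F →L[ℝ] F →L[ℝ] ℝ) (A : F →L[ℝ] F) : F [⋀^Fin 2]→L[ℝ] ℝ :=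
  formOfBilin F ℝ ((1 / 2 : ℝ) • b.comp (phi₂ 1 (-A) - phi₂ 1 A))

variable [CompleteSpace F] {b : F →L[ℝ] F →L[ℝ] ℝ}

/-- The adjoint of `φ₂(A)` is `φ₂(-A)`, so the bilinear form is already alternating and taking its
alternating part changes nothing. -/
theorem varpiForm_apply (hsymm : ∀ x y, b x y = b y x) {A : F →L[ℝ] F}
    (hA : ∀ x y, b (A x) y = - b x (A y)) (X Y : F) :
    varpiForm b A ![X, Y] = varpiAux b 1 A X Y := by
  have hA' : ∀ x y, b ((-A) x) y = - b x ((-A) y) := fun x y => by simp [hA]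
  have h1 := adjoint_phi₂ hA 1 Y X
  have h2 := adjoint_phi₂ hA' 1 Y X
  rw [neg_neg] at h2
  rw [hsymm Y] at h1 h2
  rw [varpiForm, formOfBilin_apply]
  simp [varpiAux, h1, h2]
  ring

theorem contDiffAt_varpiForm {V : Type*} [NormedAddCommGroup V] [NormedSpace ℝ V]
    {n : WithTop ℕ∞} {A : V → F →L[ℝ] F} {y : V} (hA : ContDiffAt ℝ n A y) :
    ContDiffAt ℝ n (fun y => varpiForm b (A y)) y :=
  ContDiffAt.comp (f := fun y => (1 / 2 : ℝ) • b.comp (phi₂ 1 (-A y) - phi₂ 1 (A y))) y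
    contDiff_formOfBilin.contDiffAt (ContDiffAt.const_smul (1 / 2 : ℝ) (contDiffAt_const.clm_comp
      ((contDiffAt_phi₂_comp 1 hA.neg).sub (contDiffAt_phi₂_comp 1 hA))))

end VarpiForm

/-! ### The 2-form `ϖ` on the Lie algebra of `G`: exterior derivative, invariance, contraction -/

section VarpiGroup

variable {F G : Type*} [NormedAddCommGroup F] [NormedSpace ℝ F] [FiniteDimensional ℝ F]
  [TopologicalSpace G] [ChartedSpace F G] [Group G] [LieGroup 𝓘(ℝ, F) ∞ G] [T2Space G]
  {b : F →L[ℝ] F →L[ℝ] ℝ}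

theorem varpiForm_adL (hb : IsInvariantInner G b) (η X Y : F) :
    varpiForm b (adL G η) ![X, Y] = varpiAux b 1 (adL G η) X Y := by
  have : CompleteSpace F := FiniteDimensional.complete ℝ F
  exact varpiForm_apply hb.symm ((isMetricLie_adL hb).skew η) X Y

theorem varpi_eq_varpiForm (hb : IsInvariantInner G b) (η X Y : F) :
    varpi G b η X Y = varpiForm b (adL G η) ![X, Y] := by
  rw [varpi_eq hb, varpiForm_adL hb]

/-- The three cyclic terms coincide, and `3 · 2 / 12 = 1 / 2`. -/
theorem chi_eq (hb : IsInvariantInner G b) (g : G) (u v w : F) :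
    chi (F := F) b g u v w = (1 / 2) * cubic (adL G) b (dLeft g⁻¹ g u) (dLeft g⁻¹ g v)
      (dLeft g⁻¹ g w) := by
  set X := dLeft (F := F) g⁻¹ g u
  set Y := dLeft (F := F) g⁻¹ g v
  set Z := dLeft (F := F) g⁻¹ g w
  change (1 / 12) * (b X ((2 : ℝ) • adL G Y Z) + b Y ((2 : ℝ) • adL G Z X) +
    b Z ((2 : ℝ) • adL G X Y)) = _
  simp only [map_smul, smul_eq_mul]
  have h := isMetricLie_adL hb
  have h1 := cubic_rotate h X Y Z
  have h2 := cubic_rotate h Y Z X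
  unfold cubic at *
  linarith

/-- The exterior derivative of `ϖ` is minus the pullback of `χ`. -/
theorem extDeriv_varpiForm (hb : IsInvariantInner G b) (η X Y Z : F) :
    extDeriv (fun η => varpiForm b (adL G η)) η ![X, Y, Z] =
      - (1 / 2) * cubic (adL G) b (phi₁ 1 (-adL G η) X) (phi₁ 1 (-adL G η) Y)
        (phi₁ 1 (-adL G η) Z) := by
  have : CompleteSpace F := FiniteDimensional.complete ℝ F
  have hd : ContDiffAt ℝ ∞ (fun η => varpiForm b (adL G η)) η :=
    contDiffAt_varpiForm (adL G : F →L[ℝ] F →L[ℝ] F).contDiff.contDiffAt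
  rw [extDeriv_apply₃ (hd.differentiableAt (by simp))]
  -- Used for the bracket `-ad`, which produces `φ₁(-ad η)`, the left-trivialized differential of
  -- `exp`. Both `varpiAux` and `cubic` change sign.
  have h := cyclic_fderiv_varpiAux (isMetricLie_adL hb).neg 1 η X Y Z
  have hv : ∀ X Y, (fun η => varpiForm b (adL G η) ![X, Y]) =
      fun η => - varpiAux b 1 ((-adL G) η) X Y := by
    intro X Y
    funext η
    rw [varpiForm_adL hb, varpiAux, varpiAux]
    simp
    ring
  rw [hv, hv, hv, fderiv_fun_neg, fderiv_fun_neg, fderiv_fun_neg]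
  simp only [neg_apply] at h ⊢
  rw [← neg_add, ← neg_add, h]
  simp [cubic]

/-- `Ad_g` conjugates `ad η` into `ad (Ad_g η)`, hence also the operators `φ₂`, and it preserves
`b`. -/
theorem varpiForm_Ad (g : G) (hb : IsInvariantInner G b) (η X Y : F) :
    varpiForm b (adL G (Ad g η)) ![Ad g X, Ad g Y] = varpiForm b (adL G η) ![X, Y] := by
  have : CompleteSpace F := FiniteDimensional.complete ℝ F
  have h := Ad_comp_adL (G := G) g η
  have h' : (Ad g).comp (-adL G η) = (-adL G (Ad g η)).comp (Ad g) := by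
    ext x
    have := congrArg (fun T : F →L[ℝ] F => T x) h
    simpa using this
  have h1 : ∀ x, phi₂ 1 (adL G (Ad g η)) (Ad g x) = Ad g (phi₂ 1 (adL G η) x) := fun x =>
    (congrArg (fun T : F →L[ℝ] F => T x) (phi₂_intertwine h 1)).symm
  have h2 : ∀ x, phi₂ 1 (-adL G (Ad g η)) (Ad g x) = Ad g (phi₂ 1 (-adL G η) x) := fun x =>
    (congrArg (fun T : F →L[ℝ] F => T x) (phi₂_intertwine h' 1)).symm
  rw [varpiForm_adL hb, varpiForm_adL hb, varpiAux, varpiAux, sub_apply,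
    sub_apply, h1, h2, ← map_sub, hb.invariant]

/-- The contraction of `ϖ` with the fundamental vector fields of the adjoint action. -/
theorem varpiForm_moment (hb : IsInvariantInner G b) (η ξ Y : F) :
    varpiForm b (adL G η) ![adL G ξ η, Y] =
      (1 / 2) * b (phi₁ 1 (-adL G η) Y + phi₁ 1 (adL G η) Y) ξ - b Y ξ := by
  have : CompleteSpace F := FiniteDimensional.complete ℝ F
  have hL := isMetricLie_adL hb
  set A := adL G η with hA
  have hskew : ∀ x y, b (A x) y = - b x (A y) := hL.skew η
  have hskew' : ∀ x y, b ((-A) x) y = - b x ((-A) y) := fun x y => by simp [hskew]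
  -- Since `[ξ, η] = -A ξ`, the contraction only involves `φ₂(±A) A ξ`, where one integration can be
  -- undone.
  have h1 : phi₂ 1 A (A ξ) = phi₁ 1 A ξ - ξ := by
    rw [phi₁_eq_add 1 A]; simp
  have h2 : phi₂ 1 (-A) (A ξ) = ξ - phi₁ 1 (-A) ξ := by
    rw [phi₁_eq_add 1 (-A)]; simp
  have h3 := adjoint_phi₁ hskew 1 Y ξ
  have h4 := adjoint_phi₁ hskew' 1 Y ξ
  rw [neg_neg] at h4
  rw [varpiForm_adL hb, varpiAux, hL.antisymm ξ η, ← hA, map_neg, map_neg, sub_apply, h1, h2]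
  simp only [map_add, map_sub, neg_apply, add_apply, sub_apply, h3, h4]
  rw [hb.symm ξ Y, hb.symm (phi₁ 1 A ξ) Y, hb.symm (phi₁ 1 (-A) ξ) Y]
  ring

end VarpiGroup


/-! ### Local frames of the `b^m`-tangent bundle -/

namespace BmStructure

variable {E M : Type*} [NormedAddCommGroup E] [NormedSpace ℝ E]
  [TopologicalSpace M] [ChartedSpace E M] (B : BmStructure E M)

/-- The anchor as a continuous linear map. -/
def anchorL (x : M) : B.tangent x →L[ℝ] E :=
  (ContinuousLinearMap.snd ℝ ℝ E).comp (Submodule.subtypeL (B.tangent x) : B.tangent x →L[ℝ] ℝ × E)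

/-- The form `df / f ^ m` as a continuous linear map. -/
def coeffL (x : M) : B.tangent x →L[ℝ] ℝ :=
  (ContinuousLinearMap.fst ℝ ℝ E).comp (Submodule.subtypeL (B.tangent x) : B.tangent x →L[ℝ] ℝ × E)

theorem coeffL_apply {x : M} (e : B.tangent x) : B.coeffL x e = B.coeff e := rfl

theorem offZ_apply₁ {W : Type*} [NormedAddCommGroup W] [NormedSpace ℝ W] (τ : B.BmForm 1 W) (x : M)
    (v : TangentSpace 𝓘(ℝ, E) x) : B.offZ τ x ![v] = τ x ![B.lift x v] := by
  change τ x (B.lift x ∘ ![v]) = _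
  congr 1
  ext i : 1; fin_cases i; rfl

theorem offZ_apply₂ {W : Type*} [NormedAddCommGroup W] [NormedSpace ℝ W] (τ : B.BmForm 2 W) (x : M)
    (u v : TangentSpace 𝓘(ℝ, E) x) : B.offZ τ x ![u, v] = τ x ![B.lift x u, B.lift x v] := by
  change τ x (B.lift x ∘ ![u, v]) = _
  congr 1
  ext i : 1; fin_cases i <;> rfl

theorem Z_mem_nhds_compl {x : M} (hx : x ∉ B.Z) : B.Zᶜ ∈ 𝓝 x :=
  B.isClosed_Z.isOpen_compl.mem_nhds hx

theorem U_mem_nhds {p : M} (hp : p ∈ B.Z) : B.U ∈ 𝓝 p := B.isOpen_U.mem_nhds (B.Z_subset_U hp)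

theorem contMDiffAt_f {x : M} (hx : x ∈ B.U) : ContMDiffAt 𝓘(ℝ, E) 𝓘(ℝ) ∞ B.f x :=
  B.smooth_f.contMDiffAt (B.isOpen_U.mem_nhds hx)

/-- The complement of `Z` is dense. -/
theorem nhdsWithin_compl_neBot {p : M} (hp : p ∈ B.Z) : (𝓝[B.Zᶜ] p).NeBot := by
  by_contra h
  rw [not_neBot, nhdsWithin, inf_principal_eq_bot, compl_compl] at h
  refine B.mfderiv_f_ne_zero p hp ?_
  have h1 : B.f =ᶠ[𝓝 p] fun _ => (0 : ℝ) := by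
    filter_upwards [h] with x hx
    exact (B.mem_Z_iff x (B.Z_subset_U hx)).1 hx
  exact (mD_congr (E := E) h1).trans (mD_const (E := E) (0 : ℝ) p)

variable [IsManifold 𝓘(ℝ, E) ∞ M]

/-- Near every point of `Z` the `b^m`-tangent bundle has a smooth trivialization in coordinates. -/
theorem exists_frame {p : M} (hp : p ∈ B.Z) : ∃ (d : E → E →L[ℝ] ℝ) (J : E → E →L[ℝ] E),
    ∀ᶠ y in 𝓝 (extChartAt 𝓘(ℝ, E) p p), ContDiffAt ℝ ∞ d y ∧ ContDiffAt ℝ ∞ J y ∧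
      ∃ j : E ≃ₗ[ℝ] B.tangent ((extChartAt 𝓘(ℝ, E) p).symm y),
        (∀ u, B.coeffL _ (j u) = d y u) ∧ ∀ u, B.anchorL _ (j u) = chartDSymm p y (J y u) := by
  set ψ := extChartAt 𝓘(ℝ, E) p with hψ
  set y₀ := ψ p with hy₀
  have hps : p ∈ ψ.source := mem_extChartAt_source p
  have hy₀t : y₀ ∈ ψ.target := mem_extChartAt_target p
  have hsy₀ : ψ.symm y₀ = p := extChartAt_to_inv p
  set fc : E → ℝ := fun y => B.f (ψ.symm y) with hfc
  set d : E → E →L[ℝ] ℝ := fun y => fderiv ℝ fc y with hd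
  have hU : ∀ᶠ y in 𝓝 y₀, ψ.symm y ∈ B.U := by
    have hc := (contMDiffAt_extChartAt_symm_of_mem hy₀t).continuousAt
    refine hc.eventually ?_
    have := B.U_mem_nhds hp
    rw [← hsy₀] at this
    exact this
  have ht : ∀ᶠ y in 𝓝 y₀, y ∈ ψ.target := extChartAt_target_mem_nhds_of_mem hy₀t
  have hcoord : ∀ y, y ∈ ψ.target → ψ.symm y ∈ B.U → ContDiffAt ℝ ∞ fc y ∧
      (mD B.f (ψ.symm y) : E →L[ℝ] ℝ).comp (chartDSymm p y) = d y := by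
    intro y hy hyU
    have h1 := contDiffAt_comp_chart_symm (ψ.map_target hy) (B.contMDiffAt_f hyU)
    have h2 := (mD_comp_mD_chart_symm (ψ.map_target hy) (B.contMDiffAt_f hyU)).self_of_nhds
    have h3 : extChartAt 𝓘(ℝ, E) p (ψ.symm y) = y := ψ.right_inv hy
    rw [h3] at h1 h2
    have h4 : (extChartAt 𝓘(ℝ, E) p).symm y = ψ.symm y := rfl
    exact ⟨h1, h2⟩
  have hne : d y₀ ≠ 0 := by
    intro h0
    have h1 := (hcoord y₀ hy₀t (by rw [hsy₀]; exact B.Z_subset_U hp)).2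
    have h2 : chartDSymm p y₀ = ContinuousLinearMap.id ℝ E := chartDSymm_self p
    rw [h0, h2, ContinuousLinearMap.comp_id, hsy₀] at h1
    exact B.mfderiv_f_ne_zero p hp h1
  obtain ⟨w, hw⟩ : ∃ w, d y₀ w ≠ 0 := by
    by_contra! h
    exact hne (ContinuousLinearMap.ext h)
  have hds : ∀ y, y ∈ ψ.target → ψ.symm y ∈ B.U → ContDiffAt ℝ ∞ d y := fun y hy hyU =>
    (hcoord y hy hyU).1.fderiv_right (m := ∞) (by simp)
  have hw' : ∀ᶠ y in 𝓝 y₀, d y w ≠ 0 := by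
    have : ContinuousAt (fun y => d y w) y₀ :=
      ((hds y₀ hy₀t (by rw [hsy₀]; exact B.Z_subset_U hp)).clm_apply contDiffAt_const).continuousAt
    exact this.eventually_ne hw
  -- Here `w` is transversal to `Z`. The correction along `w` is chosen so that `d(J u) = f^m d(u)`,
  -- which places `(d u, J u)` in the fibre. On `Z` the map `J` kills `w`, but `d u` still records
  -- the lost component, so the trivialization remains bijective.
  refine ⟨d, fun y => ContinuousLinearMap.id ℝ E +
    ((fc y ^ B.m - 1) / d y w) • (d y).smulRight w, ?_⟩
  filter_upwards [hU, ht, hw'] with y hyU hyt hyw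
  obtain ⟨hfy, hmD⟩ := hcoord y hyt hyU
  refine ⟨hds y hyt hyU, ?_, ?_⟩
  · exact contDiffAt_const.add ((((hfy.pow B.m).sub contDiffAt_const).div
      ((hds y hyt hyU).clm_apply contDiffAt_const) hyw).smul
        ((hds y hyt hyU).smulRight contDiffAt_const))
  set J : E →L[ℝ] E := ContinuousLinearMap.id ℝ E +
    ((fc y ^ B.m - 1) / d y w) • (d y).smulRight w with hJ
  have hJu : ∀ u, J u = u + ((fc y ^ B.m - 1) * d y u / d y w) • w := fun u => by
    simp [hJ, smul_smul]; congr 1; ring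
  have hdJ : ∀ u, d y (J u) = fc y ^ B.m * d y u := fun u => by
    rw [hJu, map_add, map_smul, smul_eq_mul, div_mul_cancel₀ _ hyw]; ring
  have hdf : ∀ v : E, (mD B.f (ψ.symm y) : E →L[ℝ] ℝ) (chartDSymm p y v) = d y v := fun v =>
    congrArg (fun T : E →L[ℝ] ℝ => T v) hmD
  have hmem : ∀ u, ((d y u, chartDSymm p y (J u)) : ℝ × E) ∈ B.tangent (ψ.symm y) := fun u => by
    refine ⟨fun _ => ?_, fun h => absurd hyU h⟩
    change (mD B.f (ψ.symm y) : E →L[ℝ] ℝ) (chartDSymm p y (J u)) = fc y ^ B.m * d y u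
    rw [hdf, hdJ]
  have hinv : ∀ v : E, chartDSymm p y (chartD p (ψ.symm y) v) = v := fun v => by
    have h := chartDSymm_comp_chartD (ψ.map_target hyt)
    have h3 : extChartAt 𝓘(ℝ, E) p (ψ.symm y) = y := ψ.right_inv hyt
    rw [h3] at h
    exact congrArg (fun T : E →L[ℝ] E => T v) h
  have hinv' : ∀ v : E, chartD p (ψ.symm y) (chartDSymm p y v) = v := fun v =>
    congrArg (fun T : E →L[ℝ] E => T v) (chartD_comp_chartDSymm hyt)
  let j₀ : E →ₗ[ℝ] B.tangent (ψ.symm y) :=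
    LinearMap.codRestrict (B.tangent (ψ.symm y))
      ((d y).prod ((chartDSymm p y).comp J) : E →L[ℝ] ℝ × E).toLinearMap hmem
  have hbij : Function.Bijective j₀ := by
    constructor
    · intro u u' h
      have h1 : d y u = d y u' := congrArg (fun e => e.1.1) h
      have h2 : chartDSymm p y (J u) = chartDSymm p y (J u') := congrArg (fun e => e.1.2) h
      have h3 := congrArg (chartD p (ψ.symm y)) h2
      rw [hinv', hinv', hJu, hJu, h1] at h3
      exact add_right_cancel h3
    · intro e
      obtain ⟨s, v, hs, hv⟩ : ∃ (s : ℝ) (v : E), s = e.1.1 ∧ v = e.1.2 := ⟨_, _, rfl, rfl⟩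
      have h1 : (mD B.f (ψ.symm y) : E →L[ℝ] ℝ) v = fc y ^ B.m * s := by
        rw [hs, hv]; exact e.2.1 hyU
      set v' : E := chartD p (ψ.symm y) v with hv'
      have h2 : d y v' = fc y ^ B.m * s := by rw [← hdf, hinv, h1]
      have h3 : d y (v' - ((fc y ^ B.m - 1) * s / d y w) • w) = s := by
        rw [map_sub, map_smul, smul_eq_mul, div_mul_cancel₀ _ hyw, h2]; ring
      refine ⟨v' - ((fc y ^ B.m - 1) * s / d y w) • w, Subtype.ext (Prod.ext (h3.trans hs) ?_)⟩
      refine Eq.trans (b := v) ?_ hv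
      change chartDSymm p y (J _) = v
      rw [hJu, h3, sub_add_cancel, hv', hinv]
  exact ⟨LinearEquiv.ofBijective j₀ hbij, fun u => rfl, fun u => rfl⟩

end BmStructure


theorem contDiffAt_flip {V E F W : Type*} [NormedAddCommGroup V] [NormedSpace ℝ V]
    [NormedAddCommGroup E] [NormedSpace ℝ E] [NormedAddCommGroup F] [NormedSpace ℝ F]
    [NormedAddCommGroup W] [NormedSpace ℝ W] {n : WithTop ℕ∞} {S : V → E →L[ℝ] F →L[ℝ] W} {x : V}
    (hS : ContDiffAt ℝ n S x) : ContDiffAt ℝ n (fun y => (S y).flip) x := by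
  let L : (E →L[ℝ] F →L[ℝ] W) →L[ℝ] (F →L[ℝ] E →L[ℝ] W) :=
    (ContinuousLinearMap.flipₗᵢ ℝ E F W).toContinuousLinearEquiv
  exact (ContinuousLinearMap.contDiff (E := E →L[ℝ] F →L[ℝ] W)
    (F := F →L[ℝ] E →L[ℝ] W) L).contDiffAt.comp x hS

section DForm

variable {E M : Type*} [NormedAddCommGroup E] [NormedSpace ℝ E] [TopologicalSpace M]
  [ChartedSpace E M] {W : Type*} [NormedAddCommGroup W] [NormedSpace ℝ W]

/-- The differential of a function as a form of degree 1. -/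
def dForm (f : M → W) : DForm E M 1 W := fun x => formOfLin E W (mD f x)

variable [IsManifold 𝓘(ℝ, E) ∞ M]

theorem smoothFormAt_dForm {f : M → W} {x : M} (hf : ContMDiffAt 𝓘(ℝ, E) 𝓘(ℝ, W) ∞ f x) :
    SmoothFormAt (dForm (E := E) f) x := by
  have h := contDiff_formOfLin.contDiffAt.comp _
    (contDiffAt_mD_comp (mem_extChartAt_source (I := 𝓘(ℝ, E)) x) hf)
  refine h.congr_of_eventuallyEq (Eventually.of_forall fun y => form₁_ext fun u => ?_)
  rw [chartRep_eq, compContinuousLinearMap_apply₁]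
  rfl

omit [IsManifold 𝓘(ℝ, E) ∞ M] in
theorem linOfForm_chartRep (β : DForm E M 1 W) {p x : M}
    (hx : x ∈ (extChartAt 𝓘(ℝ, E) p).source) (v : TangentSpace 𝓘(ℝ, E) x) (u : E)
    (hv : (v : E) = chartDSymm p (extChartAt 𝓘(ℝ, E) p x) u) :
    linOfForm E W (chartRep β p (extChartAt 𝓘(ℝ, E) p x)) u = β x ![v] := by
  -- The base point `ψ⁻¹(ψ x)` equals `x` only propositionally. All tangent spaces being copies of
  -- `E`, the value is transported by substitution.
  have h : ∀ z, z = x → (show E [⋀^Fin 1]→L[ℝ] W from β z) ![(v : E)] = β x ![v] := by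
    rintro _ rfl; rfl
  rw [linOfForm_apply, chartRep_eq, compContinuousLinearMap_apply₁, ← hv]
  exact h _ ((extChartAt 𝓘(ℝ, E) p).left_inv hx)

omit [IsManifold 𝓘(ℝ, E) ∞ M] in
theorem bilinOfForm_chartRep (β : DForm E M 2 W) {p x : M}
    (hx : x ∈ (extChartAt 𝓘(ℝ, E) p).source) (v v' : TangentSpace 𝓘(ℝ, E) x) (u u' : E)
    (hv : (v : E) = chartDSymm p (extChartAt 𝓘(ℝ, E) p x) u)
    (hv' : (v' : E) = chartDSymm p (extChartAt 𝓘(ℝ, E) p x) u') :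
    bilinOfForm E W (chartRep β p (extChartAt 𝓘(ℝ, E) p x)) u u' = β x ![v, v'] := by
  have h : ∀ z, z = x → (show E [⋀^Fin 2]→L[ℝ] W from β z) ![(v : E), (v' : E)] =
      β x ![v, v'] := by
    rintro _ rfl; rfl
  rw [bilinOfForm_apply, chartRep_eq, compContinuousLinearMap_apply₂, ← hv, ← hv']
  exact h _ ((extChartAt 𝓘(ℝ, E) p).left_inv hx)

end DForm

/-! ### Coordinate expressions of `b^m`-forms and extension over `Z` -/

namespace BmStructure

variable {E M : Type*} [NormedAddCommGroup E] [NormedSpace ℝ E]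
  [TopologicalSpace M] [ChartedSpace E M] (B : BmStructure E M)
  {W : Type*} [NormedAddCommGroup W] [NormedSpace ℝ W]

/-- A pair `(d, J)` is a frame at `x` in the chart around `p` if `u ↦ (d u, J u)` is, in
coordinates, a smooth trivialization of the `b^m`-tangent bundle. -/
structure IsFrameAt (p : M) (d : E → E →L[ℝ] ℝ) (J : E → E →L[ℝ] E) (x : M) : Prop where
  mem_source : x ∈ (extChartAt 𝓘(ℝ, E) p).source
  contDiffAt_d : ContDiffAt ℝ ∞ d (extChartAt 𝓘(ℝ, E) p x)
  contDiffAt_J : ContDiffAt ℝ ∞ J (extChartAt 𝓘(ℝ, E) p x)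
  exists_equiv : ∃ j : E ≃ₗ[ℝ] B.tangent x, (∀ u, B.coeffL _ (j u) = d (extChartAt 𝓘(ℝ, E) p x) u) ∧
    ∀ u, B.anchorL _ (j u) = chartDSymm p (extChartAt 𝓘(ℝ, E) p x) (J (extChartAt 𝓘(ℝ, E) p x) u)

/-- A form `(df / f ^ m) a + β` in a frame. -/
def rep₁ (p : M) (d : E → E →L[ℝ] ℝ) (J : E → E →L[ℝ] E) (a : M → W) (β : DForm E M 1 W) (y : E) :
    E →L[ℝ] W :=
  (d y).smulRight (a ((extChartAt 𝓘(ℝ, E) p).symm y)) +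
    (linOfForm E W (chartRep β p y)).comp (J y)

/-- A form `(df / f ^ m) ∧ α + β` in a frame. -/
def rep₂ (p : M) (d : E → E →L[ℝ] ℝ) (J : E → E →L[ℝ] E) (α : DForm E M 1 ℝ) (β : DForm E M 2 ℝ)
    (y : E) : E →L[ℝ] E →L[ℝ] ℝ :=
  (d y).smulRight ((linOfForm E ℝ (chartRep α p y)).comp (J y)) -
    ((d y).smulRight ((linOfForm E ℝ (chartRep α p y)).comp (J y))).flip +
    bilinOfForm E ℝ ((chartRep β p y).compContinuousLinearMap (J y))

variable {B} {p x : M} {d : E → E →L[ℝ] ℝ} {J : E → E →L[ℝ] E}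

theorem rep₁_apply (hx : x ∈ (extChartAt 𝓘(ℝ, E) p).source) {a : M → W} {β : DForm E M 1 W}
    {e : B.tangent x} {u : E} (h1 : B.coeffL x e = d (extChartAt 𝓘(ℝ, E) p x) u)
    (h2 : B.anchorL x e = chartDSymm p (extChartAt 𝓘(ℝ, E) p x) (J (extChartAt 𝓘(ℝ, E) p x) u)) :
    rep₁ p d J a β (extChartAt 𝓘(ℝ, E) p x) u = B.coeff e • a x + β x ![B.anchor e] := by
  rw [← linOfForm_chartRep β hx (B.anchor e) _ h2, ← coeffL_apply, h1, rep₁,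
    (extChartAt 𝓘(ℝ, E) p).left_inv hx]
  rfl

theorem rep₂_apply (hx : x ∈ (extChartAt 𝓘(ℝ, E) p).source) {α : DForm E M 1 ℝ}
    {β : DForm E M 2 ℝ} {e e' : B.tangent x} {u u' : E}
    (h1 : B.coeffL x e = d (extChartAt 𝓘(ℝ, E) p x) u)
    (h2 : B.anchorL x e = chartDSymm p (extChartAt 𝓘(ℝ, E) p x) (J (extChartAt 𝓘(ℝ, E) p x) u))
    (h1' : B.coeffL x e' = d (extChartAt 𝓘(ℝ, E) p x) u')
    (h2' : B.anchorL x e' =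
      chartDSymm p (extChartAt 𝓘(ℝ, E) p x) (J (extChartAt 𝓘(ℝ, E) p x) u')) :
    rep₂ p d J α β (extChartAt 𝓘(ℝ, E) p x) u u' =
      B.coeff e * α x ![B.anchor e'] - B.coeff e' * α x ![B.anchor e] +
        β x ![B.anchor e, B.anchor e'] := by
  rw [← linOfForm_chartRep α hx (B.anchor e) _ h2, ← linOfForm_chartRep α hx (B.anchor e') _ h2',
    ← bilinOfForm_chartRep β hx (B.anchor e) (B.anchor e') _ _ h2 h2', ← coeffL_apply,
    ← coeffL_apply, h1, h1', rep₂, bilinOfForm_apply]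
  simp only [add_apply, sub_apply, ContinuousLinearMap.flip_apply,
    ContinuousLinearMap.smulRight_apply, bilinOfForm_apply]
  rw [compContinuousLinearMap_apply₂]
  rfl

variable [IsManifold 𝓘(ℝ, E) ∞ M]

variable (B) in
theorem exists_isFrameAt {p : M} (hp : p ∈ B.Z) : ∃ (d : E → E →L[ℝ] ℝ) (J : E → E →L[ℝ] E),
    ∀ᶠ x in 𝓝 p, B.IsFrameAt p d J x := by
  obtain ⟨d, J, h⟩ := B.exists_frame hp
  refine ⟨d, J, ?_⟩
  filter_upwards [(continuousAt_extChartAt p).eventually h,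
    extChartAt_source_mem_nhds (I := 𝓘(ℝ, E)) p] with x hx hxs
  rw [(extChartAt 𝓘(ℝ, E) p).left_inv hxs] at hx
  exact ⟨hxs, hx.1, hx.2.1, hx.2.2⟩

theorem IsFrameAt.contDiffAt_rep₁ (h : B.IsFrameAt p d J x) {a : M → W} {β : DForm E M 1 W}
    (ha : ContMDiffAt 𝓘(ℝ, E) 𝓘(ℝ, W) ∞ a x) (hβ : SmoothFormAt β x) :
    ContDiffAt ℝ ∞ (rep₁ p d J a β) (extChartAt 𝓘(ℝ, E) p x) := by
  refine (h.contDiffAt_d.smulRight (contDiffAt_comp_chart_symm h.mem_source ha)).add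
    (ContDiffAt.clm_comp ?_ h.contDiffAt_J)
  exact contDiff_linOfForm.contDiffAt.comp _ ((smoothFormAt_iff h.mem_source).1 hβ)

theorem IsFrameAt.contDiffAt_rep₂ (h : B.IsFrameAt p d J x) {α : DForm E M 1 ℝ}
    {β : DForm E M 2 ℝ} (hα : SmoothFormAt α x) (hβ : SmoothFormAt β x) :
    ContDiffAt ℝ ∞ (rep₂ p d J α β) (extChartAt 𝓘(ℝ, E) p x) := by
  have h1 : ContDiffAt ℝ ∞ (fun y => (d y).smulRight
      ((linOfForm E ℝ (chartRep α p y)).comp (J y))) (extChartAt 𝓘(ℝ, E) p x) :=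
    h.contDiffAt_d.smulRight ((contDiff_linOfForm.contDiffAt.comp _
      ((smoothFormAt_iff h.mem_source).1 hα)).clm_comp h.contDiffAt_J)
  have h2 : ContDiffAt ℝ ∞ (fun y => ((d y).smulRight
      ((linOfForm E ℝ (chartRep α p y)).comp (J y))).flip) (extChartAt 𝓘(ℝ, E) p x) :=
    contDiffAt_flip h1
  exact (h1.sub h2).add (contDiff_bilinOfForm.contDiffAt.comp _
    (contDiffAt_compContinuousLinearMap ((smoothFormAt_iff h.mem_source).1 hβ) h.contDiffAt_J))

/-- The value at a point of `Z` of a smooth `b^m`-form of degree 1 is determined by its values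
off `Z`. -/
theorem eq_of_eventually_eq_compl (hp : p ∈ B.Z) {a a' : M → W} {β β' : DForm E M 1 W}
    (ha : ContMDiffAt 𝓘(ℝ, E) 𝓘(ℝ, W) ∞ a p) (ha' : ContMDiffAt 𝓘(ℝ, E) 𝓘(ℝ, W) ∞ a' p)
    (hβ : SmoothFormAt β p) (hβ' : SmoothFormAt β' p)
    (h : ∀ᶠ x in 𝓝 p, x ∉ B.Z → ∀ e : B.tangent x,
      B.coeff e • a x + β x ![B.anchor e] = B.coeff e • a' x + β' x ![B.anchor e])
    (e : B.tangent p) :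
    B.coeff e • a p + β p ![B.anchor e] = B.coeff e • a' p + β' p ![B.anchor e] := by
  obtain ⟨d, J, hF⟩ := B.exists_isFrameAt hp
  have hFp := hF.self_of_nhds
  have := B.nhdsWithin_compl_neBot hp
  have hlim : ∀ {a : M → W} {β : DForm E M 1 W}, ContMDiffAt 𝓘(ℝ, E) 𝓘(ℝ, W) ∞ a p →
      SmoothFormAt β p → Tendsto (fun x => rep₁ p d J a β (extChartAt 𝓘(ℝ, E) p x))
        (𝓝[B.Zᶜ] p) (𝓝 (rep₁ p d J a β (extChartAt 𝓘(ℝ, E) p p))) := by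
    intro a β ha hβ
    have h1 : ContinuousAt (fun x => rep₁ p d J a β (extChartAt 𝓘(ℝ, E) p x)) p :=
      ContinuousAt.comp (g := rep₁ p d J a β) (hFp.contDiffAt_rep₁ ha hβ).continuousAt
        (continuousAt_extChartAt p)
    exact h1.tendsto.mono_left nhdsWithin_le_nhds
  have heq : rep₁ p d J a β (extChartAt 𝓘(ℝ, E) p p) =
      rep₁ p d J a' β' (extChartAt 𝓘(ℝ, E) p p) := by
    refine tendsto_nhds_unique_of_eventuallyEq (hlim ha hβ) (hlim ha' hβ') ?_
    filter_upwards [nhdsWithin_le_nhds hF, nhdsWithin_le_nhds h, self_mem_nhdsWithin] with x h1 h2 h3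
    obtain ⟨j, hj, hj'⟩ := h1.exists_equiv
    ext u
    rw [rep₁_apply h1.mem_source (hj u) (hj' u), rep₁_apply h1.mem_source (hj u) (hj' u), h2 h3]
  obtain ⟨j, hj, hj'⟩ := hFp.exists_equiv
  obtain ⟨u, rfl⟩ := j.surjective e
  rw [← rep₁_apply hFp.mem_source (hj u) (hj' u), ← rep₁_apply hFp.mem_source (hj u) (hj' u), heq]

variable (B) in
open Classical in
/-- Extension of a form of degree 1, defined off `Z`, to a `b^m`-form. -/
theorem exists_extension_form (δ : M → E →L[ℝ] W)
    (h : ∀ p ∈ B.Z, ∃ (a : M → W) (β : DForm E M 1 W), ∀ᶠ x in 𝓝 p,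
      ContMDiffAt 𝓘(ℝ, E) 𝓘(ℝ, W) ∞ a x ∧ SmoothFormAt β x ∧
      (x ∉ B.Z → ∀ e : B.tangent x, δ x (B.anchorL x e) = B.coeff e • a x + β x ![B.anchor e])) :
    ∃ τ : ∀ x, B.tangent x →L[ℝ] W, (∀ x ∉ B.Z, τ x = (δ x).comp (B.anchorL x)) ∧
      ∀ p ∈ B.Z, ∃ (a : M → W) (β : DForm E M 1 W), ∀ᶠ x in 𝓝 p,
        ContMDiffAt 𝓘(ℝ, E) 𝓘(ℝ, W) ∞ a x ∧ SmoothFormAt β x ∧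
        ∀ e : B.tangent x, τ x e = B.coeff e • a x + β x ![B.anchor e] := by
  choose! a β hloc using h
  -- At a point of `Z` the value is taken from the local expression chosen at that same point.
  -- Density of the complement of `Z` makes it agree with the expressions chosen at nearby points.
  refine ⟨fun x => if x ∈ B.Z then (B.coeffL x).smulRight (a x x) +
    (linOfForm E W (β x x)).comp (B.anchorL x) else (δ x).comp (B.anchorL x),
    fun x hx => if_neg hx, fun p hp => ⟨a p, β p, ?_⟩⟩
  filter_upwards [(hloc p hp).eventually_nhds] with x hx
  have hx0 := hx.self_of_nhds
  refine ⟨hx0.1, hx0.2.1, fun e => ?_⟩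
  by_cases hxZ : x ∈ B.Z
  · have hx1 := (hloc x hxZ).self_of_nhds
    rw [if_pos hxZ]
    have h1 := eq_of_eventually_eq_compl hxZ hx1.1 hx0.1 hx1.2.1 hx0.2.1
      (by filter_upwards [hx, hloc x hxZ] with z hz hz' hzZ e
          rw [← hz.2.2 hzZ, ← hz'.2.2 hzZ]) e
    rw [← h1]
    exact congrArg (B.coeff e • a x x + ·) (linOfForm_apply (E := E) (β x x) _)
  · rw [if_neg hxZ]
    exact hx0.2.2 hxZ e

omit [IsManifold 𝓘(ℝ, E) ∞ M] in
variable (B) in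
open Classical in
/-- Extension of a function defined off `Z`. -/
theorem exists_extension_fun (A : M → W)
    (h : ∀ p ∈ B.Z, ∃ A' : M → W, ∀ᶠ x in 𝓝 p,
      ContMDiffAt 𝓘(ℝ, E) 𝓘(ℝ, W) ∞ A' x ∧ (x ∉ B.Z → A' x = A x)) :
    ∃ A' : M → W, (∀ x ∉ B.Z, A' x = A x) ∧
      ∀ p ∈ B.Z, ∀ᶠ x in 𝓝 p, ContMDiffAt 𝓘(ℝ, E) 𝓘(ℝ, W) ∞ A' x := by
  choose! A' hloc using h
  refine ⟨fun x => if x ∈ B.Z then A' x x else A x, fun x hx => if_neg hx, fun p hp => ?_⟩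
  have heq : ∀ᶠ x in 𝓝 p, (if x ∈ B.Z then A' x x else A x) = A' p x := by
    filter_upwards [(hloc p hp).eventually_nhds] with x hx
    have hx0 := hx.self_of_nhds
    by_cases hxZ : x ∈ B.Z
    · have hx1 := (hloc x hxZ).self_of_nhds
      have := B.nhdsWithin_compl_neBot hxZ
      rw [if_pos hxZ]
      refine tendsto_nhds_unique_of_eventuallyEq (l := 𝓝[B.Zᶜ] x)
        (hx1.1.continuousAt.tendsto.mono_left nhdsWithin_le_nhds)
        (hx0.1.continuousAt.tendsto.mono_left nhdsWithin_le_nhds) ?_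
      filter_upwards [nhdsWithin_le_nhds hx, nhdsWithin_le_nhds (hloc x hxZ),
        self_mem_nhdsWithin] with z hz hz' hzZ
      rw [hz.2 hzZ, hz'.2 hzZ]
    · rw [if_neg hxZ, hx0.2 hxZ]
  filter_upwards [heq.eventually_nhds, hloc p hp] with x hx hx'
  exact hx'.1.congr_of_eventuallyEq hx

end BmStructure

/-! ### The differential of a `b^m`-function -/

section BmFunction

variable {W : Type*} [NormedAddCommGroup W] [NormedSpace ℝ W]

/-- The derivative of the singular part of a `b^m`-function has a pole of order at most `m`. -/
theorem exists_smooth_pow_smul_deriv {m : ℕ} (hm : 1 ≤ m) {c : ℕ → ℝ → W}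
    (hc : ∀ i, ContDiff ℝ ∞ (c i)) (a : W) :
    ∃ g : ℝ → W, ContDiff ℝ ∞ g ∧ ∀ t ≠ 0, ∃ r, HasDerivAt (fun t : ℝ =>
      ∑ i ∈ Finset.Icc 1 (m - 1), (t ^ i)⁻¹ • c i t + Real.log |t| • a) r t ∧ t ^ m • r = g t := by
  -- This is `t^m` times the derivative, term by term. For `i ≤ m - 1` the exponents `m - i` and `m
  -- - 1 - i` are genuine differences, so the pole is cancelled.
  refine ⟨fun t => ∑ i ∈ Finset.Icc 1 (m - 1), ((t ^ (m - i)) • deriv (c i) t +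
    (-(i : ℝ) * t ^ (m - 1 - i)) • c i t) + t ^ (m - 1) • a, ?_, fun t ht => ?_⟩
  · refine ContDiff.add (ContDiff.sum fun i _ => ?_) ((contDiff_id.pow _).smul contDiff_const)
    refine ((contDiff_id.pow _).smul ?_).add
      ((contDiff_const.mul (contDiff_id.pow _)).smul (hc i))
    exact (contDiff_infty_iff_deriv.1 (hc i)).2
  have h1 : ∀ i ∈ Finset.Icc 1 (m - 1), HasDerivAt (fun t : ℝ => (t ^ i)⁻¹ • c i t)
      ((t ^ i)⁻¹ • deriv (c i) t + (-((i : ℝ) * t ^ (i - 1)) / (t ^ i) ^ 2) • c i t) t := by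
    intro i _
    have h2 := (hasDerivAt_pow i t).inv (pow_ne_zero i ht)
    exact h2.smul (((hc i).differentiable (by simp)) t).hasDerivAt
  have h3 : HasDerivAt (fun t : ℝ => Real.log |t| • a) (t⁻¹ • a) t := by
    simp only [Real.log_abs]
    exact (Real.hasDerivAt_log ht).smul_const a
  refine ⟨_, (HasDerivAt.fun_sum h1).add h3, ?_⟩
  rw [smul_add, Finset.smul_sum]
  congr 1
  · refine Finset.sum_congr rfl fun i hi => ?_
    rw [Finset.mem_Icc] at hi
    rw [smul_add, smul_smul, smul_smul]
    congr 2
    · rw [← div_eq_mul_inv, pow_sub₀ t ht (by omega), div_eq_mul_inv]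
    · obtain ⟨k, hk⟩ : ∃ k, i = k + 1 := ⟨i - 1, by omega⟩
      obtain ⟨l, hl⟩ : ∃ l, m = i + 1 + l := ⟨m - 1 - i, by omega⟩
      subst hk
      subst hl
      have e1 : k + 1 + 1 + l - 1 - (k + 1) = l := by omega
      rw [e1, Nat.add_sub_cancel]
      field_simp
      ring
  · rw [smul_smul]
    congr 1
    obtain ⟨k, rfl⟩ : ∃ k, m = k + 1 := ⟨m - 1, by omega⟩
    rw [Nat.add_sub_cancel, pow_succ, mul_assoc, mul_inv_cancel₀ ht, mul_one]

variable {E M : Type*} [NormedAddCommGroup E] [NormedSpace ℝ E]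
  [TopologicalSpace M] [ChartedSpace E M] [IsManifold 𝓘(ℝ, E) ∞ M] {B : BmStructure E M}

omit [IsManifold 𝓘(ℝ, E) ∞ M] in
theorem contMDiffAt_of_isBmFunction {μ : M → W} (hμ : B.IsBmFunction μ) {x : M} (hx : x ∉ B.Z) :
    ContMDiffAt 𝓘(ℝ, E) 𝓘(ℝ, W) ∞ μ x :=
  hμ.1.contMDiffAt (B.Z_mem_nhds_compl hx)

/-- On a `b^m`-tangent vector `e` one has `df(e) = f^m · coeff e`, and the factor `f^m` cancels the
pole in the derivative of the singular part. -/
theorem exists_differential_of_isBmFunction {μ : M → W} (hμ : B.IsBmFunction μ) {p : M}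
    (hp : p ∈ B.Z) : ∃ (a : M → W) (β : DForm E M 1 W), ∀ᶠ x in 𝓝 p,
      ContMDiffAt 𝓘(ℝ, E) 𝓘(ℝ, W) ∞ a x ∧ SmoothFormAt β x ∧
      (x ∉ B.Z → ∀ e : B.tangent x,
        (mD μ x : E →L[ℝ] W) (B.anchorL x e) = B.coeff e • a x + β x ![B.anchor e]) := by
  obtain ⟨c, a, h, hc, hloc⟩ := hμ.2 p hp
  obtain ⟨g, hg, hgr⟩ := exists_smooth_pow_smul_deriv B.one_le_m hc a
  refine ⟨fun x => g (B.f x), dForm h, ?_⟩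
  filter_upwards [hloc.eventually_nhds, B.U_mem_nhds hp] with x hx hxU
  have hx0 := hx.self_of_nhds
  refine ⟨hg.contMDiff.contMDiffAt.comp x (B.contMDiffAt_f hxU), smoothFormAt_dForm hx0.1,
    fun hxZ e => ?_⟩
  have hfx : B.f x ≠ 0 := fun h0 => hxZ ((B.mem_Z_iff x hxU).2 h0)
  obtain ⟨r, hr, hr'⟩ := hgr _ hfx
  set ρ : ℝ → W := fun t => ∑ i ∈ Finset.Icc 1 (B.m - 1), (t ^ i)⁻¹ • c i t + Real.log |t| • a
  have h1 : μ =ᶠ[𝓝 x] fun z => ρ (B.f z) + h z := by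
    filter_upwards [hx, B.Z_mem_nhds_compl hxZ] with z hz hzZ
    exact hz.2 hzZ
  have hfd := hasMFDerivAt_mD (mdiff_of_contMDiffAt (B.contMDiffAt_f hxU))
  have h2 := HasMFDerivAt.comp x hr.hasFDerivAt.hasMFDerivAt hfd
  have h3 := h2.add (hasMFDerivAt_mD (mdiff_of_contMDiffAt hx0.1))
  have h4 : (mD μ x : E →L[ℝ] W) = ((ContinuousLinearMap.toSpanSingleton ℝ r).comp
      (mD B.f x : E →L[ℝ] ℝ)) + mD h x := (mD_congr h1).trans (mD_eq h3)
  have h5 : (mD B.f x : E →L[ℝ] ℝ) (B.anchorL x e) = B.f x ^ B.m * B.coeff e := e.2.1 hxU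
  rw [h4, add_apply, ContinuousLinearMap.comp_apply, h5,
    ContinuousLinearMap.toSpanSingleton_apply, mul_comm, mul_smul, hr']
  rfl

end BmFunction


theorem exists_equiv_of_injective {E : Type*} [NormedAddCommGroup E] [NormedSpace ℝ E]
    [FiniteDimensional ℝ E] {S : E →L[ℝ] E →L[ℝ] ℝ} (h : ∀ u, S u = 0 → u = 0) :
    ∃ S' : E ≃L[ℝ] (E →L[ℝ] ℝ), (S' : E →L[ℝ] E →L[ℝ] ℝ) = S := by
  have hf : Module.finrank ℝ E = Module.finrank ℝ (E →L[ℝ] ℝ) := by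
    rw [← Subspace.dual_finrank_eq (K := ℝ) (V := E)]
    exact (LinearMap.toContinuousLinearMap (𝕜 := ℝ) (E := E) (F' := ℝ)).finrank_eq
  have hinj : Function.Injective S.toLinearMap := (injective_iff_map_eq_zero S).2 h
  refine ⟨(LinearEquiv.ofInjectiveOfFinrankEq S.toLinearMap hinj hf).toContinuousLinearEquiv, ?_⟩
  ext u v
  rfl

section Actions

variable {E M F G : Type*} [NormedAddCommGroup E] [NormedSpace ℝ E]
  [TopologicalSpace M] [ChartedSpace E M]
  [NormedAddCommGroup F] [NormedSpace ℝ F]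
  [TopologicalSpace G] [ChartedSpace F G] [Group G]
  [MulAction G M] [ContMDiffSMul 𝓘(ℝ, F) 𝓘(ℝ, E) ∞ G M]

variable (E F) in
omit [NormedSpace ℝ F] [ChartedSpace F G] [ContMDiffSMul 𝓘(ℝ, F) 𝓘(ℝ, E) ∞ G M] in
theorem mdiff_smul_left [NormedSpace ℝ F] [ChartedSpace F G]
    [ContMDiffSMul 𝓘(ℝ, F) 𝓘(ℝ, E) ∞ G M] (g : G) (x : M) :
    MDifferentiableAt 𝓘(ℝ, E) 𝓘(ℝ, E) (fun y : M => g • y) x :=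
  mdiff_of_contMDiffAt
    (ContMDiffSMul.contMDiff_const_smul (I := 𝓘(ℝ, F)) (I' := 𝓘(ℝ, E)) (n := ∞) g).contMDiffAt

theorem mdiff_smul_right (x : M) (g : G) :
    MDifferentiableAt 𝓘(ℝ, F) 𝓘(ℝ, E) (fun h : G => h • x) g :=
  mdiff_of_contMDiffAt (ContMDiff.smul (I := 𝓘(ℝ, F)) (I' := 𝓘(ℝ, E)) (n := ∞)
    contMDiff_id contMDiff_const).contMDiffAt

end Actions

/-! ### Hamiltonian spaces and the extension of `dμ` and `ad μ` over `Z` -/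

section Hamiltonian

variable {E M F G : Type*} [NormedAddCommGroup E] [NormedSpace ℝ E]
  [TopologicalSpace M] [ChartedSpace E M]
  [NormedAddCommGroup F] [NormedSpace ℝ F]
  [TopologicalSpace G] [ChartedSpace F G] [Group G]
  [MulAction G M]
  {b : F →L[ℝ] F →L[ℝ] ℝ} {B : BmStructure E M} {ω₀ : B.BmForm 2 ℝ} {μ : M → F}

theorem IsBmHamiltonian.smul_notMem_Z (h₀ : IsBmHamiltonian G B b ω₀ μ) (g : G) {x : M}
    (hx : x ∉ B.Z) : g • x ∉ B.Z := fun h => hx <| by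
  simpa using h₀.smul_mem_Z g⁻¹ _ h

theorem IsBmHamiltonian.contMDiffAt (h₀ : IsBmHamiltonian G B b ω₀ μ) {x : M} (hx : x ∉ B.Z) :
    ContMDiffAt 𝓘(ℝ, E) 𝓘(ℝ, F) ∞ μ x := contMDiffAt_of_isBmFunction h₀.isBmFunction hx

theorem IsBmHamiltonian.mdiff (h₀ : IsBmHamiltonian G B b ω₀ μ) {x : M} (hx : x ∉ B.Z) :
    MDifferentiableAt 𝓘(ℝ, E) 𝓘(ℝ, F) μ x := mdiff_of_contMDiffAt (h₀.contMDiffAt hx)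

variable [ContMDiffSMul 𝓘(ℝ, F) 𝓘(ℝ, E) ∞ G M]

/-- The differential of the moment map intertwines the actions. -/
theorem IsBmHamiltonian.mD_comp_smul (h₀ : IsBmHamiltonian G B b ω₀ μ) (g : G) {x : M}
    (hx : x ∉ B.Z) : (mD μ (g • x) : E →L[ℝ] F).comp (mD (fun y : M => g • y) x : E →L[ℝ] E) =
      (Ad g).comp (mD μ x : E →L[ℝ] F) := by
  rw [← mD_comp (h₀.mdiff (h₀.smul_notMem_Z g hx)) (mdiff_smul_left E F g x)]
  have h1 : (fun y => μ (g • y)) =ᶠ[𝓝 x] fun y => Ad g (μ y) := by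
    filter_upwards [B.Z_mem_nhds_compl hx] with y hy using h₀.equivariant g y hy
  rw [mD_congr h1]
  exact mD_eq (HasMFDerivAt.comp x (Ad g : F →L[ℝ] F).hasFDerivAt.hasMFDerivAt
    (hasMFDerivAt_mD (h₀.mdiff hx)))

variable [FiniteDimensional ℝ F] [LieGroup 𝓘(ℝ, F) ∞ G]

/-- The derivative of the moment map along the fundamental vector fields. -/
theorem IsBmHamiltonian.mD_fundVF (h₀ : IsBmHamiltonian G B b ω₀ μ) (ξ : F) {x : M}
    (hx : x ∉ B.Z) : (mD μ x : E →L[ℝ] F) (fundVF E G ξ x) = adL G ξ (μ x) := by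
  have h1 := mD_comp_of_eq (h₀.mdiff hx) (mdiff_smul_right (E := E) (F := F) x (1 : G)) (one_smul G x)
  have h2 : (fun g : G => μ (g • x)) = fun g : G => Ad g (μ x) :=
    funext fun g => h₀.equivariant g x hx
  rw [h2, mD_eq (hasMFDerivAt_Ad (G := G) (μ x))] at h1
  exact (congrArg (fun T : F →L[ℝ] F => T ξ) h1).symm

variable [FiniteDimensional ℝ E] [IsManifold 𝓘(ℝ, E) ∞ M] [T2Space G]

/-- By dimension, injectivity makes `S y` an isomorphism onto the dual space, and inversion is
smooth at isomorphisms. -/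
theorem contDiffAt_inverse_comp {V : Type*} [NormedAddCommGroup V] [NormedSpace ℝ V]
    {S : V → E →L[ℝ] E →L[ℝ] ℝ} {y : V} (hS : ContDiffAt ℝ ∞ S y) (h : ∀ u, S y u = 0 → u = 0) :
    ContDiffAt ℝ ∞ (fun y => (S y).inverse) y := by
  have : CompleteSpace E := FiniteDimensional.complete ℝ E
  obtain ⟨S', hS'⟩ := exists_equiv_of_injective h
  have h1 := contDiffAt_map_inverse (𝕜 := ℝ) (n := ∞) S'
  rw [hS'] at h1
  exact h1.comp y hS

omit [T2Space G] in
/-- Although `μ` is singular along `Z`, the operators `ad μ` extend smoothly over `Z`, because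
`ω₀` is non-degenerate. -/
theorem IsBmHamiltonian.exists_local_ad (h₀ : IsBmHamiltonian G B b ω₀ μ)
    (hb : ∀ x y : F, adL G x y = - adL G y x) {p : M} (hp : p ∈ B.Z) :
    ∃ A : M → F →L[ℝ] F, ∀ᶠ x in 𝓝 p,
      ContMDiffAt 𝓘(ℝ, E) 𝓘(ℝ, F →L[ℝ] F) ∞ A x ∧ (x ∉ B.Z → A x = adL G (μ x)) := by
  obtain ⟨d, J, hF⟩ := B.exists_isFrameAt hp
  obtain ⟨α, β, hαβ⟩ := h₀.smooth.2 p hp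
  obtain ⟨a, β₁, haβ₁⟩ := exists_differential_of_isBmFunction h₀.isBmFunction hp
  set S : E → E →L[ℝ] E →L[ℝ] ℝ := BmStructure.rep₂ p d J α β with hS
  set T : E → E →L[ℝ] F := BmStructure.rep₁ p d J a β₁ with hT
  -- In the frame, `S` is `ω₀` and `T` is `dμ`. The vector `S⁻¹(b(T ·, ξ))` represents the field
  -- dual to `(dμ, ξ)`, and `T` maps it to `[ξ, μ]`; the sign turns this into `[μ, ξ]`.
  refine ⟨fun x => -((T (extChartAt 𝓘(ℝ, E) p x)).comp ((S (extChartAt 𝓘(ℝ, E) p x)).inverse.comp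
    (b.comp (T (extChartAt 𝓘(ℝ, E) p x))).flip)), ?_⟩
  filter_upwards [hF, hαβ, haβ₁] with x hFx hαβx haβ₁x
  obtain ⟨hα, hβ, hω⟩ := hαβx
  obtain ⟨ha, hβ₁, hμ⟩ := haβ₁x
  set y := extChartAt 𝓘(ℝ, E) p x with hy
  have hSd : ContDiffAt ℝ ∞ S y := hFx.contDiffAt_rep₂ hα hβ
  have hTd : ContDiffAt ℝ ∞ T y := hFx.contDiffAt_rep₁ ha hβ₁
  obtain ⟨j, hj, hj'⟩ := hFx.exists_equiv
  have hSω : ∀ u u', S y u u' = ω₀ x ![j u, j u'] := fun u u' => by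
    rw [hω]
    exact BmStructure.rep₂_apply hFx.mem_source (hj u) (hj' u) (hj u') (hj' u')
  have hinj : ∀ u, S y u = 0 → u = 0 := fun u hu => by
    rw [← j.map_eq_zero_iff]
    refine h₀.nondegenerate x (j u) fun e' => ?_
    obtain ⟨u', rfl⟩ := j.surjective e'
    rw [← hSω, hu]
    rfl
  constructor
  · refine contMDiffAt_comp_chart (f := fun y => -((T y).comp ((S y).inverse.comp
      (b.comp (T y)).flip))) hFx.mem_source ?_
    exact (hTd.clm_comp ((contDiffAt_inverse_comp hSd hinj).clm_comp
      (contDiffAt_flip (contDiffAt_const.clm_comp hTd)))).neg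
  · intro hxZ
    obtain ⟨S', hS'⟩ := exists_equiv_of_injective hinj
    ext ξ
    have hTμ : ∀ u, T y u = (mD μ x : E →L[ℝ] F) (B.anchorL x (j u)) := fun u => by
      rw [hμ hxZ]
      exact BmStructure.rep₁_apply hFx.mem_source (hj u) (hj' u)
    set u := (S y).inverse ((b.comp (T y)).flip ξ) with hu
    have hSu : S y u = (b.comp (T y)).flip ξ := by
      rw [hu, ← hS', ContinuousLinearMap.inverse_equiv]
      exact S'.apply_symm_apply _
    -- Both vectors have the contraction `(dμ, ξ)` with `ω₀`, the second by the moment condition, so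
    -- they agree by non-degeneracy.
    have hju : j u = B.lift x (fundVF E G ξ x) := by
      rw [← sub_eq_zero]
      refine h₀.nondegenerate x _ fun e' => ?_
      obtain ⟨u', rfl⟩ := j.surjective e'
      have h1 : ω₀ x ![j u, j u'] = b (T y u') ξ := by
        rw [← hSω, hSu]; rfl
      have h2 := h₀.moment ξ x hxZ (B.anchor (j u'))
      rw [B.offZ_apply₂, B.lift_anchor hxZ] at h2
      have h3 : ω₀ x ![B.lift x (fundVF E G ξ x), j u'] = b (T y u') ξ := by
        rw [h2, hTμ]; rfl
      have h4 := (ω₀ x).map_update_sub ![j u, j u'] 0 (j u) (B.lift x (fundVF E G ξ x))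
      have e : ∀ z, Function.update ![j u, j u'] 0 z = ![z, j u'] := fun z => by
        ext i : 1; fin_cases i <;> rfl
      rw [e, e, e, h1, h3, sub_self] at h4
      exact h4
    change -(T y u) = adL G (μ x) ξ
    have h5 : B.anchorL x (j u) = fundVF E G ξ x := by
      rw [hju]
      exact B.anchor_lift hxZ _
    have h6 : T y u = adL G ξ (μ x) := by
      rw [hTμ, ← h₀.mD_fundVF ξ hxZ]
      exact congrArg (mD μ x : E →L[ℝ] F) h5
    rw [h6, hb ξ, neg_neg]

/-- The operators `ad μ`, extended over `Z`. -/
theorem IsBmHamiltonian.exists_ad (h₀ : IsBmHamiltonian G B b ω₀ μ) (hb : IsInvariantInner G b) :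
    ∃ A : M → F →L[ℝ] F, (∀ x ∉ B.Z, A x = adL G (μ x)) ∧
      ∀ x, ContMDiffAt 𝓘(ℝ, E) 𝓘(ℝ, F →L[ℝ] F) ∞ A x := by
  obtain ⟨A, hA, hA'⟩ := B.exists_extension_fun _ fun _ hp =>
    h₀.exists_local_ad (isMetricLie_adL hb).antisymm hp
  refine ⟨A, hA, fun x => ?_⟩
  by_cases hx : x ∈ B.Z
  · exact (hA' x hx).self_of_nhds
  · have h1 : ContMDiffAt 𝓘(ℝ, E) 𝓘(ℝ, F →L[ℝ] F) ∞ (fun x => adL G (μ x)) x :=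
      (adL G : F →L[ℝ] F →L[ℝ] F).contDiff.contMDiff.contMDiffAt.comp x (h₀.contMDiffAt hx)
    exact h1.congr_of_eventuallyEq (by
      filter_upwards [B.Z_mem_nhds_compl hx] with y hy using hA y hy)

omit [ContMDiffSMul 𝓘(ℝ, F) 𝓘(ℝ, E) ∞ G M] [FiniteDimensional ℝ F] [LieGroup 𝓘(ℝ, F) ∞ G]
  [FiniteDimensional ℝ E] [T2Space G] in
/-- The differential of the moment map, as a `b^m`-form. -/
theorem IsBmHamiltonian.exists_dmu (h₀ : IsBmHamiltonian G B b ω₀ μ) :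
    ∃ D : ∀ x, B.tangent x →L[ℝ] F,
      (∀ x ∉ B.Z, D x = (mD μ x : E →L[ℝ] F).comp (B.anchorL x)) ∧
      ∀ p ∈ B.Z, ∃ (a : M → F) (β : DForm E M 1 F), ∀ᶠ x in 𝓝 p,
        ContMDiffAt 𝓘(ℝ, E) 𝓘(ℝ, F) ∞ a x ∧ SmoothFormAt β x ∧
        ∀ e : B.tangent x, D x e = B.coeff e • a x + β x ![B.anchor e] :=
  B.exists_extension_form _ fun _ hp => exists_differential_of_isBmFunction h₀.isBmFunction hp

end Hamiltonian


/-! ### Operations on forms -/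

section Operations

variable {E M : Type*} [NormedAddCommGroup E] [NormedSpace ℝ E] [TopologicalSpace M]
  [ChartedSpace E M] {k : ℕ} {F W : Type*} [NormedAddCommGroup F] [NormedSpace ℝ F]
  [NormedAddCommGroup W] [NormedSpace ℝ W]

/-- The composition of a 1-form with values in `F` and linear maps on `F`. -/
def compForm (C : M → F →L[ℝ] W) (β : DForm E M 1 F) : DForm E M 1 W := fun x =>
  formOfLin E W ((C x).comp (linOfForm E F (β x)))

/-- The form `P (β, β)` for a 1-form `β` with values in `F` and 2-forms `P` on `F`. -/
def pullForm (P : M → F [⋀^Fin 2]→L[ℝ] W) (β : DForm E M 1 F) : DForm E M 2 W := fun x =>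
  ContinuousAlternatingMap.compContinuousLinearMap (P x) (linOfForm E F (β x))

theorem compForm_apply (C : M → F →L[ℝ] W) (β : DForm E M 1 F) (x : M)
    (v : TangentSpace 𝓘(ℝ, E) x) : compForm C β x ![v] = C x (β x ![v]) :=
  congrArg (C x) (linOfForm_apply (E := E) (β x) v)

theorem pullForm_apply (P : M → F [⋀^Fin 2]→L[ℝ] W) (β : DForm E M 1 F) (x : M)
    (u v : TangentSpace 𝓘(ℝ, E) x) : pullForm P β x ![u, v] = P x ![β x ![u], β x ![v]] := by
  refine (compContinuousLinearMap_apply₂ (P x) (linOfForm E F (β x)) u v).trans ?_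
  exact congrArg₂ (fun s t => P x ![s, t]) (linOfForm_apply (E := E) (β x) u)
    (linOfForm_apply (E := E) (β x) v)

theorem linOfForm_chartRep_apply (β : DForm E M 1 F) (p : M) (y u : E) :
    linOfForm E F (chartRep β p y) u =
      (show E [⋀^Fin 1]→L[ℝ] F from β ((extChartAt 𝓘(ℝ, E) p).symm y)) ![chartDSymm p y u] := by
  rw [linOfForm_apply, chartRep_eq, compContinuousLinearMap_apply₁]

variable [IsManifold 𝓘(ℝ, E) ∞ M]

theorem chartRep_congr {κ κ' : DForm E M k W} {x : M} (h : ∀ᶠ z in 𝓝 x, κ' z = κ z) :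
    chartRep κ' x =ᶠ[𝓝 (extChartAt 𝓘(ℝ, E) x x)] chartRep κ x := by
  have hc := (contMDiffAt_extChartAt_symm_of_mem
    (mem_extChartAt_target (I := 𝓘(ℝ, E)) x)).continuousAt
  have h' := hc.eventually (p := fun z => κ' z = κ z) (by rwa [extChartAt_to_inv x])
  filter_upwards [h'] with y hy
  rw [chartRep, chartRep, hy]

theorem SmoothFormAt.congr {κ κ' : DForm E M k W} {x : M} (hκ : SmoothFormAt κ x)
    (h : ∀ᶠ z in 𝓝 x, κ' z = κ z) : SmoothFormAt κ' x :=
  hκ.congr_of_eventuallyEq (chartRep_congr h)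

omit [IsManifold 𝓘(ℝ, E) ∞ M] in
theorem SmoothFormAt.add {κ κ' : DForm E M k W} {x : M} (hκ : SmoothFormAt κ x)
    (hκ' : SmoothFormAt κ' x) : SmoothFormAt (fun x => κ x + κ' x) x :=
  ContDiffAt.add hκ hκ'

theorem smoothFormAt_compForm {C : M → F →L[ℝ] W} {β : DForm E M 1 F} {x : M}
    (hC : ContMDiffAt 𝓘(ℝ, E) 𝓘(ℝ, F →L[ℝ] W) ∞ C x) (hβ : SmoothFormAt β x) :
    SmoothFormAt (compForm C β) x := by
  have h1 := contDiffAt_comp_chart_symm (mem_extChartAt_source (I := 𝓘(ℝ, E)) x) hC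
  have h2 := contDiff_formOfLin.contDiffAt.comp _ (h1.clm_comp
    (contDiff_linOfForm.contDiffAt.comp _ hβ))
  refine h2.congr_of_eventuallyEq (Eventually.of_forall fun y => form₁_ext fun u => ?_)
  rw [chartRep_eq, compContinuousLinearMap_apply₁]
  refine (compForm_apply C β _ _).trans (congrArg (C _) ?_)
  exact (linOfForm_chartRep_apply β x y u).symm

theorem smoothFormAt_pullForm {P : M → F [⋀^Fin 2]→L[ℝ] W} {β : DForm E M 1 F} {x : M}
    (hP : ContMDiffAt 𝓘(ℝ, E) 𝓘(ℝ, F [⋀^Fin 2]→L[ℝ] W) ∞ P x) (hβ : SmoothFormAt β x) :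
    SmoothFormAt (pullForm P β) x := by
  have h1 := contDiffAt_comp_chart_symm (mem_extChartAt_source (I := 𝓘(ℝ, E)) x) hP
  have h2 := contDiffAt_compContinuousLinearMap h1 (contDiff_linOfForm.contDiffAt.comp _ hβ)
  refine h2.congr_of_eventuallyEq (Eventually.of_forall fun y => form₂_ext fun u v => ?_)
  rw [chartRep_eq, compContinuousLinearMap_apply₂, compContinuousLinearMap_apply₂]
  refine (pullForm_apply P β _ _ _).trans ?_
  exact congrArg₂ (fun s t => P _ ![s, t]) (linOfForm_chartRep_apply β x y u).symm
    (linOfForm_chartRep_apply β x y v).symm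

/-- The exterior derivative of the pullback of a 2-form. -/
theorem extD_pullForm_dForm {κ : F → F [⋀^Fin 2]→L[ℝ] W} {μ : M → F} {x : M}
    (hκ : ContDiffAt ℝ ∞ κ (μ x)) (hμ : ContMDiffAt 𝓘(ℝ, E) 𝓘(ℝ, F) ∞ μ x) (u v w : E) :
    extD (pullForm (fun x => κ (μ x)) (dForm (E := E) μ)) x ![u, v, w] = extDeriv κ (μ x)
      ![(mD μ x : E →L[ℝ] F) u, (mD μ x : E →L[ℝ] F) v, (mD μ x : E →L[ℝ] F) w] := by
  set ψ := extChartAt 𝓘(ℝ, E) x with hψ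
  set φ : E → F := fun y => μ (ψ.symm y) with hφ
  have hs := mem_extChartAt_source (I := 𝓘(ℝ, E)) x
  have hx : ψ.symm (ψ x) = x := extChartAt_to_inv x
  have hφd : ContDiffAt ℝ ∞ φ (ψ x) := contDiffAt_comp_chart_symm hs hμ
  have hm := mD_comp_mD_chart_symm hs hμ
  have h1 : chartRep (pullForm (fun x => κ (μ x)) (dForm (E := E) μ)) x =ᶠ[𝓝 (ψ x)]
      fun y => (κ (φ y)).compContinuousLinearMap (fderiv ℝ φ y) := by
    filter_upwards [hm] with y hy
    refine form₂_ext fun u v => ?_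
    rw [chartRep_eq, compContinuousLinearMap_apply₂, compContinuousLinearMap_apply₂, ← hy]
    exact pullForm_apply _ _ _ _ _
  have hφx : φ (ψ x) = μ x := congrArg μ hx
  have hκ' : ContDiffAt ℝ ∞ κ (φ (ψ x)) := by rwa [hφx]
  have h2 := hm.self_of_nhds
  have h3 : chartDSymm x (ψ x) = ContinuousLinearMap.id ℝ E := chartDSymm_self x
  rw [h3, ContinuousLinearMap.comp_id] at h2
  rw [extD_apply₃, h1.extDeriv_eq, chartD_self]
  rw [extDeriv_pullback (hκ'.differentiableAt (by simp)) hφd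
    (by simp only [minSmoothness_of_isRCLikeNormedField]; exact ENat.LEInfty.out),
    compContinuousLinearMap_apply₃, hφx, ← h2, hx]
  rfl

end Operations


/-! ### Pullbacks to the `b^m`-tangent bundle -/

namespace BmStructure

variable {E M : Type*} [NormedAddCommGroup E] [NormedSpace ℝ E]
  [TopologicalSpace M] [ChartedSpace E M] {B : BmStructure E M}
  {F W : Type*} [NormedAddCommGroup F] [NormedSpace ℝ F] [NormedAddCommGroup W] [NormedSpace ℝ W]

/-- `D` is the differential of `μ`, extended over `Z` as a smooth `b^m`-form. -/
structure IsDifferential (μ : M → F) (D : ∀ x, B.tangent x →L[ℝ] F) : Prop where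
  smooth : ∀ x ∉ B.Z, ContMDiffAt 𝓘(ℝ, E) 𝓘(ℝ, F) ∞ μ x
  apply_lift : ∀ x ∉ B.Z, ∀ v : TangentSpace 𝓘(ℝ, E) x, D x (B.lift x v) = (mD μ x : E →L[ℝ] F) v
  local_form : ∀ p ∈ B.Z, ∃ (a : M → F) (β : DForm E M 1 F), ∀ᶠ x in 𝓝 p,
    ContMDiffAt 𝓘(ℝ, E) 𝓘(ℝ, F) ∞ a x ∧ SmoothFormAt β x ∧
    ∀ e : B.tangent x, D x e = B.coeff e • a x + β x ![B.anchor e]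

/-- The `b^m`-form `C ∘ D` of degree 1. -/
def bmComp (C : M → F →L[ℝ] W) (D : ∀ x, B.tangent x →L[ℝ] F) : B.BmForm 1 W := fun x =>
  ContinuousAlternatingMap.ofSubsingleton ℝ _ _ 0 ((C x).comp (D x))

/-- The `b^m`-form `P (D, D)` of degree 2. -/
def bmPull (P : M → F [⋀^Fin 2]→L[ℝ] W) (D : ∀ x, B.tangent x →L[ℝ] F) : B.BmForm 2 W := fun x =>
  (P x).compContinuousLinearMap (D x)

theorem bmComp_apply (C : M → F →L[ℝ] W) (D : ∀ x, B.tangent x →L[ℝ] F) (x : M)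
    (e : B.tangent x) : bmComp C D x ![e] = C x (D x e) := rfl

theorem bmPull_apply (P : M → F [⋀^Fin 2]→L[ℝ] W) (D : ∀ x, B.tangent x →L[ℝ] F) (x : M)
    (e e' : B.tangent x) : bmPull P D x ![e, e'] = P x ![D x e, D x e'] := by
  change P x (D x ∘ ![e, e']) = _
  congr 1
  ext i; fin_cases i <;> rfl

theorem offZ_add (σ σ' : B.BmForm 2 W) (x : M) :
    B.offZ (fun x => σ x + σ' x) x = B.offZ σ x + B.offZ σ' x := rfl

variable {μ : M → F} {D : ∀ x, B.tangent x →L[ℝ] F}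

theorem IsDifferential.offZ_bmComp (hD : IsDifferential μ D) (C : M → F →L[ℝ] W) {x : M}
    (hx : x ∉ B.Z) : B.offZ (bmComp C D) x = compForm C (dForm (E := E) μ) x := by
  refine form₁_ext (E := E) fun v => ?_
  refine (B.offZ_apply₁ _ x v).trans ((bmComp_apply C D x _).trans ?_)
  refine (congrArg (C x) (hD.apply_lift x hx v)).trans ?_
  exact (compForm_apply (E := E) C (dForm μ) x v).symm

theorem IsDifferential.offZ_bmPull (hD : IsDifferential μ D) (P : M → F [⋀^Fin 2]→L[ℝ] W) {x : M}
    (hx : x ∉ B.Z) : B.offZ (bmPull P D) x = pullForm P (dForm (E := E) μ) x := by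
  refine form₂_ext (E := E) fun u v => ?_
  refine (B.offZ_apply₂ _ x u v).trans ((bmPull_apply P D x _ _).trans ?_)
  refine (congrArg₂ (fun s t => P x ![s, t]) (hD.apply_lift x hx u) (hD.apply_lift x hx v)).trans ?_
  exact (pullForm_apply (E := E) P (dForm μ) x u v).symm

variable [IsManifold 𝓘(ℝ, E) ∞ M]

theorem IsDifferential.isSmooth₁_bmComp (hD : IsDifferential μ D) {C : M → F →L[ℝ] W}
    (hC : ∀ x, ContMDiffAt 𝓘(ℝ, E) 𝓘(ℝ, F →L[ℝ] W) ∞ C x) : B.IsSmooth₁ (bmComp C D) := by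
  refine ⟨fun x hx => ?_, fun p hp => ?_⟩
  · refine (smoothFormAt_compForm (hC x) (smoothFormAt_dForm (hD.smooth x hx))).congr ?_
    filter_upwards [B.Z_mem_nhds_compl hx] with z hz using hD.offZ_bmComp C hz
  · obtain ⟨a, β, h⟩ := hD.local_form p hp
    refine ⟨fun x => C x (a x), compForm C β, ?_⟩
    filter_upwards [h] with x hx
    obtain ⟨ha, hβ, hDx⟩ := hx
    refine ⟨(hC x).clm_apply ha, smoothFormAt_compForm (hC x) hβ, fun e => ?_⟩
    rw [bmComp_apply, hDx, map_add, map_smul, compForm_apply]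

/-- The term in `s s'` vanishes because `κ(a, a) = 0`. For this reason inserting a `b^m`-form twice
does not raise the order of the pole. -/
theorem form₂_add_smul (κ : F [⋀^Fin 2]→L[ℝ] ℝ) (s s' : ℝ) (a v v' : F) :
    κ ![s • a + v, s' • a + v'] = s * κ ![a, v'] - s' * κ ![a, v] + κ ![v, v'] := by
  have h1 : κ ![a, a] = 0 := by
    have := form₂_swap κ a a
    linarith
  have h2 := form₂_swap κ v a
  rw [← bilinOfForm_apply] at h1 h2 ⊢
  simp only [← bilinOfForm_apply] at *
  simp only [map_add, map_smul, add_apply, smul_apply, smul_eq_mul, h1, h2]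
  ring

/-- If `dμ = (df / f^m) a + β₁`, then `P(dμ, dμ) = (df / f^m) ∧ P(a, β₁) + P(β₁, β₁)`, which has the
required local form. -/
theorem IsDifferential.isSmooth₂_add_bmPull (hD : IsDifferential μ D) {σ : B.BmForm 2 ℝ}
    (hσ : B.IsSmooth₂ σ) {P : M → F [⋀^Fin 2]→L[ℝ] ℝ}
    (hP : ∀ x, ContMDiffAt 𝓘(ℝ, E) 𝓘(ℝ, F [⋀^Fin 2]→L[ℝ] ℝ) ∞ P x) :
    B.IsSmooth₂ fun x => σ x + bmPull P D x := by
  refine ⟨fun x hx => ?_, fun p hp => ?_⟩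
  · refine ((hσ.1 x hx).add
      (smoothFormAt_pullForm (hP x) (smoothFormAt_dForm (hD.smooth x hx)))).congr ?_
    filter_upwards [B.Z_mem_nhds_compl hx] with z hz
    rw [offZ_add, hD.offZ_bmPull P hz]
  · obtain ⟨a, β₁, h⟩ := hD.local_form p hp
    obtain ⟨α, β, h'⟩ := hσ.2 p hp
    refine ⟨fun x => α x + compForm (fun x => bilinOfForm F ℝ (P x) (a x)) β₁ x,
      fun x => β x + pullForm P β₁ x, ?_⟩
    filter_upwards [h, h'] with x hx hx'
    obtain ⟨ha, hβ₁, hDx⟩ := hx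
    obtain ⟨hα, hβ, hσx⟩ := hx'
    have hPa : ContMDiffAt 𝓘(ℝ, E) 𝓘(ℝ, F →L[ℝ] ℝ) ∞ (fun x => bilinOfForm F ℝ (P x) (a x)) x :=
      (ContMDiffAt.comp x (contDiff_bilinOfForm (E := F) (W := ℝ)).contMDiff.contMDiffAt
        (hP x)).clm_apply ha
    refine ⟨hα.add (smoothFormAt_compForm hPa hβ₁), hβ.add (smoothFormAt_pullForm (hP x) hβ₁),
      fun e e' => ?_⟩
    change σ x ![e, e'] + bmPull P D x ![e, e'] =
      B.coeff e * (α x ![B.anchor e'] +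
        compForm (fun x => bilinOfForm F ℝ (P x) (a x)) β₁ x ![B.anchor e']) -
      B.coeff e' * (α x ![B.anchor e] +
        compForm (fun x => bilinOfForm F ℝ (P x) (a x)) β₁ x ![B.anchor e]) +
      (β x ![B.anchor e, B.anchor e'] + pullForm P β₁ x ![B.anchor e, B.anchor e'])
    rw [hσx, bmPull_apply, hDx, hDx, form₂_add_smul, compForm_apply, compForm_apply,
      pullForm_apply, bilinOfForm_apply, bilinOfForm_apply]
    ring

end BmStructure


/-! ### Exponentiation of Hamiltonian spaces -/

section Exponentiation

open BmStructure

variable {E M F G : Type*} [NormedAddCommGroup E] [NormedSpace ℝ E]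
  [TopologicalSpace M] [ChartedSpace E M]
  [NormedAddCommGroup F] [NormedSpace ℝ F] [FiniteDimensional ℝ F]
  [TopologicalSpace G] [ChartedSpace F G] [Group G] [LieGroup 𝓘(ℝ, F) ∞ G] [T2Space G]
  {b : F →L[ℝ] F →L[ℝ] ℝ} {B : BmStructure E M} {μ : M → F}

theorem mD_lieExp_comp {x : M} (hμ : ContMDiffAt 𝓘(ℝ, E) 𝓘(ℝ, F) ∞ μ x) (v : E) :
    (mD (fun y => lieExp G (μ y)) x : E →L[ℝ] F) v =
      (mD (lieExp G) (μ x) : F →L[ℝ] F) ((mD μ x : E →L[ℝ] F) v) :=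
  congrArg (fun T : E →L[ℝ] F => T v) (mD_comp (mdiff_lieExp (μ x)) (mdiff_of_contMDiffAt hμ))

theorem thetaL_mD_lieExp_comp {x : M} (hμ : ContMDiffAt 𝓘(ℝ, E) 𝓘(ℝ, F) ∞ μ x) (v : E) :
    (dLeft (F := F) (lieExp G (μ x))⁻¹ (lieExp G (μ x)))
      ((mD (fun y => lieExp G (μ y)) x : E →L[ℝ] F) v) =
      phi₁ 1 (-adL G (μ x)) ((mD μ x : E →L[ℝ] F) v) := by
  rw [mD_lieExp_comp hμ, ← thetaL_comp_mD_lieExp]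
  rfl

theorem thetaR_mD_lieExp_comp {x : M} (hμ : ContMDiffAt 𝓘(ℝ, E) 𝓘(ℝ, F) ∞ μ x) (v : E) :
    (dRight (F := F) (lieExp G (μ x))⁻¹ (lieExp G (μ x)))
      ((mD (fun y => lieExp G (μ y)) x : E →L[ℝ] F) v) =
      phi₁ 1 (adL G (μ x)) ((mD μ x : E →L[ℝ] F) v) := by
  rw [mD_lieExp_comp hμ, ← thetaR_comp_mD_lieExp]
  rfl

theorem chi_lieExp_comp (hb : IsInvariantInner G b) {x : M}
    (hμ : ContMDiffAt 𝓘(ℝ, E) 𝓘(ℝ, F) ∞ μ x) (u v w : E) :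
    chi (F := F) b (lieExp G (μ x)) ((mD (fun y => lieExp G (μ y)) x : E →L[ℝ] F) u)
      ((mD (fun y => lieExp G (μ y)) x : E →L[ℝ] F) v)
      ((mD (fun y => lieExp G (μ y)) x : E →L[ℝ] F) w) =
      (1 / 2) * cubic (adL G) b (phi₁ 1 (-adL G (μ x)) ((mD μ x : E →L[ℝ] F) u))
        (phi₁ 1 (-adL G (μ x)) ((mD μ x : E →L[ℝ] F) v))
        (phi₁ 1 (-adL G (μ x)) ((mD μ x : E →L[ℝ] F) w)) := by
  rw [chi_eq hb, thetaL_mD_lieExp_comp hμ, thetaL_mD_lieExp_comp hμ, thetaL_mD_lieExp_comp hμ]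

/-- The form `ω₀ + μ^* ϖ`. -/
def expForm (b : F →L[ℝ] F →L[ℝ] ℝ) (ω₀ : B.BmForm 2 ℝ) (A : M → F →L[ℝ] F)
    (D : ∀ x, B.tangent x →L[ℝ] F) : B.BmForm 2 ℝ := fun x =>
  ω₀ x + bmPull (fun x => varpiForm b (A x)) D x

omit [FiniteDimensional ℝ F] in
theorem expForm_apply (b : F →L[ℝ] F →L[ℝ] ℝ) (ω₀ : B.BmForm 2 ℝ) (A : M → F →L[ℝ] F)
    (D : ∀ x, B.tangent x →L[ℝ] F) (x : M) (e e' : B.tangent x) :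
    expForm b ω₀ A D x ![e, e'] = ω₀ x ![e, e'] + varpiForm b (A x) ![D x e, D x e'] :=
  congrArg (ω₀ x ![e, e'] + ·) (bmPull_apply _ _ _ _ _)

variable {ω₀ : B.BmForm 2 ℝ} {A : M → F →L[ℝ] F} {D : ∀ x, B.tangent x →L[ℝ] F}

omit [T2Space G] in
theorem offZ_expForm (hD : IsDifferential μ D) (hA : ∀ x ∉ B.Z, A x = adL G (μ x)) {x : M}
    (hx : x ∉ B.Z) : B.offZ (expForm b ω₀ A D) x =
      B.offZ ω₀ x + pullForm (fun x => varpiForm b (adL G (μ x))) (dForm (E := E) μ) x := by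
  have h := hD.offZ_bmPull (fun x => varpiForm b (A x)) hx
  refine (congrArg (B.offZ ω₀ x + ·) h).trans ?_
  rw [pullForm, hA x hx]
  rfl

omit [T2Space G] in
theorem offZ_expForm_apply (hD : IsDifferential μ D) (hA : ∀ x ∉ B.Z, A x = adL G (μ x)) {x : M}
    (hx : x ∉ B.Z) (u v : TangentSpace 𝓘(ℝ, E) x) :
    B.offZ (expForm b ω₀ A D) x ![u, v] = B.offZ ω₀ x ![u, v] +
      varpiForm b (adL G (μ x)) ![(mD μ x : E →L[ℝ] F) u, (mD μ x : E →L[ℝ] F) v] := by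
  rw [offZ_expForm hD hA hx]
  exact congrArg (B.offZ ω₀ x ![u, v] + ·) (pullForm_apply _ _ _ _ _)

variable [IsManifold 𝓘(ℝ, E) ∞ M]

/-- Off `Z` this is the formula for the left-trivialized differential of `exp`. Over `Z` it is
smooth because the extensions of both `ad μ` and `dμ` are. -/
theorem isPullbackMC_bmComp (hD : IsDifferential μ D) (hA : ∀ x ∉ B.Z, A x = adL G (μ x))
    (hA' : ∀ x, ContMDiffAt 𝓘(ℝ, E) 𝓘(ℝ, F →L[ℝ] F) ∞ A x) :
    IsPullbackMC B (fun x => lieExp G (μ x)) (bmComp (fun x => phi₁ 1 (-A x)) D) := by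
  have : CompleteSpace F := FiniteDimensional.complete ℝ F
  refine ⟨hD.isSmooth₁_bmComp fun x => ?_, fun x hx v => ?_⟩
  · have h1 : ContDiff ℝ ∞ (fun A : F →L[ℝ] F => phi₁ 1 (-A)) :=
      contDiff_iff_contDiffAt.2 fun _ => contDiffAt_phi₁_comp 1 contDiffAt_id.neg
    exact h1.contMDiff.contMDiffAt.comp x (hA' x)
  · rw [hD.offZ_bmComp _ hx]
    refine (compForm_apply (E := E) _ (dForm μ) x v).trans ?_
    rw [hA x hx]
    exact (thetaL_mD_lieExp_comp (hD.smooth x hx) v).symm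

/-- The summand `ω₀` is closed, and the exterior derivative of `μ^*ϖ` is the pullback of `dϖ`. -/
theorem extD_expForm (hb : IsInvariantInner G b) (hD : IsDifferential μ D)
    (hA : ∀ x ∉ B.Z, A x = adL G (μ x)) (hω : B.IsSmooth₂ ω₀)
    (hcl : ∀ x ∉ B.Z, extD (B.offZ ω₀) x = 0) {x : M} (hx : x ∉ B.Z) (u v w : E) :
    extD (B.offZ (expForm b ω₀ A D)) x ![u, v, w] =
      - (1 / 2) * cubic (adL G) b (phi₁ 1 (-adL G (μ x)) ((mD μ x : E →L[ℝ] F) u))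
        (phi₁ 1 (-adL G (μ x)) ((mD μ x : E →L[ℝ] F) v))
        (phi₁ 1 (-adL G (μ x)) ((mD μ x : E →L[ℝ] F) w)) := by
  have : CompleteSpace F := FiniteDimensional.complete ℝ F
  have hd : ContDiff ℝ ∞ (fun η => varpiForm b (adL G η)) := contDiff_iff_contDiffAt.2 fun _ =>
    contDiffAt_varpiForm (adL G : F →L[ℝ] F →L[ℝ] F).contDiff.contDiffAt
  have hsm : SmoothFormAt (pullForm (fun x => varpiForm b (adL G (μ x))) (dForm (E := E) μ)) x :=
    smoothFormAt_pullForm (hd.contMDiff.contMDiffAt.comp x (hD.smooth x hx))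
      (smoothFormAt_dForm (hD.smooth x hx))
  have h1 := chartRep_congr (κ := fun x => B.offZ ω₀ x +
      pullForm (fun x => varpiForm b (adL G (μ x))) (dForm (E := E) μ) x)
    (κ' := B.offZ (expForm b ω₀ A D)) (x := x) (by
      filter_upwards [B.Z_mem_nhds_compl hx] with z hz using offZ_expForm hD hA hz)
  have h2 : extDeriv (chartRep (B.offZ (expForm b ω₀ A D)) x) (extChartAt 𝓘(ℝ, E) x x) =
      extDeriv (chartRep (B.offZ ω₀) x) (extChartAt 𝓘(ℝ, E) x x) +
      extDeriv (chartRep (pullForm (fun x => varpiForm b (adL G (μ x))) (dForm (E := E) μ)) x)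
        (extChartAt 𝓘(ℝ, E) x x) := by
    rw [h1.extDeriv_eq]
    exact extDeriv_fun_add (ContDiffAt.differentiableAt (hω.1 x hx) (by simp))
      (ContDiffAt.differentiableAt hsm (by simp))
  have h3 : extD (B.offZ ω₀) x ![u, v, w] = 0 :=
    congrArg (fun κ : E [⋀^Fin 3]→L[ℝ] ℝ => κ ![u, v, w]) (hcl x hx)
  rw [extD_apply₃] at h3
  have h4 := extD_pullForm_dForm (W := ℝ) hd.contDiffAt (hD.smooth x hx) u v w
  rw [extD_apply₃, extDeriv_varpiForm hb] at h4
  rw [extD_apply₃, h2]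
  exact (congrArg₂ (· + ·) h3 h4).trans (zero_add _)

omit [FiniteDimensional ℝ F] [LieGroup 𝓘(ℝ, F) ∞ G] [T2Space G] in
/-- The `b^m`-form `Φ^* θ` is unique. -/
theorem IsPullbackMC.unique {Φ : M → G} {τ τ' : B.BmForm 1 F} (h : IsPullbackMC B Φ τ)
    (h' : IsPullbackMC B Φ τ') (x : M) (e : B.tangent x) : τ x ![e] = τ' x ![e] := by
  have hoff : ∀ z ∉ B.Z, ∀ e : B.tangent z, τ z ![e] = τ' z ![e] := fun z hz e => by
    have h1 := (h.2 z hz (B.anchor e)).trans (h'.2 z hz (B.anchor e)).symm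
    rwa [B.offZ_apply₁, B.offZ_apply₁, B.lift_anchor hz] at h1
  by_cases hx : x ∈ B.Z
  · obtain ⟨a, β, hβ⟩ := h.1.2 x hx
    obtain ⟨a', β', hβ'⟩ := h'.1.2 x hx
    have h0 := hβ.self_of_nhds
    have h0' := hβ'.self_of_nhds
    rw [h0.2.2, h0'.2.2]
    refine eq_of_eventually_eq_compl hx h0.1 h0'.1 h0.2.1 h0'.2.1 ?_ e
    filter_upwards [hβ, hβ'] with z hz hz' hzZ e
    rw [← hz.2.2, ← hz'.2.2, hoff z hzZ]
  · exact hoff x hx e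

/-- The value of `Φ^*θ^l` on `e` is `φ₁(-A) (dμ e)`, so injectivity gives `dμ e = 0`. Then the
`ϖ`-term of the contraction with `e` vanishes, and non-degeneracy of `ω₀` finishes. -/
theorem weaklyNondegenerateAt_expForm (hD : IsDifferential μ D)
    (hA : ∀ x ∉ B.Z, A x = adL G (μ x))
    (hA' : ∀ x, ContMDiffAt 𝓘(ℝ, E) 𝓘(ℝ, F →L[ℝ] F) ∞ A x) {x : M}
    (hω : ∀ e : B.tangent x, (∀ e', ω₀ x ![e, e'] = 0) → e = 0)
    (hx : Function.Injective (phi₁ 1 (-A x))) :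
    WeaklyNondegenerateAt F B (expForm b ω₀ A D) (fun x => lieExp G (μ x)) x := by
  rintro e he ⟨τ, hτ, hτe⟩
  have h1 : phi₁ 1 (-A x) (D x e) = 0 := by
    rw [← hτe, hτ.unique (isPullbackMC_bmComp hD hA hA') x e]
    rfl
  have h2 : D x e = 0 := hx (h1.trans (map_zero _).symm)
  refine hω e fun e' => ?_
  have h3 := he e'
  rw [expForm_apply, h2, (varpiForm b (A x)).map_coord_zero (m := ![0, D x e']) 0 rfl, add_zero] at h3
  exact h3

theorem injective_of_dexp_bijective {η : F} (h : Function.Bijective (dexp G η)) :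
    Function.Injective (phi₁ 1 (-adL G η)) := by
  rw [← dexpL_eq]
  exact (dLeft_inv_injective (F := F) (lieExp G η)).comp h.1

omit [IsManifold 𝓘(ℝ, E) ∞ M] in
-- Off `Z` the left-trivialized differential is `φ₁(-A)`, which is continuous at `p`. Since `p` lies
-- in the closure of the complement of `Z`, the limit is unique.
theorem phi₁_eq_of_tendsto_dexpL (hA : ∀ x ∉ B.Z, A x = adL G (μ x)) {p : M}
    (hA' : ContMDiffAt 𝓘(ℝ, E) 𝓘(ℝ, F →L[ℝ] F) ∞ A p) (hp : p ∈ B.Z) {T : F →L[ℝ] F}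
    (hT : Tendsto (fun x => dexpL G (μ x)) (𝓝[B.Zᶜ] p) (𝓝 T)) : phi₁ 1 (-A p) = T := by
  have : CompleteSpace F := FiniteDimensional.complete ℝ F
  have := B.nhdsWithin_compl_neBot hp
  have h1 : ContinuousAt (fun A : F →L[ℝ] F => phi₁ 1 (-A)) (A p) :=
    (contDiffAt_phi₁_comp (n := ∞) 1 contDiffAt_id.neg).continuousAt
  have h2 : Tendsto (fun x => phi₁ 1 (-A x)) (𝓝[B.Zᶜ] p) (𝓝 (phi₁ 1 (-A p))) :=
    (h1.tendsto.comp hA'.continuousAt.tendsto).mono_left nhdsWithin_le_nhds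
  refine tendsto_nhds_unique_of_eventuallyEq h2 hT ?_
  filter_upwards [self_mem_nhdsWithin] with x hx
  rw [hA x hx, dexpL_eq]

variable [MulAction G M] [ContMDiffSMul 𝓘(ℝ, F) 𝓘(ℝ, E) ∞ G M]

/-- The axioms of a quasi-Hamiltonian space except non-degeneracy. -/
theorem IsBmHamiltonian.isBmPreQuasiHamiltonian (hb : IsInvariantInner G b)
    (h₀ : IsBmHamiltonian G B b ω₀ μ) (hD : IsDifferential μ D)
    (hA : ∀ x ∉ B.Z, A x = adL G (μ x))
    (hA' : ∀ x, ContMDiffAt 𝓘(ℝ, E) 𝓘(ℝ, F →L[ℝ] F) ∞ A x) :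
    IsBmPreQuasiHamiltonian B b (expForm b ω₀ A D) (fun x => lieExp G (μ x)) where
  smul_mem_Z := h₀.smul_mem_Z
  smooth := by
    have : CompleteSpace F := FiniteDimensional.complete ℝ F
    have hd : ContDiff ℝ ∞ (fun A : F →L[ℝ] F => varpiForm b A) :=
      contDiff_iff_contDiffAt.2 fun _ => contDiffAt_varpiForm contDiffAt_id
    exact hD.isSmooth₂_add_bmPull h₀.smooth fun x => hd.contMDiff.contMDiffAt.comp x (hA' x)
  invariant := fun g x hx u v => by
    have hc : ∀ u, (mD μ (g • x) : E →L[ℝ] F) ((mD (fun y : M => g • y) x : E →L[ℝ] E) u) =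
        Ad g ((mD μ x : E →L[ℝ] F) u) := fun u =>
      congrArg (fun T : E →L[ℝ] F => T u) (h₀.mD_comp_smul g hx)
    have h := h₀.invariant g x hx u v
    rw [offZ_expForm_apply hD hA hx, offZ_expForm_apply hD hA (h₀.smul_notMem_Z g hx), h]
    congr 1
    have h1 := varpiForm_Ad g hb (μ x) ((mD μ x : E →L[ℝ] F) u) ((mD μ x : E →L[ℝ] F) v)
    rw [← h1, ← hc u, ← hc v, h₀.equivariant g x hx]
    rfl
  smooth_map := fun x hx =>
    (contMDiff_lieExp.contMDiffAt.comp x (h₀.contMDiffAt hx)).contMDiffWithinAt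
  singular_map := ⟨_, isPullbackMC_bmComp hD hA hA'⟩
  equivariant := fun g x hx => by
    rw [h₀.equivariant g x hx, lieExp_Ad]
  equivariantly_closed := fun x hx u v w => by
    refine (extD_expForm hb hD hA h₀.smooth h₀.closed hx u v w).trans ?_
    have h := chi_lieExp_comp hb (h₀.contMDiffAt hx) u v w
    rw [neg_mul]
    exact congrArg Neg.neg h.symm
  moment := fun ξ x hx v => by
    -- The moment condition of `ω₀` contributes `(dμ v, ξ)`, which cancels the last term of the
    -- contraction of `ϖ`.
    rw [offZ_expForm_apply hD hA hx, h₀.moment ξ x hx v, h₀.mD_fundVF ξ hx, varpiForm_moment hb]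
    refine (add_sub_cancel _ _).trans (congrArg (fun X => (1 / 2) * b X ξ) ?_)
    exact (congrArg₂ (· + ·) (thetaL_mD_lieExp_comp (h₀.contMDiffAt hx) v)
      (thetaR_mD_lieExp_comp (h₀.contMDiffAt hx) v)).symm

end Exponentiation

end BmQH

end

/-! ### The main theorem -/

theorem mainTheorem10
    {E : Type*} [NormedAddCommGroup E] [NormedSpace ℝ E] [FiniteDimensional ℝ E]
    {M : Type*} [TopologicalSpace M] [ChartedSpace E M] [IsManifold 𝓘(ℝ, E) ∞ M]
    [T2Space M] [SecondCountableTopology M]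
    {F : Type*} [NormedAddCommGroup F] [NormedSpace ℝ F] [FiniteDimensional ℝ F]
    {G : Type*} [TopologicalSpace G] [ChartedSpace F G] [Group G] [LieGroup 𝓘(ℝ, F) ∞ G]
    [T2Space G]
    [MulAction G M] [ContMDiffSMul 𝓘(ℝ, F) 𝓘(ℝ, E) ∞ G M]
    (b : F →L[ℝ] F →L[ℝ] ℝ) (hb : BmQH.IsInvariantInner G b)
    (B : BmQH.BmStructure E M) (ω₀ : B.BmForm 2 ℝ) (μ : M → F)
    (h₀ : BmQH.IsBmHamiltonian G B b ω₀ μ) :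
    ∃ σ : B.BmForm 2 ℝ,
      (∀ x ∉ B.Z, ∀ u v : TangentSpace 𝓘(ℝ, E) x,
        B.offZ σ x ![u, v] = B.offZ ω₀ x ![u, v] +
          BmQH.varpi G b (μ x) (mfderiv 𝓘(ℝ, E) 𝓘(ℝ, F) μ x u)
            (mfderiv 𝓘(ℝ, E) 𝓘(ℝ, F) μ x v)) ∧
      BmQH.IsBmPreQuasiHamiltonian B b σ (fun x => BmQH.lieExp G (μ x)) ∧
      (BmQH.DexpBijectiveOffZ G B μ →
        ∀ x ∉ B.Z, BmQH.WeaklyNondegenerateAt F B σ (fun x => BmQH.lieExp G (μ x)) x) ∧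
      (BmQH.DexpBijectiveOffZ G B μ → BmQH.DexpBijectiveOnZ G B μ →
        BmQH.IsBmQuasiHamiltonian B b σ (fun x => BmQH.lieExp G (μ x))) := by
  -- `A` extends `ad μ` and `D` extends `dμ` over `Z`; the form `σ` is assembled from these and
  -- `ω₀`.
  obtain ⟨A, hA, hA'⟩ := h₀.exists_ad hb
  obtain ⟨D, hDoff, hDloc⟩ := h₀.exists_dmu
  have hD : BmQH.BmStructure.IsDifferential μ D :=
    ⟨fun x hx => h₀.contMDiffAt hx, fun x hx v => by
      rw [hDoff x hx]
      exact congrArg (BmQH.mD μ x : E →L[ℝ] F) (B.anchor_lift hx v), hDloc⟩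
  have hpre := h₀.isBmPreQuasiHamiltonian hb hD hA hA'
  have hoff : BmQH.DexpBijectiveOffZ G B μ → ∀ x ∉ B.Z, BmQH.WeaklyNondegenerateAt F B
      (BmQH.expForm b ω₀ A D) (fun x => BmQH.lieExp G (μ x)) x := fun h x hx => by
    refine BmQH.weaklyNondegenerateAt_expForm hD hA hA' (h₀.nondegenerate x) ?_
    rw [hA x hx]
    exact BmQH.injective_of_dexp_bijective (h x hx)
  refine ⟨BmQH.expForm b ω₀ A D, fun x hx u v => ?_, hpre, hoff, fun h h' => ⟨hpre, fun x => ?_⟩⟩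
  · rw [BmQH.offZ_expForm_apply hD hA hx]
    exact congrArg (B.offZ ω₀ x ![u, v] + ·) (BmQH.varpi_eq_varpiForm hb _ _ _).symm
  · by_cases hx : x ∈ B.Z
    · obtain ⟨T, hT, hTb⟩ := h' x hx
      refine BmQH.weaklyNondegenerateAt_expForm hD hA hA' (h₀.nondegenerate x) ?_
      rw [BmQH.phi₁_eq_of_tendsto_dexpL hA (hA' x) hx hT]
      exact hTb.1
    · exact hoff h x hx
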